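/- \textbf{Setting.} Let $n\ge 0$, $C\ge1$, and let $A_{-1},A_0,A_1,B_0,C_0$ be real $n\times n$ matrices, with $A_{\pm1}$ entrywise nonnegative, with $A_0,B_0,C_0$ having nonnegative off-diagonal entries, and with $(A_{-1}+A_0+A_1)\mathbf 1=(B_0+A_1)\mathbf 1=(A_{-1}+C_0)\mathbf 1=\mathbf 0$. Let $Q$ be the block-tridiagonal generator, on the states $(k,i)$ with level $0\le k\le C$ and phase $1\le i\le n$, whose diagonal blocks are $B_0,A_0,\dots,A_0,C_0$, whose superdiagonal blocks are $A_1$ and whose subdiagonal blocks are $A_{-1}$ (a finite QBD process). The unrestricted process is the QBD process on the levels $0,1,2,\dots$ with diagonal blocks $B_0,A_0,A_0,\dots$ and the same off-diagonal blocks. Assume that $Q$, the unrestricted process and the phase generator $A_{-1}+A_0+A_1$ are irreducible, and that the unrestricted process is not null-recurrent (it is transient or positive recurrent). Let $G$ and $\hat G$ be the minimal nonnegative solutions of $A_{-1}+A_0X+A_1X^2=0$ and $A_1+A_0X+A_{-1}X^2=0$, let $H_0=-(A_0+A_1G+A_{-1}\hat G)^{-1}$ and, for $0\le k\le C$, $$\mu_k=\mu_k(C)=\sum_{j=0}^{k-1}G^jH_0\mathbf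 1+\sum_{j=1}^{C-k}\hat G^jH_0\mathbf 1 .$$ Let $M_{(k,i)(\ell,j)}$ be the mean first entrance time to $(\ell,j)$ of the process with generator $Q$ started in $(k,i)$ (zero if $(k,i)=(\ell,j)$), let $M_{k,\ell}$ be the $n\times n$ block $(M_{(k,i)(\ell,j)})_{i,j}$ and $m^{(j)}_{k,\ell}=M_{k,\ell}e_j$ its $j$th column. For a phase $j$, let $\bar A^{(j)}_{\pm1}$ be $A_{\pm1}$ with row $j$ replaced by $0$, and let $\bar B^{(j)}_0,\bar A^{(j)}_0,\bar C^{(j)}_0$ be $B_0,A_0,C_0$ with row $j$ replaced by $-e_j^\top$. Let $Q^{(\ell,j)}$ be $Q$ with its row $(\ell,j)$ replaced by minus the unit row vector of $(\ell,j)$ (in state $(\ell,j)$ the only transition is absorption, at rate $1$). For a set $E$ of levels, the generator of the chain $T=Q^{(\ell,j)}$ restricted to the levels in $E$ is $T_{EE}+T_{EE^c}(-T_{E^cE^c})^{-1}T_{E^cE}$. A square matrix is called a transient generator if its off-diagonal entries are nonnegative, its row sums are nonpositive, and its exponential $e^{t\,\cdot}$ tends to $0$ as $t\to\infty$. \textbf{Proposition.}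 The minimal solutions $G,\hat G$ exist, $A_0+A_1G+A_{-1}\hat G$ is invertible, all the $M_{(k,i)(\ell,j)}$ are finite, and the following holds for all $0\le k\le C$ and all phases $j$. In each case (i)--(iv), $Z=\mathring Q K$, where $\mathring Q$ is the generator of the chain $Q^{(\ell,j)}$ restricted to the levels indicated (the inverse in its definition exists), $\mathring Q$ is a transient generator, and $K$ and $Z$ are invertible. (i) $\ell=0$: $m^{(j)}_{k,0}=G^kv+\hat G^{C-k}w+\mu_k$, where $$\begin{bmatrix}v\\w\end{bmatrix}=(-Z)^{-1}\begin{bmatrix}\mathbf 1-e_j+\bar B_0^{(j)}\mu_0+\bar A_1^{(j)}\mu_1\\ \mathbf 1+A_{-1}\mu_{C-1}+C_0\mu_C\end{bmatrix},\quad Z=\begin{bmatrix}\bar B_0^{(j)}+\bar A_1^{(j)}G&(\bar B_0^{(j)}\hat G+\bar A_1^{(j)})\hat G^{C-1}\\(A_{-1}+C_0G)G^{C-1}&A_{-1}\hat G+C_0\end{bmatrix},$$ with levels $0,C$ and $K=\begin{bmatrix}I&\hat G^C\\G^C&I\end{bmatrix}$. (ii) $1\le\ell\le C-2$: $m^{(j)}_{k,\ell}=G^kv^-+\hat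 G^{\ell-k}w^-+\mu_k$ if $k\le\ell$ and $m^{(j)}_{k,\ell}=G^{k-\ell-1}v^++\hat G^{C-k}w^++\mu_k$ if $k\ge\ell+1$, where $$\begin{bmatrix}v^-\\w^-\\v^+\\w^+\end{bmatrix}=(-Z)^{-1}\begin{bmatrix}\mathbf 1+B_0\mu_0+A_1\mu_1\\ \mathbf 1-e_j+\bar A_{-1}^{(j)}\mu_{\ell-1}+\bar A_0^{(j)}\mu_\ell+\bar A_1^{(j)}\mu_{\ell+1}\\ \mathbf 1+A_{-1}\mu_\ell+A_0\mu_{\ell+1}+A_1\mu_{\ell+2}\\ \mathbf 1+A_{-1}\mu_{C-1}+C_0\mu_C\end{bmatrix},$$ $$Z=\begin{bmatrix}B_0+A_1G&(B_0\hat G+A_1)\hat G^{\ell-1}&0&0\\(\bar A_{-1}^{(j)}+\bar A_0^{(j)}G)G^{\ell-1}&\bar A_{-1}^{(j)}\hat G+\bar A_0^{(j)}&\bar A_1^{(j)}&\bar A_1^{(j)}\hat G^{C-\ell-1}\\A_{-1}G^\ell&A_{-1}&A_0+A_1G&(A_0\hat G+A_1)\hat G^{C-\ell-2}\\0&0&(C_0G+A_{-1})G^{C-\ell-2}&C_0+A_{-1}\hat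 G\end{bmatrix},$$ with levels $0,\ell,\ell+1,C$ and $K=\begin{bmatrix}I&\hat G^\ell&0&0\\G^\ell&I&0&0\\0&0&I&\hat G^{C-\ell-1}\\0&0&G^{C-\ell-1}&I\end{bmatrix}$. (iii) $\ell=C-1$ and $C\ge2$: $m^{(j)}_{k,C-1}=G^kv+\hat G^{C-1-k}w+\mu_k$ if $k\le C-1$ and $m^{(j)}_{C,C-1}=x+\mu_C$, where $$\begin{bmatrix}v\\w\\x\end{bmatrix}=(-Z)^{-1}\begin{bmatrix}\mathbf 1+B_0\mu_0+A_1\mu_1\\ \mathbf 1-e_j+\bar A_{-1}^{(j)}\mu_{C-2}+\bar A_0^{(j)}\mu_{C-1}+\bar A_1^{(j)}\mu_C\\ \mathbf 1+A_{-1}\mu_{C-1}+C_0\mu_C\end{bmatrix},$$ $$Z=\begin{bmatrix}B_0+A_1G&(B_0\hat G+A_1)\hat G^{C-2}&0\\(\bar A_{-1}^{(j)}+\bar A_0^{(j)}G)G^{C-2}&\bar A_{-1}^{(j)}\hat G+\bar A_0^{(j)}&\bar A_1^{(j)}\\A_{-1}G^{C-1}&A_{-1}&C_0\end{bmatrix},$$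 with levels $0,C-1,C$ and $K=\begin{bmatrix}I&\hat G^{C-1}&0\\G^{C-1}&I&0\\0&0&I\end{bmatrix}$. (iv) $\ell=C$: $m^{(j)}_{k,C}=G^kv+\hat G^{C-k}w+\mu_k$, where $$\begin{bmatrix}v\\w\end{bmatrix}=(-Z)^{-1}\begin{bmatrix}\mathbf 1+B_0\mu_0+A_1\mu_1\\ \mathbf 1-e_j+\bar A_{-1}^{(j)}\mu_{C-1}+\bar C_0^{(j)}\mu_C\end{bmatrix},\quad Z=\begin{bmatrix}B_0+A_1G&(B_0\hat G+A_1)\hat G^{C-1}\\(\bar A_{-1}^{(j)}+\bar C_0^{(j)}G)G^{C-1}&\bar A_{-1}^{(j)}\hat G+\bar C_0^{(j)}\end{bmatrix},$$ with levels $0,C$ and $K=\begin{bmatrix}I&\hat G^C\\G^C&I\end{bmatrix}$. Moreover, if $\pi=(\pi_0,\dots,\pi_C)$ is the stationary probability vector of $Q$, then the integral defining the deviation matrix $D=\int_0^\infty(e^{Qu}-\mathbf 1\pi)\,du$ converges absolutely, and the blocks of $D$ are, for $0\le k,\ell\le C$, $$D_{k,\ell}=\Bigl[\mathbf 1_n\otimes\sum_{x=0}^C\pi_xM_{x,\ell}-M_{k,\ell}\Bigr]\operatorname{diag}(\pi_\ell).$$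 -/

import Mathlib

open MeasureTheory ProbabilityTheory Filter Topology
open scoped ENNReal

noncomputable section

/-! ### Continuous-time Markov chains on a countable state space -/

/-- The generator (conservative Q-matrix) of a continuous-time Markov chain: nonnegative
off-diagonal rates, finite exit rates, row sums equal to zero. -/
structure MarkovGenerator (S : Type*) where
  rate : S → S → ℝ
  rate_nonneg : ∀ x y, x ≠ y → 0 ≤ rate x y
  hasSum_rate : ∀ x, HasSum (rate x) 0

/-- Every state can be reached from every state through transitions of positive rate. -/
def IrreducibleRates {S : Type*} (q : S → S → ℝ) : Prop :=
  ∀ x y, Relation.ReflTransGen (fun a b => 0 < q a b) x y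

/-- The sequence `y` does not visit the state `s` at any of the steps `a, …, k`. -/
def Avoids {S : Type*} (y : ℕ → S) (s : S) (a k : ℕ) : Prop :=
  ∀ m, a ≤ m → m ≤ k → y m ≠ s

instance isProbabilityMeasure_expOne : IsProbabilityMeasure (expMeasure 1) :=
  isProbabilityMeasure_expMeasure one_pos

namespace MarkovGenerator

variable {S : Type*} (Q : MarkovGenerator S)

/-- The exit rate of a state. -/
def exitRate (x : S) : ℝ := -Q.rate x x

open Classical in
lemma hasSum_jump (x : S) (hx : Q.exitRate x ≠ 0) :
    HasSum (fun y => if y = x then 0 else ENNReal.ofReal (Q.rate x y / Q.exitRate x)) 1 := by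
  have h0 : HasSum (fun y => if y = x then 0 else Q.rate x y) (Q.exitRate x) := by
    have h := (Q.hasSum_rate x).update x 0
    have e : (0 : ℝ) - Q.rate x x + 0 = Q.exitRate x := by simp [exitRate]
    have e2 : (fun y => if y = x then 0 else Q.rate x y) = Function.update (Q.rate x) x 0 := by
      funext y
      by_cases hy : y = x
      · subst hy; simp
      · simp [hy]
    rw [e2, ← e]
    simpa [sub_eq_add_neg, add_comm] using h
  have hpos : 0 ≤ Q.exitRate x := by
    refine h0.nonneg fun y => ?_
    by_cases hy : y = x
    · simp [hy]
    · simpa [hy] using Q.rate_nonneg x y (Ne.symm hy)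
  have h1 : HasSum (fun y => (if y = x then 0 else Q.rate x y) / Q.exitRate x) 1 := by
    have := h0.div_const (Q.exitRate x)
    rwa [div_self hx] at this
  have hn : ∀ y, 0 ≤ (if y = x then 0 else Q.rate x y) / Q.exitRate x := by
    intro y
    refine div_nonneg ?_ hpos
    by_cases hy : y = x
    · simp [hy]
    · simpa [hy] using Q.rate_nonneg x y (Ne.symm hy)
  have h2 := ENNReal.ofReal_tsum_of_nonneg hn h1.summable
  rw [h1.tsum_eq, ENNReal.ofReal_one] at h2
  have h3 : HasSum (fun y => ENNReal.ofReal ((if y = x then 0 else Q.rate x y) / Q.exitRate x)) 1 := by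
    rw [h2]; exact ENNReal.summable.hasSum
  convert h3 using 1
  funext y
  by_cases hy : y = x <;> simp [hy]

open Classical in
/-- The law of the state entered at the first jump out of `x` (a state with exit rate zero is
absorbing). -/
def jump (x : S) : PMF S :=
  if hx : Q.exitRate x = 0 then PMF.pure x
  else ⟨fun y => if y = x then 0 else ENNReal.ofReal (Q.rate x y / Q.exitRate x),
    Q.hasSum_jump x hx⟩

variable [MeasurableSpace S] [MeasurableSingletonClass S] [Countable S]

/-- The transition kernel of the embedded jump chain. -/
def jumpKernel : Kernel S S := Kernel.ofFunOfCountable fun x => (Q.jump x).toMeasure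

instance : IsMarkovKernel Q.jumpKernel :=
  ⟨fun x => by
    change IsProbabilityMeasure ((Q.jump x).toMeasure)
    infer_instance⟩

/-- The next state of the jump chain, given its whole past. -/
def historyKernel (k : ℕ) : Kernel (Finset.Iic k → S) S :=
  Q.jumpKernel.comap (fun h => h ⟨k, Finset.mem_Iic.2 le_rfl⟩) (measurable_pi_apply _)

instance (k : ℕ) : IsMarkovKernel (Q.historyKernel k) := by
  unfold historyKernel; infer_instance

/-- The law of the jump chain started in `x`. -/
def jumpLaw (x : S) : Measure (ℕ → S) :=
  Kernel.trajMeasure (X := fun _ => S) (Measure.dirac x) Q.historyKernel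

/-- The law, for the chain started in `x`, of the pair `(y, e)`, where `y` is the sequence of the
successively visited states and `e` is an independent sequence of independent exponential
variables of mean one. The chain stays `e k / exitRate (y k)` units of time in its `k`-th state,
and then jumps to `y (k + 1)`. -/
def law (x : S) : Measure ((ℕ → S) × (ℕ → ℝ)) :=
  (Q.jumpLaw x).prod (Measure.infinitePi fun _ : ℕ => expMeasure 1)

/-- The time spent in the `k`-th visited state. -/
def holdingTime (ω : (ℕ → S) × (ℕ → ℝ)) (k : ℕ) : ℝ≥0∞ :=
  ENNReal.ofReal (ω.2 k) / ENNReal.ofReal (Q.exitRate (ω.1 k))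

open Classical in
/-- The first entrance time to `s` (it is zero if the chain starts in `s`, and it is the sum of all
holding times if `s` is never visited). -/
def entranceTime (s : S) (ω : (ℕ → S) × (ℕ → ℝ)) : ℝ≥0∞ :=
  ∑' k, if Avoids ω.1 s 0 k then Q.holdingTime ω k else 0

open Classical in
/-- The time of the first visit to `s` after at least one jump. -/
def returnTime (s : S) (ω : (ℕ → S) × (ℕ → ℝ)) : ℝ≥0∞ :=
  ∑' k, if Avoids ω.1 s 1 k then Q.holdingTime ω k else 0

/-- The mean first entrance time to `s` from `x`. -/
def meanEntranceTime (x s : S) : ℝ≥0∞ := ∫⁻ ω, Q.entranceTime s ω ∂(Q.law x)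

/-- The chain started in `x` almost surely returns to `x`. -/
def IsRecurrentState (x : S) : Prop := ∀ᵐ ω ∂(Q.law x), ∃ k, 1 ≤ k ∧ ω.1 k = x

/-- The chain started in `x` almost surely returns to `x`, and the mean return time is infinite
(an absorbing state is not null-recurrent). -/
def IsNullRecurrentState (x : S) : Prop :=
  Q.IsRecurrentState x ∧ Q.exitRate x ≠ 0 ∧ ∫⁻ ω, Q.returnTime x ω ∂(Q.law x) = ∞

end MarkovGenerator

/-! ### Matrices attached to finite chains -/

/-- The stationary probability vectors of a finite generator. -/
def IsStationaryVector {S : Type*} [Fintype S] (Q : Matrix S S ℝ) (p : S → ℝ) : Prop :=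
  (∀ x, 0 ≤ p x) ∧ ∑ x, p x = 1 ∧ Matrix.vecMul p Q = 0

/-- The integrand of the deviation matrix, `exp (u Q) - 1 p`. -/
def deviationIntegrand {S : Type*} [Fintype S] [DecidableEq S] (Q : Matrix S S ℝ) (p : S → ℝ)
    (x y : S) (u : ℝ) : ℝ :=
  NormedSpace.exp (u • Q) x y - p y

/-- The deviation matrix `∫₀^∞ (exp (u Q) - 1 p) du`. -/
def deviationMatrix {S : Type*} [Fintype S] [DecidableEq S] (Q : Matrix S S ℝ) (p : S → ℝ) :
    Matrix S S ℝ :=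
  Matrix.of fun x y => ∫ u in Set.Ioi (0 : ℝ), deviationIntegrand Q p x y u

/-- The generator of a transient (eventually absorbed) finite chain: nonnegative off-diagonal
entries, nonpositive row sums (the missing mass is the absorption rate), and a transition function
that tends to zero. -/
def IsTransientGenerator {S : Type*} [Fintype S] [DecidableEq S] (T : Matrix S S ℝ) : Prop :=
  (∀ x y, x ≠ y → 0 ≤ T x y) ∧ (∀ x, ∑ y, T x y ≤ 0) ∧
    ∀ x y, Tendsto (fun t : ℝ => NormedSpace.exp (t • T) x y) atTop (𝓝 0)

/-- The matrix `Q` with its row `s` replaced by minus the unit vector of `s`: from `s`, the only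
transition is absorption, at rate one. -/
def absorbAt {S : Type*} [DecidableEq S] (Q : Matrix S S ℝ) (s : S) : Matrix S S ℝ :=
  Q.updateRow s (-Pi.single s 1)

section Restriction

variable {L P : Type*} [Fintype L] [DecidableEq L] [Fintype P] [DecidableEq P] {r : ℕ}

/-- The block of `T` of the states whose level is not among the levels `e 0, …, e (r - 1)`. -/
def outerBlock (T : Matrix (L × P) (L × P) ℝ) (e : Fin r → L) :
    Matrix {x : L × P // ∀ a, e a ≠ x.1} {x : L × P // ∀ a, e a ≠ x.1} ℝ :=
  T.submatrix Subtype.val Subtype.val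

/-- The generator of the chain with generator `T`, restricted to (that is, observed only while it
is in) the levels `e 0, …, e (r - 1)`: `T₁₁ + T₁₂ (-T₂₂)⁻¹ T₂₁`, where the index 1 stands for
these levels and 2 for the other ones. -/
def restrictToLevels (T : Matrix (L × P) (L × P) ℝ) (e : Fin r → L) :
    Matrix (Fin r × P) (Fin r × P) ℝ :=
  let inn : Fin r × P → L × P := fun a => (e a.1, a.2)
  let out : {x : L × P // ∀ a, e a ≠ x.1} → L × P := Subtype.val
  T.submatrix inn inn + T.submatrix inn out * (-outerBlock T e)⁻¹ * T.submatrix out inn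

/-- A block matrix with square blocks as an ordinary matrix. -/
def flat (Z : Matrix (Fin r) (Fin r) (Matrix P P ℝ)) : Matrix (Fin r × P) (Fin r × P) ℝ :=
  Matrix.comp _ _ _ _ _ Z

/-- `Z` is the product of the generator of a transient chain, namely of the chain `T` restricted
to the levels `e 0, …, e (r - 1)`, and the invertible matrix `K`; the inverse that occurs in the
definition of the restricted chain exists, and `Z` is invertible. -/
def FactorsThroughRestriction (T : Matrix (L × P) (L × P) ℝ) (e : Fin r → L)
    (Z K : Matrix (Fin r) (Fin r) (Matrix P P ℝ)) : Prop :=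
  IsUnit (outerBlock T e) ∧ IsTransientGenerator (restrictToLevels T e) ∧
    IsUnit (flat K) ∧ IsUnit (flat Z) ∧ flat Z = restrictToLevels T e * flat K

/-- The solution `x = (-Z)⁻¹ b` of a block system, as a tuple of blocks. -/
def blockSolve (Z : Matrix (Fin r) (Fin r) (Matrix P P ℝ)) (b : Fin r → P → ℝ) : Fin r → P → ℝ :=
  fun a i => ((-flat Z)⁻¹.mulVec fun c => b c.1 c.2) (a, i)

end Restriction

/-! ### Minimal nonnegative solutions of matrix quadratic equations -/

/-- `X` is an entrywise nonnegative solution of `U + V X + W X² = 0`. -/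
def IsNonnegSolution {P : Type*} [Fintype P] [DecidableEq P] (U V W X : Matrix P P ℝ) : Prop :=
  (∀ i j, 0 ≤ X i j) ∧ U + V * X + W * X ^ 2 = 0

/-- `X` is the minimal nonnegative solution of `U + V X + W X² = 0`. -/
def IsMinNonnegSolution {P : Type*} [Fintype P] [DecidableEq P] (U V W X : Matrix P P ℝ) : Prop :=
  IsNonnegSolution U V W X ∧ ∀ Y, IsNonnegSolution U V W Y → ∀ i j, X i j ≤ Y i j

/-- The entrywise infimum of the nonnegative solutions of `U + V X + W X² = 0`, that is, the
minimal nonnegative solution if there is one. -/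
def minNonnegSolution {P : Type*} [Fintype P] [DecidableEq P] (U V W : Matrix P P ℝ) :
    Matrix P P ℝ :=
  Matrix.of fun i j => sInf {t | ∃ X, IsNonnegSolution U V W X ∧ X i j = t}

/-! ### Quasi-birth-and-death processes -/

/-- The blocks of a level-independent QBD process with `n` phases: `Am`, `A0`, `Ap` are the rates
one level down, within a level and one level up, at the interior levels; `B0` and `C0` replace
`A0` at the lowest and at the highest level. -/
structure QBD (n : ℕ) where
  Am : Matrix (Fin n) (Fin n) ℝ
  A0 : Matrix (Fin n) (Fin n) ℝ
  Ap : Matrix (Fin n) (Fin n) ℝ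
  B0 : Matrix (Fin n) (Fin n) ℝ
  C0 : Matrix (Fin n) (Fin n) ℝ
  Am_nonneg : ∀ i j, 0 ≤ Am i j
  Ap_nonneg : ∀ i j, 0 ≤ Ap i j
  A0_nonneg : ∀ i j, i ≠ j → 0 ≤ A0 i j
  B0_nonneg : ∀ i j, i ≠ j → 0 ≤ B0 i j
  C0_nonneg : ∀ i j, i ≠ j → 0 ≤ C0 i j
  sum_interior : ∀ i, ∑ j, Am i j + ∑ j, A0 i j + ∑ j, Ap i j = 0
  sum_lowest : ∀ i, ∑ j, B0 i j + ∑ j, Ap i j = 0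
  sum_highest : ∀ i, ∑ j, Am i j + ∑ j, C0 i j = 0

namespace QBD

variable {n : ℕ} (q : QBD n)

/-- The rates of the QBD process without upper boundary, on the levels `0, 1, 2, …`. -/
def unrestrictedRate (x y : ℕ × Fin n) : ℝ :=
  if y.1 = x.1 + 1 then q.Ap x.2 y.2
  else if y.1 + 1 = x.1 then q.Am x.2 y.2
  else if y.1 = x.1 then (if x.1 = 0 then q.B0 x.2 y.2 else q.A0 x.2 y.2)
  else 0

/-- The generator of the QBD process with levels `0, …, C`. -/
def generator (C : ℕ) : Matrix (Fin (C + 1) × Fin n) (Fin (C + 1) × Fin n) ℝ :=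
  Matrix.of fun x y =>
    if (y.1 : ℕ) = x.1 + 1 then q.Ap x.2 y.2
    else if (y.1 : ℕ) + 1 = x.1 then q.Am x.2 y.2
    else if y.1 = x.1 then
      (if (x.1 : ℕ) = 0 then q.B0 x.2 y.2
        else if (x.1 : ℕ) = C then q.C0 x.2 y.2 else q.A0 x.2 y.2)
    else 0

lemma unrestrictedRate_hasSum (x : ℕ × Fin n) : HasSum (q.unrestrictedRate x) 0 := by
  obtain ⟨k, i⟩ := x
  have key : ∑ y ∈ Finset.range (k + 2) ×ˢ (Finset.univ : Finset (Fin n)),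
      q.unrestrictedRate (k, i) y = 0 := by
    rw [Finset.sum_product]
    rcases k with _ | k
    · simp [Finset.sum_range_succ, unrestrictedRate, q.sum_lowest i]
    · rw [Finset.sum_range_succ, Finset.sum_range_succ, Finset.sum_range_succ]
      have h0 : ∑ l ∈ Finset.range k, ∑ j, q.unrestrictedRate (k + 1, i) (l, j) = 0 := by
        refine Finset.sum_eq_zero fun l hl => Finset.sum_eq_zero fun j _ => ?_
        have hl := Finset.mem_range.1 hl
        have h1 : l ≠ k + 1 + 1 := by omega
        have h2 : l + 1 ≠ k + 1 := by omega
        have h3 : l ≠ k + 1 := by omega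
        simp only [unrestrictedRate, if_neg h1, if_neg h2, if_neg h3]
      have h1 : k ≠ k + 1 + 1 := by omega
      rw [h0]
      simpa [unrestrictedRate, h1] using q.sum_interior i
  have h : HasSum (q.unrestrictedRate (k, i))
      (∑ y ∈ Finset.range (k + 2) ×ˢ (Finset.univ : Finset (Fin n)),
        q.unrestrictedRate (k, i) y) := hasSum_sum_of_ne_finset_zero (by
      rintro ⟨l, j⟩ hb
      have hl : ¬ l < k + 2 := by simpa using hb
      have h1 : l ≠ k + 1 := by omega
      have h2 : l + 1 ≠ k := by omega
      have h3 : l ≠ k := by omega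
      simp only [unrestrictedRate, if_neg h1, if_neg h2, if_neg h3])
  rwa [key] at h

/-- The QBD process without upper boundary. -/
def unrestricted : MarkovGenerator (ℕ × Fin n) where
  rate := q.unrestrictedRate
  rate_nonneg := by
    rintro ⟨k, i⟩ ⟨l, j⟩ hne
    have hij : l = k → i ≠ j := by rintro rfl rfl; exact hne rfl
    simp only [unrestrictedRate]
    split_ifs with h1 h2 h3 h4
    · exact q.Ap_nonneg _ _
    · exact q.Am_nonneg _ _
    · exact q.B0_nonneg _ _ (hij h3)
    · exact q.A0_nonneg _ _ (hij h3)
    · exact le_rfl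
  hasSum_rate := q.unrestrictedRate_hasSum

lemma generator_sum (C : ℕ) (hC : 1 ≤ C) (x : Fin (C + 1) × Fin n) :
    ∑ y, q.generator C x y = 0 := by
  obtain ⟨k, i⟩ := x
  have hk : (k : ℕ) < C + 1 := k.2
  let f : ℕ → ℝ := fun l => ∑ j, if l = (k : ℕ) + 1 then q.Ap i j
    else if l + 1 = k then q.Am i j
    else if l = k then
      (if (k : ℕ) = 0 then q.B0 i j else if (k : ℕ) = C then q.C0 i j else q.A0 i j)
    else 0
  have e : ∑ y, q.generator C (k, i) y = ∑ l ∈ Finset.range (C + 1), f l := by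
    rw [Fintype.sum_prod_type, ← Fin.sum_univ_eq_sum_range]
    simp only [f, generator, Matrix.of_apply, Fin.ext_iff]
  have up : f (k + 1) = ∑ j, q.Ap i j := by simp [f]
  have mid : f k = ∑ j, if (k : ℕ) = 0 then q.B0 i j
      else if (k : ℕ) = C then q.C0 i j else q.A0 i j := by simp [f]
  have other : ∀ l, l ≠ (k : ℕ) + 1 → l + 1 ≠ k → l ≠ k → f l = 0 := by
    intro l h1 h2 h3
    simp [f, h1, h2, h3]
  rw [e]
  by_cases h0 : (k : ℕ) = 0
  · rw [← Finset.sum_subset (s₁ := {0, 1})]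
    · rw [Finset.sum_pair (by norm_num)]
      rw [h0] at up mid
      rw [mid, show f 1 = _ from up]
      simpa using q.sum_lowest i
    · intro l hl; simp at hl ⊢; omega
    · intro l _ hl
      simp at hl
      exact other l (by omega) (by omega) (by omega)
  · have down : f (k - 1) = ∑ j, q.Am i j := by
      have h1 : (k : ℕ) - 1 ≠ k + 1 := by omega
      have h2 : (k : ℕ) - 1 + 1 = k := by omega
      simp only [f, if_neg h1, if_pos h2]
    by_cases hkC : (k : ℕ) = C
    · rw [← Finset.sum_subset (s₁ := {(k : ℕ) - 1, (k : ℕ)})]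
      · rw [Finset.sum_pair (by omega), down, mid]
        simp only [if_neg h0, if_pos hkC]
        exact q.sum_highest i
      · intro l hl; simp at hl ⊢; omega
      · intro l hl hl'
        simp at hl hl'
        exact other l (by omega) (by omega) (by omega)
    · rw [← Finset.sum_subset (s₁ := {(k : ℕ) - 1, (k : ℕ), (k : ℕ) + 1})]
      · rw [Finset.sum_insert (by simp; omega), Finset.sum_pair (by omega), down, mid, up]
        simp only [if_neg h0, if_neg hkC]
        rw [← add_assoc]
        exact q.sum_interior i
      · intro l hl; simp at hl ⊢; omega
      · intro l hl hl'
        simp at hl hl'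
        exact other l (by omega) (by omega) (by omega)

/-- The QBD process with levels `0, …, C`. -/
def finite (C : ℕ) (hC : 1 ≤ C) : MarkovGenerator (Fin (C + 1) × Fin n) where
  rate := q.generator C
  rate_nonneg := by
    rintro ⟨k, i⟩ ⟨l, j⟩ hne
    have hij : l = k → i ≠ j := by rintro rfl rfl; exact hne rfl
    simp only [generator, Matrix.of_apply]
    split_ifs with h1 h2 h3 h4 h5
    · exact q.Ap_nonneg _ _
    · exact q.Am_nonneg _ _
    · exact q.B0_nonneg _ _ (hij h3)
    · exact q.C0_nonneg _ _ (hij h3)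
    · exact q.A0_nonneg _ _ (hij h3)
    · exact le_rfl
  hasSum_rate := fun x => by
    have h := hasSum_fintype (q.generator C x)
    rwa [q.generator_sum C hC x] at h

/-- The QBD process is in the non-null-recurrent case: the process without upper boundary has no
null-recurrent state. For an irreducible process this means that it is either transient or positive
recurrent. -/
def NonNullRecurrent : Prop := ∀ x, ¬ q.unrestricted.IsNullRecurrentState x

/-- The minimal nonnegative solution of `Am + A0 X + Ap X² = 0`. -/
def G : Matrix (Fin n) (Fin n) ℝ := minNonnegSolution q.Am q.A0 q.Ap

/-- The minimal nonnegative solution of `Ap + A0 X + Am X² = 0`. -/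
def Ghat : Matrix (Fin n) (Fin n) ℝ := minNonnegSolution q.Ap q.A0 q.Am

/-- `H₀ = -(A0 + Ap G + Am Ĝ)⁻¹`. -/
def H0 : Matrix (Fin n) (Fin n) ℝ := -(q.A0 + q.Ap * q.G + q.Am * q.Ghat)⁻¹

/-- `μ_k(C) = ∑_{j=0}^{k-1} G^j H₀ 1 + ∑_{j=1}^{C-k} Ĝ^j H₀ 1`. -/
def mu (C k : ℕ) : Fin n → ℝ :=
  ∑ j ∈ Finset.range k, (q.G ^ j * q.H0).mulVec 1 +
    ∑ j ∈ Finset.Icc 1 (C - k), (q.Ghat ^ j * q.H0).mulVec 1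

/-- The mean first entrance time from `(k, i)` to `(l, j)` as a real number, arranged in blocks:
`M k l i j`. -/
def M (C : ℕ) (hC : 1 ≤ C) (k l : Fin (C + 1)) : Matrix (Fin n) (Fin n) ℝ :=
  Matrix.of fun i j => ((q.finite C hC).meanEntranceTime (k, i) (l, j)).toReal

/-- The `j`th column of the block `M k l`. -/
def m (C : ℕ) (hC : 1 ≤ C) (j : Fin n) (k l : Fin (C + 1)) : Fin n → ℝ :=
  fun i => q.M C hC k l i j

end QBD

/-- The matrix obtained by replacing row `j` by zero. -/
def zeroRow {n : ℕ} (j : Fin n) (A : Matrix (Fin n) (Fin n) ℝ) : Matrix (Fin n) (Fin n) ℝ :=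
  A.updateRow j 0

/-- The matrix obtained by replacing row `j` by minus the `j`th unit row vector. -/
def unitRow {n : ℕ} (j : Fin n) (A : Matrix (Fin n) (Fin n) ℝ) : Matrix (Fin n) (Fin n) ℝ :=
  A.updateRow j (-Pi.single j 1)

namespace QBD

variable {n : ℕ} (q : QBD n)

/-! The matrices `Z`, the matrices of powers of `G` and `Ĝ`, and the right-hand sides of the linear
systems, in the four cases: level zero, levels `1 ≤ l ≤ C - 2`, level `C - 1`, level `C`. -/

def Zzero (C : ℕ) (j : Fin n) : Matrix (Fin 2) (Fin 2) (Matrix (Fin n) (Fin n) ℝ) :=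
  !![unitRow j q.B0 + zeroRow j q.Ap * q.G,
      (unitRow j q.B0 * q.Ghat + zeroRow j q.Ap) * q.Ghat ^ (C - 1);
    (q.Am + q.C0 * q.G) * q.G ^ (C - 1),
      q.Am * q.Ghat + q.C0]

def rhsZero (C : ℕ) (j : Fin n) : Fin 2 → Fin n → ℝ :=
  ![1 - Pi.single j 1 + (unitRow j q.B0).mulVec (q.mu C 0) + (zeroRow j q.Ap).mulVec (q.mu C 1),
    1 + q.Am.mulVec (q.mu C (C - 1)) + q.C0.mulVec (q.mu C C)]

def Zmid (C l : ℕ) (j : Fin n) : Matrix (Fin 4) (Fin 4) (Matrix (Fin n) (Fin n) ℝ) :=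
  !![q.B0 + q.Ap * q.G, (q.B0 * q.Ghat + q.Ap) * q.Ghat ^ (l - 1), 0, 0;
    (zeroRow j q.Am + unitRow j q.A0 * q.G) * q.G ^ (l - 1),
      zeroRow j q.Am * q.Ghat + unitRow j q.A0,
      zeroRow j q.Ap, zeroRow j q.Ap * q.Ghat ^ (C - l - 1);
    q.Am * q.G ^ l, q.Am,
      q.A0 + q.Ap * q.G, (q.A0 * q.Ghat + q.Ap) * q.Ghat ^ (C - l - 2);
    0, 0, (q.C0 * q.G + q.Am) * q.G ^ (C - l - 2), q.C0 + q.Am * q.Ghat]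

def rhsMid (C l : ℕ) (j : Fin n) : Fin 4 → Fin n → ℝ :=
  ![1 + q.B0.mulVec (q.mu C 0) + q.Ap.mulVec (q.mu C 1),
    1 - Pi.single j 1 + (zeroRow j q.Am).mulVec (q.mu C (l - 1)) +
      (unitRow j q.A0).mulVec (q.mu C l) + (zeroRow j q.Ap).mulVec (q.mu C (l + 1)),
    1 + q.Am.mulVec (q.mu C l) + q.A0.mulVec (q.mu C (l + 1)) + q.Ap.mulVec (q.mu C (l + 2)),
    1 + q.Am.mulVec (q.mu C (C - 1)) + q.C0.mulVec (q.mu C C)]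

def Zpred (C : ℕ) (j : Fin n) : Matrix (Fin 3) (Fin 3) (Matrix (Fin n) (Fin n) ℝ) :=
  !![q.B0 + q.Ap * q.G, (q.B0 * q.Ghat + q.Ap) * q.Ghat ^ (C - 2), 0;
    (zeroRow j q.Am + unitRow j q.A0 * q.G) * q.G ^ (C - 2),
      zeroRow j q.Am * q.Ghat + unitRow j q.A0, zeroRow j q.Ap;
    q.Am * q.G ^ (C - 1), q.Am, q.C0]

def rhsPred (C : ℕ) (j : Fin n) : Fin 3 → Fin n → ℝ :=
  ![1 + q.B0.mulVec (q.mu C 0) + q.Ap.mulVec (q.mu C 1),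
    1 - Pi.single j 1 + (zeroRow j q.Am).mulVec (q.mu C (C - 2)) +
      (unitRow j q.A0).mulVec (q.mu C (C - 1)) + (zeroRow j q.Ap).mulVec (q.mu C C),
    1 + q.Am.mulVec (q.mu C (C - 1)) + q.C0.mulVec (q.mu C C)]

def Ztop (C : ℕ) (j : Fin n) : Matrix (Fin 2) (Fin 2) (Matrix (Fin n) (Fin n) ℝ) :=
  !![q.B0 + q.Ap * q.G, (q.B0 * q.Ghat + q.Ap) * q.Ghat ^ (C - 1);
    (zeroRow j q.Am + unitRow j q.C0 * q.G) * q.G ^ (C - 1),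
      zeroRow j q.Am * q.Ghat + unitRow j q.C0]

def rhsTop (C : ℕ) (j : Fin n) : Fin 2 → Fin n → ℝ :=
  ![1 + q.B0.mulVec (q.mu C 0) + q.Ap.mulVec (q.mu C 1),
    1 - Pi.single j 1 + (zeroRow j q.Am).mulVec (q.mu C (C - 1)) +
      (unitRow j q.C0).mulVec (q.mu C C)]

end QBD

end

noncomputable section

/-! Fix a target state `s = (ℓ, j)`, and let `T` be the generator absorbed at `s`. First-step
analysis shows that the mean entrance times to `s` solve `T m = -(1 - e_s)`. The maximum principle
for irreducible generators makes `T` invertible, so any function with the same image under `T` is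
the vector of entrance times.

Such a function is found by an ansatz. At an interior level, `G ^ k v` and `Ĝ ^ (C - k) w` are
annihilated by the generator, because `G` and `Ĝ` solve the two quadratic equations. The vectors
`μ_k` are a particular solution with image `-1` (`mu_interior`). The equations that remain are those
at the boundary levels and around the target level; they form the finite system with matrix `Z`.
Since the ansatz is harmonic at all other levels, eliminating these levels by a Schur complement
gives `Z = Q̊ K`, where `K` collects the values of the ansatz at the observed levels
(`flat_eq_restrictToLevels_mul`). The restricted generator is invertible because `T` and its outer
block are, and it is then transient (`isTransientGenerator_of_isUnit`).

The delicate point is the invertibility of `K` and of `A0 + Ap G + Am Ĝ`; both express that an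
upward and a downward geometric solution cannot be glued together (`eq_zero_of_gluedSolutions`). The
Poisson equation of the phase process gives `c` and `d` such that `k + c i` has constant drift `d`.
If `d > 0`, the powers of `G` tend to zero, so a positive maximum of a glued solution is attained on
a closed set of states bounded above, which positive drift forbids. The case `d < 0` is the mirror
image. The case `d = 0` is where non-null-recurrence enters: comparison with `k + c i` proves
recurrence, and comparison with a quadratic function of it shows that mean return times are infinite
(`exists_isDrift_ne_zero`).

For the deviation matrix, stationarity supplies the row of `Q m` at the target that first-step
analysis leaves open. The proposed column `v` then satisfies `Q v = p y - 1_{x = y}` and `p v = 0`,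
so `-exp (t Q) v` is an antiderivative of the integrand and vanishes at infinity by geometric
ergodicity (`deviationMatrix_eq`). -/

lemma lintegral_ofReal_expMeasure_one : ∫⁻ t, ENNReal.ofReal t ∂(expMeasure 1) = 1 := by
  have hI := Real.integral_rpow_mul_exp_neg_mul_Ioi (a := 2) (r := 1) two_pos one_pos
  have h2 : (2 : ℝ) - 1 = 1 := by norm_num
  simp only [h2, Real.rpow_one, one_mul, Real.Gamma_two, mul_one, div_one, Real.one_rpow] at hI
  -- The Bochner integral of a non-integrable function is zero, so the value one already forces
  -- integrability.
  have hint : IntegrableOn (fun t : ℝ => t * Real.exp (-t)) (Set.Ioi 0) := by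
    by_contra h
    rw [integral_undef h] at hI
    exact zero_ne_one hI
  have hm : Measurable (gammaPDF 1 1) := (measurable_gammaPDFReal 1 1).ennreal_ofReal
  rw [expMeasure, gammaMeasure, lintegral_withDensity_eq_lintegral_mul _ hm (by fun_prop)]
  have e : ∀ t, (gammaPDF 1 1 * fun t => ENNReal.ofReal t) t
      = Set.indicator (Set.Ioi 0) (fun t => ENNReal.ofReal (t * Real.exp (-t))) t := by
    intro t
    rcases le_or_gt t 0 with ht | ht
    · simp [ENNReal.ofReal_of_nonpos ht, not_lt.2 ht]
    · simp [gammaPDF, gammaPDFReal, ht, ht.le, mul_comm t, ENNReal.ofReal_mul (Real.exp_pos _).le]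
  simp_rw [e]
  rw [lintegral_indicator measurableSet_Ioi, ← ofReal_integral_eq_lintegral_ofReal hint, hI]
  · simp
  · filter_upwards [ae_restrict_mem measurableSet_Ioi] with t ht
    exact mul_nonneg (le_of_lt ht) (Real.exp_pos _).le

lemma lintegral_ofReal_eval_infinitePi_expMeasure (k : ℕ) :
    ∫⁻ e, ENNReal.ofReal (e k) ∂(Measure.infinitePi fun _ : ℕ => expMeasure 1) = 1 := by
  refine Eq.trans ?_ lintegral_ofReal_expMeasure_one
  exact (measurePreserving_eval_infinitePi (fun _ : ℕ => expMeasure 1) k).lintegral_comp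
    ENNReal.measurable_ofReal

/-! ### The jump chain and first-step analysis -/

namespace MarkovGenerator

variable {S : Type*} (Q : MarkovGenerator S)

lemma exitRate_nonneg (x : S) : 0 ≤ Q.exitRate x := by
  classical
  have h := (Q.hasSum_rate x).update x 0
  have : HasSum (Function.update (Q.rate x) x 0) (Q.exitRate x) := by
    simpa [exitRate] using h
  refine this.nonneg fun y => ?_
  by_cases hy : y = x
  · simp [hy]
  · simpa [hy] using Q.rate_nonneg x y (Ne.symm hy)

lemma exitRate_pos_of_rate_pos {x y : S} (hxy : x ≠ y) (h : 0 < Q.rate x y) :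
    0 < Q.exitRate x := by
  classical
  have h1 := (Q.hasSum_rate x).update x 0
  have : HasSum (Function.update (Q.rate x) x 0) (Q.exitRate x) := by
    simpa [exitRate] using h1
  refine lt_of_lt_of_le ?_ (le_hasSum this y fun z _ => ?_)
  · simpa [hxy.symm] using h
  · by_cases hz : z = x
    · simp [hz]
    · simpa [hz] using Q.rate_nonneg x z (Ne.symm hz)

open Classical in
lemma jump_apply {x : S} (hx : Q.exitRate x ≠ 0) (z : S) :
    Q.jump x z = if z = x then 0 else ENNReal.ofReal (Q.rate x z / Q.exitRate x) := by
  have : Q.jump x = ⟨fun y => if y = x then 0 else ENNReal.ofReal (Q.rate x y / Q.exitRate x),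
      Q.hasSum_jump x hx⟩ := dif_neg hx
  rw [this]
  rfl

variable [MeasurableSpace S] [MeasurableSingletonClass S]

lemma measurableSet_avoids (s : S) (a k : ℕ) : MeasurableSet {y : ℕ → S | Avoids y s a k} := by
  unfold Avoids
  simp only [Set.ofPred_forall]
  refine MeasurableSet.iInter fun m => MeasurableSet.iInter fun _ => MeasurableSet.iInter fun _ => ?_
  have h1 : MeasurableSet ({s}ᶜ : Set S) := (measurableSet_singleton s).compl
  exact measurableSet_preimage (f := fun y : ℕ → S => y m) (measurable_pi_apply m) h1

variable [Countable S]

lemma lintegral_jumpLaw_zero (x : S) (g : S → ℝ≥0∞) :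
    ∫⁻ y, g (y 0) ∂(Q.jumpLaw x) = g x := by
  have h : (Q.jumpLaw x).map (Preorder.frestrictLe 0) =
      (Measure.dirac x).map (MeasurableEquiv.piUnique fun i : Finset.Iic 0 => S).symm := by
    rw [jumpLaw, Kernel.trajMeasure, Measure.map_comp _ _ (by fun_prop),
      Kernel.traj_map_frestrictLe, Kernel.partialTraj_self]
    exact Measure.id_comp
  have hg : Measurable g := measurable_of_countable g
  have e : ∫⁻ y, g (y 0) ∂(Q.jumpLaw x) =
      ∫⁻ h, g (h ⟨0, Finset.mem_Iic.2 le_rfl⟩) ∂((Q.jumpLaw x).map (Preorder.frestrictLe 0)) := by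
    rw [lintegral_map (by fun_prop) (by fun_prop)]
    rfl
  rw [e, h, lintegral_map (by fun_prop) (by fun_prop), lintegral_dirac]
  rfl

/-- The Markov property: the joint law of the history and the next state is the composition-product
of the law of the history with a kernel that looks only at the last state. -/
lemma lintegral_jumpLaw_succ (x : S) (k : ℕ) (f : (Finset.Iic k → S) → ℝ≥0∞) (hf : Measurable f)
    (g : S → ℝ≥0∞) :
    ∫⁻ y, f (Preorder.frestrictLe k y) * g (y (k + 1)) ∂(Q.jumpLaw x) =
      ∫⁻ y, f (Preorder.frestrictLe k y) * ∫⁻ z, g z ∂(Q.jumpKernel (y k)) ∂(Q.jumpLaw x) := by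
  have hg : Measurable g := measurable_of_countable g
  have hg' : Measurable fun z => ∫⁻ w, g w ∂(Q.jumpKernel z) := measurable_of_countable _
  have h := Kernel.map_frestrictLe_trajMeasure_compProd_eq_map_trajMeasure
    (X := fun _ => S) (μ₀ := Measure.dirac x) (κ := Q.historyKernel) (a := k)
  have h1 := congrArg (fun m => ∫⁻ p, f p.1 * g p.2 ∂m) h
  rw [Measure.lintegral_compProd (by fun_prop), 
    lintegral_map (by fun_prop) (by fun_prop), lintegral_map (by fun_prop) (by fun_prop)] at h1
  rw [jumpLaw]
  refine h1.symm.trans (lintegral_congr fun y => ?_)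
  exact lintegral_const_mul (μ := Q.jumpKernel (y k)) (f (Preorder.frestrictLe k y)) hg

open Classical in
/-- One step of the jump chain killed on entering `s`. -/
def killedStep (s : S) (φ : S → ℝ≥0∞) (x : S) : ℝ≥0∞ :=
  ∫⁻ z, (if z = s then 0 else φ z) ∂(Q.jumpKernel x)

lemma killedStep_mono (s : S) {φ ψ : S → ℝ≥0∞} (h : φ ≤ ψ) :
    Q.killedStep s φ ≤ Q.killedStep s ψ := fun x => by
  refine lintegral_mono fun z => ?_
  dsimp only
  split_ifs
  · exact le_rfl
  · exact h z

open Classical in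
-- Avoidance up to step `k` is an event of the history, so the Markov property applies to it; the
-- condition `a ≤ k + 1` ensures that the new step is also tested, which is what kills the chain at
-- `s`.
lemma lintegral_avoids_succ (x s : S) (a k : ℕ) (hak : a ≤ k + 1) (φ : S → ℝ≥0∞) :
    ∫⁻ y, (if Avoids y s a (k + 1) then φ (y (k + 1)) else 0) ∂(Q.jumpLaw x) =
      ∫⁻ y, (if Avoids y s a k then Q.killedStep s φ (y k) else 0) ∂(Q.jumpLaw x) := by
  let A : Set (Finset.Iic k → S) := {h | ∀ m : Finset.Iic k, a ≤ m → h m ≠ s}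
  have hA : MeasurableSet A := by
    simp only [A, Set.ofPred_forall]
    refine MeasurableSet.iInter fun m => MeasurableSet.iInter fun _ => ?_
    have h1 : MeasurableSet ({s}ᶜ : Set S) := (measurableSet_singleton s).compl
    exact measurableSet_preimage (f := fun y : Finset.Iic k → S => y m) (measurable_pi_apply m) h1
  have hmem : ∀ y : ℕ → S, Preorder.frestrictLe k y ∈ A ↔ Avoids y s a k := by
    intro y
    constructor
    · intro h m h1 h2
      exact h ⟨m, Finset.mem_Iic.2 h2⟩ h1
    · intro h m h1
      exact h m h1 (Finset.mem_Iic.1 m.2)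
  have := Q.lintegral_jumpLaw_succ x k (A.indicator 1) (measurable_one.indicator hA)
    (fun z => if z = s then 0 else φ z)
  convert this using 1
  · refine lintegral_congr fun y => ?_
    by_cases h : Avoids y s a k
    · have h1 : Avoids y s a (k + 1) ↔ y (k + 1) ≠ s := by
        refine ⟨fun h' => h' _ hak le_rfl, fun h' m hm1 hm2 => ?_⟩
        rcases Nat.le_succ_iff.1 hm2 with h3 | h3
        · exact h m hm1 h3
        · subst h3; exact h'
      rw [Set.indicator_of_mem ((hmem y).2 h)]
      by_cases h2 : y (k + 1) = s <;> simp [h1, h2]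
    · have h1 : ¬ Avoids y s a (k + 1) := fun h' => h fun m h1 h2 => h' m h1 (by omega)
      rw [Set.indicator_of_notMem (fun h' => h ((hmem y).1 h'))]
      simp [h1]
  · refine lintegral_congr fun y => ?_
    by_cases h : Avoids y s a k
    · rw [Set.indicator_of_mem ((hmem y).2 h)]
      simp [h, killedStep]
    · rw [Set.indicator_of_notMem (fun h' => h ((hmem y).1 h'))]
      simp [h]

open Classical in
-- Each use of the Markov property removes the last step and replaces the test function by its image
-- under the killed step. Only the starting state is left, and it is tested against `s`; in the
-- variant that starts testing at step one it is not.
lemma lintegral_avoids_zero (x s : S) (k : ℕ) (φ : S → ℝ≥0∞) :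
    ∫⁻ y, (if Avoids y s 0 k then φ (y k) else 0) ∂(Q.jumpLaw x) =
      if x = s then 0 else (Q.killedStep s)^[k] φ x := by
  induction k generalizing φ with
  | zero =>
    have : ∀ y : ℕ → S, Avoids y s 0 0 ↔ y 0 ≠ s := fun y =>
      ⟨fun h => h 0 le_rfl le_rfl, fun h m _ h2 => by rwa [Nat.le_zero.1 h2]⟩
    simp_rw [this]
    rw [Q.lintegral_jumpLaw_zero x fun z => if z ≠ s then φ z else 0]
    by_cases h : x = s <;> simp [h]
  | succ k ih => rw [lintegral_avoids_succ _ _ _ _ _ (Nat.zero_le _), ih, Function.iterate_succ_apply]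

open Classical in
lemma lintegral_avoids_one (x s : S) (k : ℕ) (φ : S → ℝ≥0∞) :
    ∫⁻ y, (if Avoids y s 1 k then φ (y k) else 0) ∂(Q.jumpLaw x) = (Q.killedStep s)^[k] φ x := by
  induction k generalizing φ with
  | zero =>
    have : ∀ y : ℕ → S, Avoids y s 1 0 := fun y m h1 h2 => by omega
    simp only [this, if_true]
    rw [Q.lintegral_jumpLaw_zero x φ]
    rfl
  | succ k ih => rw [lintegral_avoids_succ _ _ _ _ _ (by omega), ih, Function.iterate_succ_apply]

/-- The mean holding time of a state. -/
def meanHolding (x : S) : ℝ≥0∞ := (ENNReal.ofReal (Q.exitRate x))⁻¹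

open Classical in
-- The exponential clocks are independent of the visited states and have mean one, so they integrate
-- out and leave only the mean holding times.
lemma lintegral_law_avoids (x s : S) (a : ℕ) :
    ∫⁻ ω, (∑' k, if Avoids ω.1 s a k then Q.holdingTime ω k else 0) ∂(Q.law x) =
      ∑' k, ∫⁻ y, (if Avoids y s a k then Q.meanHolding (y k) else 0) ∂(Q.jumpLaw x) := by
  have hm : ∀ k, Measurable fun y : ℕ → S =>
      if Avoids y s a k then Q.meanHolding (y k) else 0 := fun k =>
    Measurable.ite (measurableSet_avoids s a k)
      ((measurable_of_countable Q.meanHolding).comp (measurable_pi_apply k)) measurable_const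
  have he : ∀ (k : ℕ) (ω : (ℕ → S) × (ℕ → ℝ)),
      (if Avoids ω.1 s a k then Q.holdingTime ω k else 0) =
      (if Avoids ω.1 s a k then Q.meanHolding (ω.1 k) else 0) * ENNReal.ofReal (ω.2 k) := by
    intro k ω
    split_ifs
    · rw [holdingTime, meanHolding, mul_comm, ENNReal.div_eq_inv_mul, mul_comm]
    · simp
  simp_rw [he]
  have hm2 : ∀ k, AEMeasurable (fun ω : (ℕ → S) × (ℕ → ℝ) =>
      (if Avoids ω.1 s a k then Q.meanHolding (ω.1 k) else 0) * ENNReal.ofReal (ω.2 k))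
      (Q.law x) := fun k => (((hm k).comp measurable_fst).mul
    (ENNReal.measurable_ofReal.comp ((measurable_pi_apply k).comp measurable_snd))).aemeasurable
  rw [lintegral_tsum hm2]
  refine tsum_congr fun k => ?_
  rw [law, lintegral_prod_mul (g := fun e : ℕ → ℝ => ENNReal.ofReal (e k))
    (hm k).aemeasurable (ENNReal.measurable_ofReal.comp (measurable_pi_apply k)).aemeasurable,
    lintegral_ofReal_eval_infinitePi_expMeasure, mul_one]

open Classical in
lemma meanEntranceTime_eq_tsum (x s : S) :
    Q.meanEntranceTime x s =
      if x = s then 0 else ∑' k, (Q.killedStep s)^[k] Q.meanHolding x := by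
  unfold meanEntranceTime entranceTime
  rw [lintegral_law_avoids]
  simp_rw [lintegral_avoids_zero]
  split_ifs <;> simp

lemma lintegral_returnTime_eq_tsum (x s : S) :
    ∫⁻ ω, Q.returnTime s ω ∂(Q.law x) = ∑' k, (Q.killedStep s)^[k] Q.meanHolding x := by
  unfold returnTime
  rw [lintegral_law_avoids]
  simp_rw [lintegral_avoids_one]

lemma meanEntranceTime_self (s : S) : Q.meanEntranceTime s s = 0 := by
  simp [meanEntranceTime_eq_tsum]

/-- The term of index zero is the current holding time. In the others one killed step factors out by
monotone convergence, and the killing at `s` agrees with the entrance time being zero there. -/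
lemma tsum_iterate_killedStep (x s : S) :
    ∑' k, (Q.killedStep s)^[k] Q.meanHolding x =
      Q.meanHolding x + ∫⁻ z, Q.meanEntranceTime z s ∂(Q.jumpKernel x) := by
  classical
  rw [tsum_eq_zero_add' (f := fun k => (Q.killedStep s)^[k] Q.meanHolding x)
    ENNReal.summable]
  refine congrArg (Q.meanHolding x + ·) ?_
  simp_rw [Function.iterate_succ_apply', killedStep]
  rw [← lintegral_tsum fun k => (measurable_of_countable _).aemeasurable]
  refine lintegral_congr fun z => ?_
  rw [meanEntranceTime_eq_tsum]
  split_ifs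
  · simp
  · rfl

/-- First-step equation for the mean first entrance time. -/
lemma meanEntranceTime_of_ne {x s : S} (h : x ≠ s) :
    Q.meanEntranceTime x s =
      Q.meanHolding x + ∫⁻ z, Q.meanEntranceTime z s ∂(Q.jumpKernel x) := by
  rw [← tsum_iterate_killedStep, meanEntranceTime_eq_tsum, if_neg h]

lemma lintegral_returnTime (x : S) :
    ∫⁻ ω, Q.returnTime x ω ∂(Q.law x) =
      Q.meanHolding x + ∫⁻ z, Q.meanEntranceTime z x ∂(Q.jumpKernel x) := by
  rw [lintegral_returnTime_eq_tsum, tsum_iterate_killedStep]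

/-- The mean first entrance time is the smallest solution of its first-step inequalities. -/
lemma meanEntranceTime_le (s : S) (w : S → ℝ≥0∞)
    (hw : ∀ x, x ≠ s → Q.meanHolding x + ∫⁻ z, w z ∂(Q.jumpKernel x) ≤ w x) (x : S) :
    Q.meanEntranceTime x s ≤ w x := by
  classical
  have key : ∀ N x, x ≠ s → ∑ k ∈ Finset.range N, (Q.killedStep s)^[k] Q.meanHolding x ≤ w x := by
    intro N
    induction N with
    | zero => simp
    | succ N ih =>
      intro x hx
      rw [Finset.sum_range_succ']
      refine le_trans ?_ (hw x hx)
      rw [add_comm]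
      refine add_le_add le_rfl ?_
      simp_rw [Function.iterate_succ_apply', killedStep]
      rw [← lintegral_finsetSum _ fun k _ => measurable_of_countable _]
      refine lintegral_mono fun z => ?_
      by_cases hz : z = s
      · simp [hz]
      · simpa [hz] using ih z hz
  rw [meanEntranceTime_eq_tsum]
  split_ifs with h
  · exact zero_le
  · rw [ENNReal.tsum_eq_iSup_nat]
    exact iSup_le fun N => key N x h

/-- The probability that the chain started in `x` does not visit `s` after time zero. -/
def neverReturn (s x : S) : ℝ≥0∞ := ⨅ k, (Q.killedStep s)^[k] 1 x

lemma iterate_killedStep_one_antitone (s : S) : Antitone fun k => (Q.killedStep s)^[k] 1 := by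
  classical
  refine antitone_nat_of_succ_le fun k => ?_
  induction k with
  | zero =>
    intro x
    simp only [Function.iterate_succ_apply', Function.iterate_zero, id]
    calc Q.killedStep s 1 x ≤ ∫⁻ z, 1 ∂(Q.jumpKernel x) := lintegral_mono fun z => by
          dsimp only; split_ifs <;> simp
      _ = 1 := by simp
  | succ k ih =>
    have h := Q.killedStep_mono s ih
    rwa [← Function.iterate_succ_apply' (Q.killedStep s) (k + 1),
      ← Function.iterate_succ_apply' (Q.killedStep s) k] at h

lemma neverReturn_le_one (s x : S) : Q.neverReturn s x ≤ 1 := (iInf_le _ 0).trans le_rfl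

open Classical in
-- The iterates decrease and are bounded by one, so the infimum may be exchanged with the integral
-- over the next state.
lemma neverReturn_eq (s x : S) :
    Q.neverReturn s x = ∫⁻ z, (if z = s then 0 else Q.neverReturn s z) ∂(Q.jumpKernel x) := by
  have h1 : Q.neverReturn s x = ⨅ k, (Q.killedStep s)^[k + 1] 1 x :=
    le_antisymm (le_iInf fun k => iInf_le _ (k + 1)) (le_iInf fun k => (iInf_le _ k).trans
      (Q.iterate_killedStep_one_antitone s (Nat.le_succ k) x))
  rw [h1]
  simp_rw [Function.iterate_succ_apply', killedStep]
  rw [← lintegral_iInf (fun k => measurable_of_countable _)]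
  · refine lintegral_congr fun z => ?_
    split_ifs
    · simp
    · rfl
  · intro a b h z
    dsimp only
    split_ifs
    · exact le_rfl
    · exact Q.iterate_killedStep_one_antitone s h z
  · refine ne_top_of_le_ne_top ENNReal.one_ne_top ?_
    calc _ ≤ ∫⁻ z, 1 ∂(Q.jumpKernel x) := lintegral_mono fun z => by split_ifs <;> simp
      _ = 1 := by simp

lemma isRecurrentState_of_neverReturn_eq_zero (x : S) (h : Q.neverReturn x x = 0) :
    Q.IsRecurrentState x := by
  classical
  have h0 : Q.jumpLaw x {y | ∀ k, 1 ≤ k → y k ≠ x} = 0 := by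
    refine le_antisymm ?_ zero_le
    rw [← h]
    refine le_iInf fun k => ?_
    rw [← lintegral_avoids_one Q x x k 1]
    calc Q.jumpLaw x {y | ∀ k, 1 ≤ k → y k ≠ x} ≤ Q.jumpLaw x {y | Avoids y x 1 k} :=
          measure_mono fun y hy m h1 _ => hy m h1
      _ = ∫⁻ y, Set.indicator {y | Avoids y x 1 k} 1 y ∂(Q.jumpLaw x) :=
          (lintegral_indicator_one (measurableSet_avoids x 1 k)).symm
      _ = _ := lintegral_congr fun y => by simp [Set.indicator_apply]
  have h1 : ∀ᵐ y ∂(Q.jumpLaw x), ∃ k, 1 ≤ k ∧ y k = x := by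
    rw [ae_iff]
    convert h0 using 3
    push Not
    rfl
  unfold IsRecurrentState law
  exact Measure.quasiMeasurePreserving_fst.ae h1

open Classical in
lemma lintegral_jumpKernel {x : S} (hx : Q.exitRate x ≠ 0) (f : S → ℝ≥0∞) :
    ∫⁻ z, f z ∂(Q.jumpKernel x) =
      ∑' z, f z * (if z = x then 0 else ENNReal.ofReal (Q.rate x z / Q.exitRate x)) := by
  rw [lintegral_countable']
  refine tsum_congr fun z => ?_
  have h1 : Q.jumpKernel x {z} = Q.jump x z :=
    PMF.toMeasure_apply_singleton _ _ (measurableSet_singleton z)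
  rw [h1, Q.jump_apply hx]

/-- A one-step average over the jump chain, rewritten with the rates. -/
lemma hasSum_rate_mul_toReal {x : S} (hx : 0 < Q.exitRate x) (f : S → ℝ≥0∞)
    (hf : ∫⁻ z, f z ∂(Q.jumpKernel x) ≠ ∞) :
    HasSum (fun z => Q.rate x z * (f z).toReal)
      (Q.exitRate x * (∫⁻ z, f z ∂(Q.jumpKernel x)).toReal - Q.exitRate x * (f x).toReal) := by
  classical
  rw [lintegral_jumpKernel Q hx.ne'] at hf ⊢
  have h := (ENNReal.hasSum_toReal hf).mul_left (Q.exitRate x)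
  rw [← ENNReal.tsum_toReal_eq (ENNReal.ne_top_of_tsum_ne_top hf)] at h
  -- The jump kernel gives no mass to `x`, while the row of rates has the diagonal entry `-exitRate
  -- x`; the missing term is put in by hand.
  have h2 := h.update x (Q.rate x x * (f x).toReal)
  have e1 : Function.update (fun i => Q.exitRate x * (f i * if i = x then 0 else
        ENNReal.ofReal (Q.rate x i / Q.exitRate x)).toReal) x (Q.rate x x * (f x).toReal) =
      fun z => Q.rate x z * (f z).toReal := by
    funext z
    by_cases hz : z = x
    · subst hz; simp
    · have h0 : 0 ≤ Q.rate x z / Q.exitRate x :=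
        div_nonneg (Q.rate_nonneg x z (Ne.symm hz)) hx.le
      simp only [Function.update_of_ne hz, if_neg hz, ENNReal.toReal_mul, ENNReal.toReal_ofReal h0]
      field_simp
  rw [e1] at h2
  refine Eq.subst (motive := fun t => HasSum (fun z => Q.rate x z * (f z).toReal) t) ?_ h2
  rw [if_pos rfl, mul_zero, ENNReal.toReal_zero, exitRate]
  ring

end MarkovGenerator

/-! ### Finite generators -/

section FiniteGenerators

variable {S : Type*} [Fintype S]

/-- Nonnegative terms with nonpositive sum vanish. The sign is required of the products and not of
the weights, because the diagonal entry of a generator is negative and occurs where `v` equals its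
maximum. -/
lemma eq_max_of_weighted_sum_nonneg {ι : Type*} [Fintype ι] {w v : ι → ℝ} {M : ℝ}
    (h1 : ∀ y, 0 ≤ w y * (M - v y)) (h2 : 0 ≤ ∑ y, w y * (v y - M)) {y : ι} (hy : 0 < w y) :
    v y = M := by
  have h3 : ∑ y, w y * (M - v y) = 0 := by
    refine le_antisymm ?_ (Finset.sum_nonneg fun y _ => h1 y)
    have : ∑ y, w y * (M - v y) = -∑ y, w y * (v y - M) := by
      rw [← Finset.sum_neg_distrib]
      exact Finset.sum_congr rfl fun _ _ => by ring
    linarith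
  have h4 := (Finset.sum_eq_zero_iff_of_nonneg fun y _ => h1 y).1 h3 y (Finset.mem_univ y)
  rcases mul_eq_zero.1 h4 with h | h
  · exact absurd h hy.ne'
  · linarith

/-- At a maximum of `u` where `Q u` is nonnegative, `u` has the same value at all the states that
can be entered. -/
lemma eq_of_max_of_mulVec_nonneg {Q : Matrix S S ℝ} (hQ : ∀ x y, x ≠ y → 0 ≤ Q x y)
    {x : S} (hsum : ∑ y, Q x y = 0) {u : S → ℝ} (hmax : ∀ y, u y ≤ u x)
    (hx : 0 ≤ Q.mulVec u x) {y : S} (hy : 0 < Q x y) : u y = u x := by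
  refine eq_max_of_weighted_sum_nonneg (w := Q x) (fun z => ?_) ?_ hy
  · by_cases h : x = z
    · simp [h]
    · exact mul_nonneg (hQ x z h) (sub_nonneg.2 (hmax z))
  · have : ∑ z, Q x z * (u z - u x) = Q.mulVec u x := by
      simp only [mul_sub, Finset.sum_sub_distrib, ← Finset.sum_mul, hsum, Matrix.mulVec, dotProduct]
      ring
    rwa [this]

/-- Maximum principle for irreducible generators. -/
lemma nonpos_of_mulVec_nonneg {Q : Matrix S S ℝ} (hQ : ∀ x y, x ≠ y → 0 ≤ Q x y)
    (hsum : ∀ x, ∑ y, Q x y = 0) (hirr : IrreducibleRates Q) {A : Set S} {s : S} (hs : s ∈ A)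
    {u : S → ℝ} (hA : ∀ x ∈ A, u x ≤ 0) (hu : ∀ x, x ∉ A → 0 ≤ Q.mulVec u x) (x : S) : u x ≤ 0 := by
  by_contra! hx
  have : Nonempty S := ⟨x⟩
  obtain ⟨m, hm⟩ := Finite.exists_max u
  have hpos : 0 < u m := hx.trans_le (hm x)
  -- A positive maximum cannot lie in `A`, so it spreads along every positive rate; by
  -- irreducibility it would reach `s ∈ A`.
  have key : ∀ y, Relation.ReflTransGen (fun a b => 0 < Q a b) m y → u y = u m := by
    intro y hy
    induction hy with
    | refl => rfl
    | @tail b c _ hbc ih =>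
      have hb : b ∉ A := fun h => by have := hA b h; linarith
      rw [← ih]
      exact eq_of_max_of_mulVec_nonneg hQ (hsum b) (fun z => ih ▸ hm z) (hu b hb) hbc
  have := key s (hirr m s)
  have := hA s hs
  linarith

lemma eq_zero_of_mulVec_eq_zero {Q : Matrix S S ℝ} (hQ : ∀ x y, x ≠ y → 0 ≤ Q x y)
    (hsum : ∀ x, ∑ y, Q x y = 0) (hirr : IrreducibleRates Q) {A : Set S} {s : S} (hs : s ∈ A)
    {u : S → ℝ} (hA : ∀ x ∈ A, u x = 0) (hu : ∀ x, x ∉ A → Q.mulVec u x = 0) : u = 0 := by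
  funext x
  refine le_antisymm ?_ ?_
  · exact nonpos_of_mulVec_nonneg hQ hsum hirr hs (fun x hx => (hA x hx).le)
      (fun x hx => (hu x hx).ge) x
  · have := nonpos_of_mulVec_nonneg (u := -u) hQ hsum hirr hs (fun x hx => by simp [hA x hx])
      (fun x hx => by simp [Matrix.mulVec_neg, hu x hx]) x
    simpa using this

variable [DecidableEq S]

lemma hasSum_matrix_exp (B : Matrix S S ℝ) (x y : S) :
    HasSum (fun n : ℕ => (n.factorial : ℝ)⁻¹ * (B ^ n) x y) (NormedSpace.exp B x y) := by
  let : NormedRing (Matrix S S ℝ) := Matrix.linftyOpNormedRing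
  let : NormedAlgebra ℝ (Matrix S S ℝ) := Matrix.linftyOpNormedAlgebra
  have h := NormedSpace.exp_series_hasSum_exp' (𝕂 := ℝ) B
  have h2 := (Pi.hasSum.1 ((Pi.hasSum.1 h) x)) y
  exact h2

lemma hasDerivAt_matrix_exp (T : Matrix S S ℝ) (t : ℝ) (x y : S) :
    HasDerivAt (fun u : ℝ => NormedSpace.exp (u • T) x y)
      ((NormedSpace.exp (t • T) * T) x y) t := by
  let : NormedRing (Matrix S S ℝ) := Matrix.linftyOpNormedRing
  let : NormedAlgebra ℝ (Matrix S S ℝ) := Matrix.linftyOpNormedAlgebra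
  have h := hasDerivAt_exp_smul_const T t
  exact (hasDerivAt_pi.1 ((hasDerivAt_pi.1 h) x)) y

lemma matrix_exp_add_smul (T : Matrix S S ℝ) (s t : ℝ) :
    NormedSpace.exp ((s + t) • T) = NormedSpace.exp (s • T) * NormedSpace.exp (t • T) := by
  rw [add_smul]
  exact Matrix.exp_add_of_commute _ _ ((Commute.refl T).smul_left s |>.smul_right t)

lemma hasDerivAt_matrix_exp_mulVec (T : Matrix S S ℝ) (v : S → ℝ) (t : ℝ) (x : S) :
    HasDerivAt (fun u : ℝ => (NormedSpace.exp (u • T)).mulVec v x)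
      ((NormedSpace.exp (t • T)).mulVec (T.mulVec v) x) t := by
  have := HasDerivAt.fun_sum (u := Finset.univ) fun y _ =>
    (hasDerivAt_matrix_exp T t x y).mul_const (v y)
  rw [Matrix.mulVec_mulVec]
  exact this

/-- The transition function of a chain is the exponential of a nonnegative matrix, up to a positive
factor. -/
lemma matrix_exp_eq_smul_exp (T : Matrix S S ℝ) (c : ℝ) :
    NormedSpace.exp T = Real.exp (-c) • NormedSpace.exp (T + c • (1 : Matrix S S ℝ)) := by
  have h : T = (-c) • (1 : Matrix S S ℝ) + (T + c • 1) := by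
    rw [neg_smul]; abel
  have hc : NormedSpace.exp ((-c) • (1 : Matrix S S ℝ)) = Real.exp (-c) • 1 := by
    have e : (-c) • (1 : Matrix S S ℝ) = Matrix.diagonal fun _ => -c := by
      ext i j; by_cases h : i = j <;> simp [h]
    rw [e, Matrix.exp_diagonal]
    ext i j
    by_cases h : i = j
    · subst h
      simp only [Matrix.diagonal_apply_eq, Matrix.smul_apply, Matrix.one_apply_eq, smul_eq_mul,
        mul_one, Real.exp_eq_exp_ℝ]
      exact Pi.coe_exp _ i
    · simp [h]
  conv_lhs => rw [h]
  rw [Matrix.exp_add_of_commute _ _ ((Commute.one_left _).smul_left _), hc, smul_mul_assoc, one_mul]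

lemma exists_nonneg_add_smul_one (T : Matrix S S ℝ) (hT : ∀ x y, x ≠ y → 0 ≤ T x y) :
    ∃ c : ℝ, 0 ≤ c ∧ ∀ x y, 0 ≤ (T + c • (1 : Matrix S S ℝ)) x y := by
  refine ⟨∑ x, |T x x|, Finset.sum_nonneg fun _ _ => abs_nonneg _, fun x y => ?_⟩
  by_cases h : x = y
  · subst h
    have := Finset.single_le_sum (f := fun x => |T x x|) (fun _ _ => abs_nonneg _)
      (Finset.mem_univ x)
    have h2 := neg_abs_le (T x x)
    simp only [Matrix.add_apply, Matrix.smul_apply, Matrix.one_apply_eq, smul_eq_mul, mul_one]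
    linarith
  · simpa [h] using hT x y h

lemma matrix_pow_nonneg {B : Matrix S S ℝ} (hB : ∀ x y, 0 ≤ B x y) (n : ℕ) (x y : S) :
    0 ≤ (B ^ n) x y := by
  induction n generalizing x y with
  | zero => by_cases h : x = y <;> simp [h, Matrix.one_apply]
  | succ n ih =>
    rw [pow_succ, Matrix.mul_apply]
    exact Finset.sum_nonneg fun z _ => mul_nonneg (ih x z) (hB z y)

lemma matrix_exp_nonneg {T : Matrix S S ℝ} (hT : ∀ x y, x ≠ y → 0 ≤ T x y) (x y : S) :
    0 ≤ NormedSpace.exp T x y := by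
  obtain ⟨c, -, hc⟩ := exists_nonneg_add_smul_one T hT
  rw [matrix_exp_eq_smul_exp T c]
  refine mul_nonneg (Real.exp_pos _).le ((hasSum_matrix_exp _ x y).nonneg fun n => ?_)
  exact mul_nonneg (by positivity) (matrix_pow_nonneg hc n x y)

lemma matrix_exp_smul_nonneg {T : Matrix S S ℝ} (hT : ∀ x y, x ≠ y → 0 ≤ T x y) {t : ℝ}
    (ht : 0 ≤ t) (x y : S) : 0 ≤ NormedSpace.exp (t • T) x y :=
  matrix_exp_nonneg (fun x y h => mul_nonneg ht (hT x y h)) x y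

/-- The derivative is `exp (t T) (T v)`, a nonnegative matrix applied to a nonpositive vector. -/
lemma antitoneOn_matrix_exp_mulVec {T : Matrix S S ℝ} (hT : ∀ x y, x ≠ y → 0 ≤ T x y)
    {v : S → ℝ} (hv : ∀ x, T.mulVec v x ≤ 0) (x : S) :
    AntitoneOn (fun t : ℝ => (NormedSpace.exp (t • T)).mulVec v x) (Set.Ici 0) := by
  have hd := fun t => hasDerivAt_matrix_exp_mulVec T v t x
  refine antitoneOn_of_deriv_nonpos (convex_Ici 0)
    (fun t _ => (hd t).continuousAt.continuousWithinAt)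
    (fun t _ => (hd t).differentiableAt.differentiableWithinAt) fun t ht => ?_
  rw [(hd t).deriv]
  rw [interior_Ici, Set.mem_Ioi] at ht
  refine Finset.sum_nonpos fun y _ => ?_
  exact mul_nonpos_of_nonneg_of_nonpos (matrix_exp_smul_nonneg hT ht.le x y) (hv y)

/-- The survival probabilities `exp (t T) 1` decrease to a limit `L` that is invariant under the
semigroup. Hence `T L = 0`, and invertibility gives `L = 0`; the entries of the exponential are
dominated by these row sums. -/
lemma isTransientGenerator_of_isUnit {T : Matrix S S ℝ} (hT : ∀ x y, x ≠ y → 0 ≤ T x y)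
    (hsum : ∀ x, ∑ y, T x y ≤ 0) (hu : IsUnit T) : IsTransientGenerator T := by
  refine ⟨hT, hsum, ?_⟩
  have h1 : ∀ x, T.mulVec 1 x ≤ 0 := fun x => by simpa [Matrix.mulVec, dotProduct] using hsum x
  let f : S → ℝ → ℝ := fun x t => (NormedSpace.exp (t • T)).mulVec 1 x
  have hf0 : ∀ x t, 0 ≤ t → 0 ≤ f x t := fun x t ht =>
    Finset.sum_nonneg fun y _ => mul_nonneg (matrix_exp_smul_nonneg hT ht x y) zero_le_one
  have hlim : ∀ x, ∃ L, Tendsto (f x) atTop (𝓝 L) := by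
    intro x
    have ha : Antitone fun t => f x (max t 0) := fun a b hab =>
      antitoneOn_matrix_exp_mulVec hT h1 x (Set.mem_Ici.2 (le_max_right a 0))
        (Set.mem_Ici.2 (le_max_right b 0))
        (max_le_max_right 0 hab)
    refine ⟨_, (tendsto_atTop_ciInf ha ⟨0, ?_⟩).congr' ?_⟩
    · rintro _ ⟨t, rfl⟩
      exact hf0 x _ (le_max_right _ _)
    · filter_upwards [eventually_ge_atTop 0] with t ht
      rw [max_eq_left ht]
  choose L hL using hlim
  have hinv : ∀ (s : ℝ) x, (NormedSpace.exp (s • T)).mulVec L x = L x := by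
    intro s x
    have e : ∀ t, f x (s + t) = ∑ y, NormedSpace.exp (s • T) x y * f y t := fun t => by
      simp only [f, matrix_exp_add_smul, ← Matrix.mulVec_mulVec]
      rfl
    have t1 : Tendsto (fun t => f x (s + t)) atTop (𝓝 (L x)) :=
      (hL x).comp (tendsto_atTop_add_const_left _ s tendsto_id)
    simp_rw [e] at t1
    have t2 : Tendsto (fun t => ∑ y, NormedSpace.exp (s • T) x y * f y t) atTop
        (𝓝 (∑ y, NormedSpace.exp (s • T) x y * L y)) :=
      tendsto_finsetSum _ fun y _ => (hL y).const_mul _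
    exact tendsto_nhds_unique t2 t1
  have hTL : T.mulVec L = 0 := by
    funext x
    have h := hasDerivAt_matrix_exp_mulVec T L 0 x
    simp_rw [hinv] at h
    have h2 := h.unique (hasDerivAt_const 0 (L x))
    simpa using h2
  have hL0 : L = 0 := Matrix.mulVec_injective_iff_isUnit.2 hu (by simpa using hTL)
  intro x y
  refine squeeze_zero' ?_ ?_ (by simpa [hL0] using hL x : Tendsto (f x) atTop (𝓝 0))
  · filter_upwards [eventually_ge_atTop 0] with t ht
    exact matrix_exp_smul_nonneg hT ht x y
  · filter_upwards [eventually_ge_atTop 0] with t ht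
    simp only [f, Matrix.mulVec, dotProduct, Pi.one_apply, mul_one]
    exact Finset.single_le_sum (f := fun z => NormedSpace.exp (t • T) x z)
      (fun z _ => matrix_exp_smul_nonneg hT ht x z) (Finset.mem_univ y)

/-- Along the semigroup `v` decreases, and by transience it decreases to zero, so it starts
nonnegative. -/
lemma nonneg_of_mulVec_nonpos {T : Matrix S S ℝ} (hT : IsTransientGenerator T) {v : S → ℝ}
    (hv : ∀ x, T.mulVec v x ≤ 0) (x : S) : 0 ≤ v x := by
  have ha := antitoneOn_matrix_exp_mulVec hT.1 hv x
  have t1 : Tendsto (fun t : ℝ => (NormedSpace.exp (t • T)).mulVec v x) atTop (𝓝 0) := by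
    have := tendsto_finsetSum Finset.univ fun y (_ : y ∈ Finset.univ) =>
      (hT.2.2 x y).mul_const (v y)
    simpa [Matrix.mulVec, dotProduct] using this
  refine le_of_tendsto t1 ?_
  filter_upwards [eventually_ge_atTop 0] with t ht
  have := ha (Set.mem_Ici.2 le_rfl) (Set.mem_Ici.2 ht) ht
  simpa using this

lemma neg_inv_nonneg {T : Matrix S S ℝ} (hT : IsTransientGenerator T) (hu : IsUnit T) (x y : S) :
    0 ≤ (-T)⁻¹ x y := by
  have hd : IsUnit (-T).det := (Matrix.isUnit_iff_isUnit_det _).1 hu.neg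
  refine nonneg_of_mulVec_nonpos hT (v := (-T)⁻¹.col y) (fun z => ?_) x
  have h : (-T) * (-T)⁻¹ = 1 := Matrix.mul_nonsing_inv _ hd
  have h2 : T.mulVec ((-T)⁻¹.col y) z = -((-T) * (-T)⁻¹) z y := by
    simp [Matrix.mul_apply, Matrix.mulVec, dotProduct, Matrix.col]
  rw [h2, h, Matrix.one_apply]
  split_ifs <;> simp

end FiniteGenerators

/-! ### Restricted chains -/

section RestrictedChains

variable {L P : Type*} [Fintype L] [DecidableEq L] [Fintype P] [DecidableEq P] {r : ℕ}

/-- The states, split into those whose level is among the `e a` and the other ones. -/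
def levelSplit (e : Fin r → L) (he : Function.Injective e) :
    (Fin r × P) ⊕ {x : L × P // ∀ a, e a ≠ x.1} ≃ L × P :=
  Equiv.ofBijective (Sum.elim (fun a => (e a.1, a.2)) Subtype.val) <| by
    constructor
    · rintro (⟨a, i⟩ | ⟨x, hx⟩) (⟨b, j⟩ | ⟨y, hy⟩) h
      · simp only [Sum.elim_inl, Prod.mk.injEq] at h
        rw [he h.1, h.2]
      · simp only [Sum.elim_inl, Sum.elim_inr] at h
        exact absurd (congrArg Prod.fst h) (hy a)
      · simp only [Sum.elim_inl, Sum.elim_inr] at h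
        exact absurd (congrArg Prod.fst h).symm (hx b)
      · simp only [Sum.elim_inr] at h
        simp [h]
    · rintro ⟨k, i⟩
      by_cases h : ∃ a, e a = k
      · obtain ⟨a, rfl⟩ := h
        exact ⟨Sum.inl (a, i), rfl⟩
      · push Not at h
        exact ⟨Sum.inr ⟨(k, i), h⟩, rfl⟩

lemma sum_levelSplit (e : Fin r → L) (he : Function.Injective e) (f : L × P → ℝ) :
    ∑ x, f x = ∑ a : Fin r × P, f (e a.1, a.2) +
      ∑ x : {x : L × P // ∀ a, e a ≠ x.1}, f x.1 := by
  rw [← (levelSplit e he).sum_comp f, Fintype.sum_sum_type]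
  rfl

variable {T : Matrix (L × P) (L × P) ℝ} {e : Fin r → L}

lemma outerBlock_isTransientGenerator (hT : ∀ x y, x ≠ y → 0 ≤ T x y)
    (hsum : ∀ x, ∑ y, T x y ≤ 0) (he : Function.Injective e) (hu : IsUnit (outerBlock T e)) :
    IsTransientGenerator (outerBlock T e) := by
  refine isTransientGenerator_of_isUnit (fun x y h => hT _ _ fun h' => h (Subtype.ext h'))
    (fun x => ?_) hu
  have h := hsum x.1
  rw [sum_levelSplit e he] at h
  have h2 : 0 ≤ ∑ a : Fin r × P, T x.1 (e a.1, a.2) :=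
    Finset.sum_nonneg fun a _ => hT _ _ fun h' => x.2 a.1 (congrArg Prod.fst h').symm
  have h3 : ∑ y, outerBlock T e x y =
    ∑ y : {x : L × P // ∀ a, e a ≠ x.1}, T x.1 y.1 := rfl
  linarith

/-- The restricted generator is the Schur complement of the outer block, so its determinant divides
that of `T`. -/
lemma isUnit_restrictToLevels (he : Function.Injective e) (hT : IsUnit T)
    (hu : IsUnit (outerBlock T e)) : IsUnit (restrictToLevels T e) := by
  let inn : Fin r × P → L × P := fun a => (e a.1, a.2)
  let out : {x : L × P // ∀ a, e a ≠ x.1} → L × P := Subtype.val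
  have hs : T.submatrix (levelSplit e he) (levelSplit e he) =
      Matrix.fromBlocks (T.submatrix inn inn) (T.submatrix inn out) (T.submatrix out inn)
        (outerBlock T e) := by
    ext x y
    rcases x with x | x <;> rcases y with y | y <;> rfl
  let : Invertible (outerBlock T e) := hu.invertible
  have hdet := congrArg Matrix.det hs
  rw [Matrix.det_submatrix_equiv_self, Matrix.det_fromBlocks₂₂] at hdet
  have hr : restrictToLevels T e = T.submatrix inn inn - T.submatrix inn out *
      ⅟(outerBlock T e) * T.submatrix out inn := by
    have hn : (-outerBlock T e)⁻¹ = -⅟(outerBlock T e) := by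
      refine Matrix.inv_eq_left_inv ?_
      simp
    simp only [restrictToLevels, hn]
    simp only [Matrix.mul_neg, Matrix.neg_mul, sub_eq_add_neg]
    rfl
  rw [Matrix.isUnit_iff_isUnit_det, hr]
  have h1 := (Matrix.isUnit_iff_isUnit_det T).1 hT
  rw [hdet] at h1
  exact isUnit_of_mul_isUnit_right h1

/-- Excursions through the eliminated levels add nonnegative rates since `(-T₂₂)⁻¹ ≥ 0`, and they
return with probability at most one, so row sums stay nonpositive. Invertibility then yields
transience. -/
lemma restrictToLevels_isTransientGenerator (hT : ∀ x y, x ≠ y → 0 ≤ T x y)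
    (hsum : ∀ x, ∑ y, T x y ≤ 0) (he : Function.Injective e) (hTu : IsUnit T)
    (hu : IsUnit (outerBlock T e)) : IsTransientGenerator (restrictToLevels T e) := by
  have ht := outerBlock_isTransientGenerator hT hsum he hu
  have hd : IsUnit (-outerBlock T e).det := (Matrix.isUnit_iff_isUnit_det _).1 hu.neg
  let inn : Fin r × P → L × P := fun a => (e a.1, a.2)
  let out : {x : L × P // ∀ a, e a ≠ x.1} → L × P := Subtype.val
  have hio : ∀ a x, inn a ≠ out x := fun a x h => x.2 a.1 (congrArg Prod.fst h)
  have hinn : Function.Injective inn := fun a b h => by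
    have h1 := congrArg Prod.fst h
    have h2 := congrArg Prod.snd h
    exact Prod.ext (he h1) h2
  have h12 : ∀ a x, 0 ≤ T.submatrix inn out a x := fun a x => hT _ _ (hio a x)
  have h21 : ∀ x a, 0 ≤ T.submatrix out inn x a := fun x a => hT _ _ (hio a x).symm
  refine isTransientGenerator_of_isUnit (fun a b hab => ?_) (fun a => ?_)
    (isUnit_restrictToLevels he hTu hu)
  · refine add_nonneg (hT _ _ fun h => hab (hinn h)) ?_
    rw [Matrix.mul_apply]
    refine Finset.sum_nonneg fun x _ => mul_nonneg ?_ (h21 x b)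
    rw [Matrix.mul_apply]
    exact Finset.sum_nonneg fun y _ => mul_nonneg (h12 a y) (neg_inv_nonneg ht hu y x)
  -- `w` is the probability of reaching the observed levels from an eliminated state; `T₂₂ (1 - w)`
  -- is the row sum of `T`, hence nonpositive, which gives `w ≤ 1`.
  · let w : {x : L × P // ∀ a, e a ≠ x.1} → ℝ :=
      (-outerBlock T e)⁻¹.mulVec ((T.submatrix out inn).mulVec 1)
    have hw : ∀ x, w x ≤ 1 := by
      intro x
      have := nonneg_of_mulVec_nonpos ht (v := 1 - w) (fun z => ?_) x
      · simpa using this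
      · have hTw : (outerBlock T e).mulVec w = -(T.submatrix out inn).mulVec 1 := by
          have : (-outerBlock T e).mulVec w = (T.submatrix out inn).mulVec 1 := by
            rw [Matrix.mulVec_mulVec, Matrix.mul_nonsing_inv _ hd, Matrix.one_mulVec]
          rw [← this, Matrix.neg_mulVec, neg_neg]
        rw [Matrix.mulVec_sub, hTw, sub_neg_eq_add]
        have h := hsum z.1
        rw [sum_levelSplit e he] at h
        simp only [Pi.add_apply, Matrix.mulVec, dotProduct, Pi.one_apply, mul_one]
        rw [add_comm]
        exact h
    have h := hsum (inn a)
    rw [sum_levelSplit e he] at h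
    have e1 : ∑ b, restrictToLevels T e a b =
        ∑ b : Fin r × P, T (inn a) (e b.1, b.2) + (T.submatrix inn out).mulVec w a := by
      have : ∀ b, restrictToLevels T e a b = T (inn a) (e b.1, b.2) +
          (T.submatrix inn out * (-outerBlock T e)⁻¹ * T.submatrix out inn) a b := fun b => rfl
      simp_rw [this]
      rw [Finset.sum_add_distrib]
      congr 1
      have h2 : (T.submatrix inn out).mulVec w =
          (T.submatrix inn out * (-outerBlock T e)⁻¹ * T.submatrix out inn).mulVec 1 := by
        simp only [w, Matrix.mulVec_mulVec, Matrix.mul_assoc]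
      rw [h2]
      simp [Matrix.mulVec, dotProduct]
    rw [e1]
    have e2 : (T.submatrix inn out).mulVec w a ≤
        ∑ x : {x : L × P // ∀ a, e a ≠ x.1}, T (inn a) x.1 := by
      refine Finset.sum_le_sum fun x _ => ?_
      have := mul_le_mul_of_nonneg_left (hw x) (h12 a x)
      simpa using this
    linarith

/-- The block column of functions of the level, as an ordinary matrix. -/
def flatColumns (V : L → Fin r → Matrix P P ℝ) : Matrix (L × P) (Fin r × P) ℝ :=
  Matrix.of fun x c => V x.1 c.1 x.2 c.2

/-- If the columns of `V` are harmonic for `T` outside of the levels `e a`, then their images at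
these levels are the product of the restricted chain and of their values at these levels. -/
lemma flat_eq_restrictToLevels_mul (he : Function.Injective e) (hu : IsUnit (outerBlock T e))
    {V : L → Fin r → Matrix P P ℝ} {Z : Matrix (Fin r) (Fin r) (Matrix P P ℝ)}
    (hin : ∀ a i c, (T * flatColumns V) (e a, i) c = flat Z (a, i) c)
    (hout : ∀ k, (∀ a, e a ≠ k) → ∀ i c, (T * flatColumns V) (k, i) c = 0) :
    flat Z = restrictToLevels T e * flat (Matrix.of fun a b => V (e a) b) := by
  have hd : IsUnit (-outerBlock T e).det := (Matrix.isUnit_iff_isUnit_det _).1 hu.neg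
  let inn : Fin r × P → L × P := fun a => (e a.1, a.2)
  let out : {x : L × P // ∀ a, e a ≠ x.1} → L × P := Subtype.val
  let K := flat (Matrix.of fun a b => V (e a) b)
  let V2 := (flatColumns V).submatrix out id
  have h1 : flat Z = T.submatrix inn inn * K + T.submatrix inn out * V2 := by
    ext ⟨a, i⟩ c
    rw [← hin, Matrix.mul_apply, sum_levelSplit e he]
    rfl
  have h2 : T.submatrix out inn * K + outerBlock T e * V2 = 0 := by
    ext x c
    have := hout x.1.1 x.2 x.1.2 c
    rw [Matrix.mul_apply, sum_levelSplit e he] at this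
    exact this
  have h3 : V2 = (-outerBlock T e)⁻¹ * (T.submatrix out inn * K) := by
    have : T.submatrix out inn * K = (-outerBlock T e) * V2 := by
      rw [Matrix.neg_mul]
      exact eq_neg_of_add_eq_zero_left h2
    rw [this, ← Matrix.mul_assoc, Matrix.nonsing_inv_mul _ hd, Matrix.one_mul]
  rw [h1, h3]
  change _ = (T.submatrix inn inn + T.submatrix inn out * (-outerBlock T e)⁻¹ *
    T.submatrix out inn) * K
  rw [Matrix.add_mul]
  simp only [Matrix.mul_assoc]

/-- Superposition: at the observed levels `Z x = -b` cancels the defect of `μ`, elsewhere the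
columns are harmonic and `μ` is already exact. The sum thus has the same image as `m` under the
injective `T`. -/
lemma eq_flatColumns_mulVec_blockSolve_add (hT : IsUnit T)
    {V : L → Fin r → Matrix P P ℝ} {Z : Matrix (Fin r) (Fin r) (Matrix P P ℝ)}
    (hin : ∀ a i c, (T * flatColumns V) (e a, i) c = flat Z (a, i) c)
    (hout : ∀ k, (∀ a, e a ≠ k) → ∀ i c, (T * flatColumns V) (k, i) c = 0)
    (hZ : IsUnit (flat Z)) {b : Fin r → P → ℝ} {μ g m : L × P → ℝ}
    (hμin : ∀ a i, T.mulVec μ (e a, i) = b a i - g (e a, i))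
    (hμout : ∀ k, (∀ a, e a ≠ k) → ∀ i, T.mulVec μ (k, i) = - g (k, i))
    (hm : T.mulVec m = -g) (k : L) (i : P) :
    m (k, i) = ∑ a, (V k a).mulVec (blockSolve Z b a) i + μ (k, i) := by
  let x : Fin r × P → ℝ := fun c => blockSolve Z b c.1 c.2
  have hd : IsUnit (-flat Z).det := (Matrix.isUnit_iff_isUnit_det _).1 hZ.neg
  have hx : (flat Z).mulVec x = fun c => -b c.1 c.2 := by
    have e1 : x = (-flat Z)⁻¹.mulVec fun c => b c.1 c.2 := rfl
    have e2 : (-flat Z).mulVec x = fun c => b c.1 c.2 := by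
      rw [e1, Matrix.mulVec_mulVec, Matrix.mul_nonsing_inv _ hd, Matrix.one_mulVec]
    rw [Matrix.neg_mulVec] at e2
    rw [← neg_neg ((flat Z).mulVec x), e2]
    rfl
  have hTV : T.mulVec ((flatColumns V).mulVec x + μ) = -g := by
    rw [Matrix.mulVec_add, Matrix.mulVec_mulVec]
    funext ⟨l, i⟩
    by_cases hl : ∃ a, e a = l
    · obtain ⟨a, rfl⟩ := hl
      have : (T * flatColumns V).mulVec x (e a, i) = (flat Z).mulVec x (a, i) :=
        Finset.sum_congr rfl fun c _ => congrArg (· * x c) (hin a i c)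
      rw [Pi.add_apply, this, hx, hμin, Pi.neg_apply]
      ring
    · push Not at hl
      have : (T * flatColumns V).mulVec x (l, i) = 0 :=
        Finset.sum_eq_zero fun c _ => mul_eq_zero_of_left (hout l hl i c) _
      rw [Pi.add_apply, this, hμout l hl, Pi.neg_apply]
      ring
  have h := Matrix.mulVec_injective_iff_isUnit.2 hT (hm.trans hTV.symm)
  rw [h, Pi.add_apply]
  congr 1
  simp only [Matrix.mulVec, dotProduct, Fintype.sum_prod_type]
  rfl

end RestrictedChains

/-! ### The chain absorbed in one state -/

section Absorption

variable {S : Type*} [Fintype S] [DecidableEq S] {Q : Matrix S S ℝ}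

lemma absorbAt_mulVec (s : S) (u : S → ℝ) (x : S) :
    (absorbAt Q s).mulVec u x = if x = s then -u s else Q.mulVec u x := by
  unfold absorbAt Matrix.mulVec
  by_cases h : x = s
  · subst h
    simp [dotProduct, Pi.single_apply]
  · simp [h]

lemma absorbAt_nonneg (hQ : ∀ x y, x ≠ y → 0 ≤ Q x y) (s x y : S) (h : x ≠ y) :
    0 ≤ absorbAt Q s x y := by
  unfold absorbAt
  by_cases hx : x = s
  · subst hx
    simp [h.symm]
  · simpa [hx] using hQ x y h

lemma absorbAt_sum_nonpos (hsum : ∀ x, ∑ y, Q x y = 0) (s x : S) :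
    ∑ y, absorbAt Q s x y ≤ 0 := by
  have h := absorbAt_mulVec (Q := Q) s 1 x
  have h1 : (absorbAt Q s).mulVec 1 x = ∑ y, absorbAt Q s x y := by
    simp [Matrix.mulVec, dotProduct]
  have h2 : Q.mulVec 1 x = 0 := by simp [Matrix.mulVec, dotProduct, hsum]
  rw [← h1, h, h2]
  split_ifs <;> simp

/-- A null vector vanishes at `s` and is harmonic for `Q` elsewhere, so the maximum principle
applies to it. -/
lemma isUnit_absorbAt (hQ : ∀ x y, x ≠ y → 0 ≤ Q x y) (hsum : ∀ x, ∑ y, Q x y = 0)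
    (hirr : IrreducibleRates Q) (s : S) : IsUnit (absorbAt Q s) := by
  refine Matrix.mulVec_injective_iff_isUnit.1 ?_
  refine (injective_iff_map_eq_zero (absorbAt Q s).mulVecLin).2 fun u hu => ?_
  have hu' : ∀ x, (absorbAt Q s).mulVec u x = 0 := fun x => congrFun hu x
  simp only [absorbAt_mulVec] at hu'
  refine eq_zero_of_mulVec_eq_zero hQ hsum hirr (A := {s}) (s := s) rfl (fun x hx => ?_)
    fun x hx => ?_
  · rw [Set.mem_singleton_iff.1 hx]
    simpa using hu' s
  · simpa [show x ≠ s from hx] using hu' x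

end Absorption

/-- A null vector of the outer block, extended by zero to the observed levels, is harmonic off these
levels. The absorbing state lies in one of them, so the altered row never interferes. -/
lemma isUnit_outerBlock_absorbAt {L P : Type*} [Fintype L] [DecidableEq L] [Fintype P]
    [DecidableEq P] {r : ℕ} {Q : Matrix (L × P) (L × P) ℝ} (hQ : ∀ x y, x ≠ y → 0 ≤ Q x y)
    (hsum : ∀ x, ∑ y, Q x y = 0) (hirr : IrreducibleRates Q) {e : Fin r → L}
    (he : Function.Injective e) (a : Fin r) (j : P) :
    IsUnit (outerBlock (absorbAt Q (e a, j)) e) := by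
  refine Matrix.mulVec_injective_iff_isUnit.1 ?_
  refine (injective_iff_map_eq_zero (outerBlock (absorbAt Q (e a, j)) e).mulVecLin).2 fun u hu => ?_
  classical
  let v : L × P → ℝ := fun x => if h : ∀ a, e a ≠ x.1 then u ⟨x, h⟩ else 0
  have hv : v = 0 := by
    refine eq_zero_of_mulVec_eq_zero hQ hsum hirr (A := {x | ¬ ∀ a, e a ≠ x.1}) (s := (e a, j))
      (fun h => h a rfl) (fun x hx => dif_neg hx) fun x hx => ?_
    have hx : ∀ a, e a ≠ x.1 := not_not.1 hx
    have hne : x ≠ (e a, j) := fun h => hx a (congrArg Prod.fst h).symm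
    have h1 := congrFun hu ⟨x, hx⟩
    have h2 : (absorbAt Q (e a, j)).mulVec v x = 0 := by
      rw [Matrix.mulVec, dotProduct, sum_levelSplit e he]
      have e1 : ∀ b : Fin r × P, v (e b.1, b.2) = 0 := fun b => dif_neg fun h => h b.1 rfl
      have e2 : ∀ y : {x : L × P // ∀ a, e a ≠ x.1}, v y.1 = u y := fun y => dif_pos y.2
      simp only [e1, e2, mul_zero, Finset.sum_const_zero, zero_add]
      exact h1
    rwa [absorbAt_mulVec, if_neg hne] at h2
  funext x
  have : v x.1 = u x := dif_pos x.2
  rw [← this, hv]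
  rfl

/-! ### Quadratic matrix equations and the drift -/

section QuadraticEquation

variable {P : Type*} [Fintype P]

lemma matrix_mulVec_mono {A : Matrix P P ℝ} (hA : ∀ i j, 0 ≤ A i j) {v w : P → ℝ} (h : v ≤ w) :
    A.mulVec v ≤ A.mulVec w := fun i =>
  Finset.sum_le_sum fun j _ => mul_le_mul_of_nonneg_left (h j) (hA i j)

lemma matrix_mul_nonneg {A B : Matrix P P ℝ} (hA : ∀ i j, 0 ≤ A i j) (hB : ∀ i j, 0 ≤ B i j)
    (i j : P) : 0 ≤ (A * B) i j :=
  Finset.sum_nonneg fun k _ => mul_nonneg (hA i k) (hB k j)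

lemma matrix_mul_le_mul {A B A' B' : Matrix P P ℝ} (hA : ∀ i j, A i j ≤ A' i j)
    (hB : ∀ i j, B i j ≤ B' i j) (hA' : ∀ i j, 0 ≤ A' i j) (hB0 : ∀ i j, 0 ≤ B i j) (i j : P) :
    (A * B) i j ≤ (A' * B') i j :=
  Finset.sum_le_sum fun k _ => mul_le_mul (hA i k) (hB k j) (hB0 k j) (hA' i k)

variable [DecidableEq P]

/-- A random walk with phases, one level down at the rates `U`, within a level at the rates `V`,
one level up at the rates `W`, with irreducible phase process. -/
structure LevelWalk (U V W : Matrix P P ℝ) : Prop where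
  down_nonneg : ∀ i j, 0 ≤ U i j
  within_nonneg : ∀ i j, i ≠ j → 0 ≤ V i j
  up_nonneg : ∀ i j, 0 ≤ W i j
  sum_eq_zero : ∀ i, ∑ j, U i j + ∑ j, V i j + ∑ j, W i j = 0
  irreducible : IrreducibleRates (U + V + W)

namespace LevelWalk

variable {U V W : Matrix P P ℝ}

lemma symm (h : LevelWalk U V W) : LevelWalk W V U where
  down_nonneg := h.up_nonneg
  within_nonneg := h.within_nonneg
  up_nonneg := h.down_nonneg
  sum_eq_zero i := by linarith [h.sum_eq_zero i]
  irreducible := by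
    have e : W + V + U = U + V + W := by abel
    rw [e]
    exact h.irreducible

/-- The fixed-point form of the quadratic equation, after uniformization at rate `c`. -/
def step (U V W : Matrix P P ℝ) (c : ℝ) (X : Matrix P P ℝ) : Matrix P P ℝ :=
  c⁻¹ • (U + (V + c • (1 : Matrix P P ℝ)) * X + W * (X * X))

lemma step_eq_self_iff {c : ℝ} (hc : 0 < c) (X : Matrix P P ℝ) :
    step U V W c X = X ↔ U + V * X + W * X ^ 2 = 0 := by
  have e : step U V W c X = c⁻¹ • (U + V * X + W * X ^ 2) + X := by
    simp only [step, Matrix.add_mul, Matrix.smul_mul, Matrix.one_mul, pow_two, smul_add]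
    rw [inv_smul_smul₀ hc.ne']
    abel
  rw [e, add_eq_right, smul_eq_zero]
  simp [hc.ne']

variable {c : ℝ}

lemma step_nonneg (h : LevelWalk U V W) (hc : 0 < c)
    (hV : ∀ i j, 0 ≤ (V + c • (1 : Matrix P P ℝ)) i j) {X : Matrix P P ℝ}
    (hX : ∀ i j, 0 ≤ X i j) (i j : P) : 0 ≤ step U V W c X i j := by
  refine mul_nonneg (inv_nonneg.2 hc.le) (add_nonneg (add_nonneg (h.down_nonneg i j) ?_) ?_)
  · exact matrix_mul_nonneg hV hX i j
  · exact matrix_mul_nonneg h.up_nonneg (matrix_mul_nonneg hX hX) i j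

lemma step_mono (h : LevelWalk U V W) (hc : 0 < c)
    (hV : ∀ i j, 0 ≤ (V + c • (1 : Matrix P P ℝ)) i j) {X Y : Matrix P P ℝ}
    (hX : ∀ i j, 0 ≤ X i j) (hXY : ∀ i j, X i j ≤ Y i j) (i j : P) :
    step U V W c X i j ≤ step U V W c Y i j := by
  have hY : ∀ i j, 0 ≤ Y i j := fun i j => (hX i j).trans (hXY i j)
  refine mul_le_mul_of_nonneg_left (add_le_add (add_le_add le_rfl ?_) ?_) (inv_nonneg.2 hc.le)
  · exact matrix_mul_le_mul (fun _ _ => le_rfl) hXY hV hX i j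
  · exact matrix_mul_le_mul (fun _ _ => le_rfl) (matrix_mul_le_mul hXY hXY hY hX)
      h.up_nonneg (matrix_mul_nonneg hX hX) i j

lemma iterate_step_nonneg (h : LevelWalk U V W) (hc : 0 < c)
    (hV : ∀ i j, 0 ≤ (V + c • (1 : Matrix P P ℝ)) i j) (k : ℕ) (i j : P) :
    0 ≤ (step U V W c)^[k] 0 i j := by
  induction k generalizing i j with
  | zero => exact le_rfl
  | succ k ih =>
    rw [Function.iterate_succ_apply']
    exact h.step_nonneg hc hV ih i j

lemma iterate_step_le_succ (h : LevelWalk U V W) (hc : 0 < c)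
    (hV : ∀ i j, 0 ≤ (V + c • (1 : Matrix P P ℝ)) i j) (k : ℕ) (i j : P) :
    (step U V W c)^[k] 0 i j ≤ (step U V W c)^[k + 1] 0 i j := by
  induction k generalizing i j with
  | zero => exact h.iterate_step_nonneg hc hV 1 i j
  | succ k ih =>
    rw [Function.iterate_succ_apply', Function.iterate_succ_apply' _ (k + 1)]
    exact h.step_mono hc hV (h.iterate_step_nonneg hc hV k) ih i j

lemma iterate_step_le (h : LevelWalk U V W) (hc : 0 < c)
    (hV : ∀ i j, 0 ≤ (V + c • (1 : Matrix P P ℝ)) i j) {Y : Matrix P P ℝ}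
    (hY : IsNonnegSolution U V W Y) (k : ℕ) (i j : P) :
    (step U V W c)^[k] 0 i j ≤ Y i j := by
  induction k generalizing i j with
  | zero => exact hY.1 i j
  | succ k ih =>
    rw [Function.iterate_succ_apply']
    have := h.step_mono hc hV (h.iterate_step_nonneg hc hV k) ih i j
    rwa [(step_eq_self_iff hc Y).2 hY.2] at this

/-- A positive vector `s` such that `lam ^ k * s i` is superharmonic bounds the iterates. -/
lemma iterate_step_mulVec_le (h : LevelWalk U V W) (hc : 0 < c)
    (hV : ∀ i j, 0 ≤ (V + c • (1 : Matrix P P ℝ)) i j) {lam : ℝ} (hlam : 0 ≤ lam) {s : P → ℝ}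
    (hs : 0 ≤ s) (hsup : U.mulVec s + lam • V.mulVec s + lam ^ 2 • W.mulVec s ≤ 0) (k : ℕ) :
    ((step U V W c)^[k] 0).mulVec s ≤ lam • s := by
  induction k with
  | zero =>
    intro i
    simpa using mul_nonneg hlam (hs i)
  | succ k ih =>
    rw [Function.iterate_succ_apply']
    set X := (step U V W c)^[k] 0 with hX
    have h0 := h.iterate_step_nonneg hc hV k
    have h1 : (V + c • (1 : Matrix P P ℝ)).mulVec (X.mulVec s) ≤
        lam • (V.mulVec s + c • s) := by
      refine (matrix_mulVec_mono hV ih).trans (le_of_eq ?_)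
      rw [Matrix.mulVec_smul, Matrix.add_mulVec, Matrix.smul_mulVec, Matrix.one_mulVec]
    have h2 : W.mulVec (X.mulVec (X.mulVec s)) ≤ lam ^ 2 • W.mulVec s := by
      refine (matrix_mulVec_mono h.up_nonneg ((matrix_mulVec_mono h0 ih).trans ?_)).trans
        (le_of_eq (Matrix.mulVec_smul W (lam ^ 2) s))
      rw [Matrix.mulVec_smul, pow_two, mul_smul]
      exact fun i => mul_le_mul_of_nonneg_left (ih i) hlam
    have e : (step U V W c X).mulVec s = c⁻¹ • (U.mulVec s +
        (V + c • (1 : Matrix P P ℝ)).mulVec (X.mulVec s) + W.mulVec (X.mulVec (X.mulVec s))) := by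
      simp only [step, Matrix.smul_mulVec, Matrix.add_mulVec, Matrix.mulVec_mulVec]
    rw [e]
    intro i
    have a1 := h1 i
    have a2 := h2 i
    have a3 := hsup i
    simp only [Pi.smul_apply, Pi.add_apply, smul_eq_mul, Pi.zero_apply] at a1 a2 a3 ⊢
    rw [inv_mul_le_iff₀ hc]
    linarith

/-- The minimal nonnegative solution exists, and it inherits superharmonic bounds. -/
theorem exists_isMinNonnegSolution (h : LevelWalk U V W) :
    ∃ G, IsMinNonnegSolution U V W G ∧ ∀ (lam : ℝ) (s : P → ℝ), 0 ≤ lam → 0 ≤ s →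
      U.mulVec s + lam • V.mulVec s + lam ^ 2 • W.mulVec s ≤ 0 → G.mulVec s ≤ lam • s := by
  obtain ⟨c0, hc0, hc1⟩ := exists_nonneg_add_smul_one V h.within_nonneg
  obtain ⟨c, hc, hV⟩ : ∃ c : ℝ, 0 < c ∧ ∀ i j, 0 ≤ (V + c • (1 : Matrix P P ℝ)) i j := by
    refine ⟨c0 + 1, by linarith, fun i j => ?_⟩
    have h1 := hc1 i j
    have h2 : (0 : ℝ) ≤ (1 : Matrix P P ℝ) i j := by
      rw [Matrix.one_apply]; split_ifs <;> norm_num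
    simp only [Matrix.add_apply, Matrix.smul_apply, smul_eq_mul] at h1 ⊢
    linarith
  let X : ℕ → Matrix P P ℝ := fun k => (step U V W c)^[k] 0
  have hbound := fun (lam : ℝ) (s : P → ℝ) h1 h2 h3 k =>
    h.iterate_step_mulVec_le hc hV (lam := lam) (s := s) h1 h2 h3 k
  -- Constants are harmonic, so with `lam = 1` the superharmonic bound makes all iterates
  -- substochastic; this is the upper bound that lets the monotone iteration converge.
  have hone : U.mulVec 1 + (1 : ℝ) • V.mulVec 1 + (1 : ℝ) ^ 2 • W.mulVec 1 ≤ 0 := by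
    intro i
    have := h.sum_eq_zero i
    simp only [Matrix.mulVec, dotProduct, Pi.add_apply, Pi.smul_apply, smul_eq_mul, Pi.one_apply,
      mul_one, one_mul, one_pow, Pi.zero_apply]
    exact this.le
  have hmono : ∀ i j, Monotone fun k => X k i j := fun i j =>
    monotone_nat_of_le_succ fun k => h.iterate_step_le_succ hc hV k i j
  have hle1 : ∀ k i j, X k i j ≤ 1 := by
    intro k i j
    have h1 := hbound 1 1 zero_le_one zero_le_one hone k i
    have h2 : ((step U V W c)^[k] 0).mulVec 1 i = ∑ j, X k i j := by
      simp [Matrix.mulVec, dotProduct, X]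
    rw [h2] at h1
    have h3 := Finset.single_le_sum (f := fun j => X k i j)
      (fun j _ => h.iterate_step_nonneg hc hV k i j) (Finset.mem_univ j)
    have h4 : ((1 : ℝ) • (1 : P → ℝ)) i = 1 := by simp
    linarith
  let G : Matrix P P ℝ := Matrix.of fun i j => ⨆ k, X k i j
  have hlim : ∀ i j, Tendsto (fun k => X k i j) atTop (𝓝 (G i j)) := fun i j =>
    tendsto_atTop_ciSup (hmono i j) ⟨1, by rintro _ ⟨k, rfl⟩; exact hle1 k i j⟩
  have hlimM : Tendsto X atTop (𝓝 G) :=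
    tendsto_pi_nhds.2 fun i => tendsto_pi_nhds.2 fun j => hlim i j
  have hcont : Continuous (step U V W c) := by
    unfold step
    fun_prop
  have hfix : step U V W c G = G := by
    have t1 : Tendsto (fun k => X (k + 1)) atTop (𝓝 G) := (tendsto_add_atTop_iff_nat 1).2 hlimM
    have t2 : Tendsto (fun k => X (k + 1)) atTop (𝓝 (step U V W c G)) := by
      have e : (fun k => X (k + 1)) = fun k => step U V W c (X k) := by
        funext k
        exact Function.iterate_succ_apply' _ _ _
      rw [e]
      exact (hcont.tendsto G).comp hlimM
    exact tendsto_nhds_unique t2 t1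
  refine ⟨G, ⟨⟨fun i j => ge_of_tendsto' (hlim i j) fun k => h.iterate_step_nonneg hc hV k i j,
    (step_eq_self_iff hc G).1 hfix⟩, fun Y hY i j => le_of_tendsto' (hlim i j) fun k =>
      h.iterate_step_le hc hV hY k i j⟩, fun lam s h1 h2 h3 i => ?_⟩
  have t : Tendsto (fun k => (X k).mulVec s i) atTop (𝓝 (G.mulVec s i)) :=
    tendsto_finsetSum _ fun j _ => (hlim i j).mul_const _
  exact le_of_tendsto' t fun k => hbound lam s h1 h2 h3 k i

end LevelWalk

lemma IsMinNonnegSolution.eq_minNonnegSolution {U V W G : Matrix P P ℝ}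
    (h : IsMinNonnegSolution U V W G) : minNonnegSolution U V W = G := by
  ext i j
  have : IsLeast {t | ∃ X, IsNonnegSolution U V W X ∧ X i j = t} (G i j) :=
    ⟨⟨G, h.1, rfl⟩, by rintro _ ⟨Y, hY, rfl⟩; exact h.2 Y hY i j⟩
  exact this.csInf_eq

namespace LevelWalk

variable {U V W : Matrix P P ℝ}

lemma isMinNonnegSolution (h : LevelWalk U V W) :
    IsMinNonnegSolution U V W (minNonnegSolution U V W) := by
  obtain ⟨G, hG, -⟩ := h.exists_isMinNonnegSolution
  rwa [hG.eq_minNonnegSolution]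

lemma minNonnegSolution_mulVec_le (h : LevelWalk U V W) {lam : ℝ} {s : P → ℝ} (hlam : 0 ≤ lam)
    (hs : 0 ≤ s) (hsup : U.mulVec s + lam • V.mulVec s + lam ^ 2 • W.mulVec s ≤ 0) :
    (minNonnegSolution U V W).mulVec s ≤ lam • s := by
  obtain ⟨G, hG, hb⟩ := h.exists_isMinNonnegSolution
  rw [hG.eq_minNonnegSolution]
  exact hb lam s hlam hs hsup

lemma minNonnegSolution_nonneg (h : LevelWalk U V W) (i j : P) :
    0 ≤ minNonnegSolution U V W i j := h.isMinNonnegSolution.1.1 i j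

lemma pow_mulVec_le (h : LevelWalk U V W) {lam : ℝ} {s : P → ℝ} (hlam : 0 ≤ lam)
    (hs : 0 ≤ s) (hsup : U.mulVec s + lam • V.mulVec s + lam ^ 2 • W.mulVec s ≤ 0) (k : ℕ) :
    (minNonnegSolution U V W ^ k).mulVec s ≤ lam ^ k • s := by
  induction k with
  | zero => simp
  | succ k ih =>
    rw [pow_succ, ← Matrix.mulVec_mulVec]
    refine (matrix_mulVec_mono (matrix_pow_nonneg h.minNonnegSolution_nonneg k)
      (h.minNonnegSolution_mulVec_le hlam hs hsup)).trans ?_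
    rw [Matrix.mulVec_smul, pow_succ', mul_smul]
    exact fun i => mul_le_mul_of_nonneg_left (ih i) hlam

/-- The powers are only substochastic, so an upper bound is preserved when it is nonnegative. -/
lemma pow_mulVec_le_const (h : LevelWalk U V W) {M : ℝ} (hM : 0 ≤ M) {a : P → ℝ}
    (ha : ∀ i, a i ≤ M) (k : ℕ) (i : P) : (minNonnegSolution U V W ^ k).mulVec a i ≤ M := by
  have hone : U.mulVec (fun _ => M) + (1 : ℝ) • V.mulVec (fun _ => M) +
      (1 : ℝ) ^ 2 • W.mulVec (fun _ => M) ≤ 0 := by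
    intro i
    have := h.sum_eq_zero i
    simp only [Matrix.mulVec, dotProduct, Pi.add_apply, Pi.smul_apply, smul_eq_mul,
      one_mul, one_pow, Pi.zero_apply, ← Finset.sum_mul, ← add_mul, this, zero_mul, le_refl]
  have h1 := matrix_mulVec_mono (matrix_pow_nonneg h.minNonnegSolution_nonneg k)
    (show a ≤ fun _ => M from ha) i
  have h2 := h.pow_mulVec_le zero_le_one (fun _ => hM) hone k i
  simp only [one_pow, one_smul] at h2
  exact h1.trans h2

/-- The vector `c` and the number `d` such that the function `(k, i) ↦ k + c i` has constant drift
`d`. -/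
def IsDrift (U V W : Matrix P P ℝ) (c : P → ℝ) (d : ℝ) : Prop :=
  ∀ i, (U + V + W).mulVec c i + ∑ j, W i j - ∑ j, U i j = d

lemma IsDrift.symm {c : P → ℝ} {d : ℝ} (hd : IsDrift U V W c d) : IsDrift W V U (-c) (-d) := by
  intro i
  have e : W + V + U = U + V + W := by abel
  rw [e, Matrix.mulVec_neg, Pi.neg_apply, ← hd i]
  ring

lemma phase_nonneg (h : LevelWalk U V W) (i j : P) (hij : i ≠ j) : 0 ≤ (U + V + W) i j :=
  add_nonneg (add_nonneg (h.down_nonneg i j) (h.within_nonneg i j hij)) (h.up_nonneg i j)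

lemma phase_sum (h : LevelWalk U V W) (i : P) : ∑ j, (U + V + W) i j = 0 := by
  simp only [Matrix.add_apply, Finset.sum_add_distrib]
  exact h.sum_eq_zero i

lemma phase_mulVec_nonpos_of_max (h : LevelWalk U V W) {u : P → ℝ} {i : P}
    (hi : ∀ j, u j ≤ u i) : (U + V + W).mulVec u i ≤ 0 := by
  have : (U + V + W).mulVec u i = ∑ j, (U + V + W) i j * (u j - u i) := by
    simp only [mul_sub, Finset.sum_sub_distrib, ← Finset.sum_mul, h.phase_sum i, Matrix.mulVec,
      dotProduct]
    ring
  rw [this]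
  refine Finset.sum_nonpos fun j _ => ?_
  by_cases hij : i = j
  · simp [hij]
  · exact mul_nonpos_of_nonneg_of_nonpos (h.phase_nonneg i j hij) (sub_nonpos.2 (hi j))

/-- Solvability of the Poisson equation. The phase generator is singular, but subtracting the
rank-one map `c ↦ c i0` makes it injective, hence surjective; the value `c i0` of the solution is
then the drift. -/
lemma exists_isDrift (h : LevelWalk U V W) [Nonempty P] : ∃ c d, IsDrift U V W c d := by
  obtain ⟨i0⟩ := ‹Nonempty P›
  let A := U + V + W
  let Φ : (P → ℝ) →ₗ[ℝ] (P → ℝ) :=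
    A.mulVecLin - (LinearMap.proj i0).smulRight (1 : P → ℝ)
  have hΦ : ∀ c i, Φ c i = A.mulVec c i - c i0 := fun c i => by simp [Φ]
  have hinj : Function.Injective Φ := by
    refine (injective_iff_map_eq_zero Φ).2 fun c hc => ?_
    have hc' : ∀ i, A.mulVec c i = c i0 := fun i => by
      have := congrFun hc i
      rw [hΦ] at this
      simpa [sub_eq_zero] using this
    have : Nonempty P := ⟨i0⟩
    -- In the kernel the generator takes the constant value `c i0`. It is nonpositive at a maximum
    -- of `c` and nonnegative at a minimum, so the constant is zero.
    obtain ⟨x, hx⟩ := Finite.exists_max c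
    obtain ⟨y, hy⟩ := Finite.exists_max (-c)
    have h1 := h.phase_mulVec_nonpos_of_max hx
    have h2 := h.phase_mulVec_nonpos_of_max hy
    rw [Matrix.mulVec_neg, Pi.neg_apply] at h2
    have h3 := hc' x
    have h4 := hc' y
    have h0 : c i0 = 0 := by
      change A.mulVec c x ≤ 0 at h1
      change -A.mulVec c y ≤ 0 at h2
      linarith
    refine eq_zero_of_mulVec_eq_zero h.phase_nonneg h.phase_sum h.irreducible (A := {i0})
      (s := i0) rfl (fun x hx => ?_) fun x _ => (hc' x).trans h0
    rw [Set.mem_singleton_iff.1 hx, h0]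
  have hsurj := LinearMap.injective_iff_surjective.1 hinj
  obtain ⟨c, hc⟩ := hsurj fun i => ∑ j, U i j - ∑ j, W i j
  refine ⟨c, c i0, fun i => ?_⟩
  have := congrFun hc i
  rw [hΦ] at this
  change A.mulVec c i + _ - _ = _
  linarith

/-- A nonempty set of states that the walk cannot leave. -/
structure IsClosedSet (U V W : Matrix P P ℝ) (E : Set (ℤ × P)) : Prop where
  nonempty : E.Nonempty
  down : ∀ k i j, (k, i) ∈ E → 0 < U i j → (k - 1, j) ∈ E
  within : ∀ k i j, (k, i) ∈ E → 0 < V i j → (k, j) ∈ E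
  up : ∀ k i j, (k, i) ∈ E → 0 < W i j → (k + 1, j) ∈ E

/-- A walk with positive drift cannot stay below a level. -/
theorem drift_nonpos_of_isClosedSet (h : LevelWalk U V W) {c : P → ℝ} {d : ℝ}
    (hd : IsDrift U V W c d) {E : Set (ℤ × P)} (hE : IsClosedSet U V W E) {N : ℤ}
    (hN : ∀ k i, (k, i) ∈ E → k ≤ N) : d ≤ 0 := by
  obtain ⟨⟨k0, i0⟩, h0⟩ := hE.nonempty
  -- Irreducibility of the phases makes every phase occur in `E`, so each has a highest level `κ j`
  -- in `E`.
  have hphase : ∀ j, ∃ k, (k, j) ∈ E := by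
    intro j
    have hp := h.irreducible i0 j
    induction hp with
    | refl => exact ⟨k0, h0⟩
    | @tail a b _ hab ih =>
      obtain ⟨k, hk⟩ := ih
      by_cases h1 : 0 < U a b
      · exact ⟨_, hE.down k a b hk h1⟩
      by_cases h2 : 0 < V a b
      · exact ⟨_, hE.within k a b hk h2⟩
      by_cases h3 : 0 < W a b
      · exact ⟨_, hE.up k a b hk h3⟩
      simp only [Matrix.add_apply] at hab
      linarith
  have hmax : ∀ j, ∃ k, (k, j) ∈ E ∧ ∀ l, (l, j) ∈ E → l ≤ k := by
    intro j
    obtain ⟨k, h1, h2⟩ := Int.exists_greatest_of_bdd (P := fun k => (k, j) ∈ E)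
      ⟨N, fun k hk => hN k j hk⟩ (hphase j)
    exact ⟨k, h1, h2⟩
  choose κ hκ hκm using hmax
  let u : P → ℝ := fun j => (κ j : ℝ) + c j
  have : Nonempty P := ⟨i0⟩
  obtain ⟨i, hi⟩ := Finite.exists_max u
  have h1 := h.phase_mulVec_nonpos_of_max hi
  -- Closedness says that `κ` drops by at most one along `U`, does not drop along `V` and rises by
  -- at least one along `W`. The sum equals `(U + V + W) u - d` at the maximum of `u = κ + c`, where
  -- the first term is nonpositive.
  have hsum : 0 ≤ ∑ j, (U i j * (κ j - κ i + 1) + V i j * (κ j - κ i) +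
      W i j * (κ j - κ i - 1) : ℝ) := by
    refine Finset.sum_nonneg fun j _ => add_nonneg (add_nonneg ?_ ?_) ?_
    · rcases (h.down_nonneg i j).eq_or_lt with h2 | h2
      · simp [← h2]
      · have h3 : (κ i : ℝ) - 1 ≤ κ j := by exact_mod_cast hκm j _ (hE.down _ i j (hκ i) h2)
        exact mul_nonneg h2.le (by linarith)
    · by_cases hij : i = j
      · simp [hij]
      rcases (h.within_nonneg i j hij).eq_or_lt with h2 | h2
      · simp [← h2]
      · have h3 : (κ i : ℝ) ≤ κ j := by exact_mod_cast hκm j _ (hE.within _ i j (hκ i) h2)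
        exact mul_nonneg h2.le (by linarith)
    · rcases (h.up_nonneg i j).eq_or_lt with h2 | h2
      · simp [← h2]
      · have h3 : (κ i : ℝ) + 1 ≤ κ j := by exact_mod_cast hκm j _ (hE.up _ i j (hκ i) h2)
        exact mul_nonneg h2.le (by linarith)
  have e : ∑ j, (U i j * (κ j - κ i + 1) + V i j * (κ j - κ i) + W i j * (κ j - κ i - 1) : ℝ) =
      (U + V + W).mulVec u i - d := by
    have h4 : ∑ j, (U i j * (κ j - κ i + 1) + V i j * (κ j - κ i) +
        W i j * (κ j - κ i - 1) : ℝ) = ∑ j, ((U + V + W) i j * u j - (U + V + W) i j * c j -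
          (U + V + W) i j * κ i + U i j - W i j) := by
      refine Finset.sum_congr rfl fun j _ => ?_
      simp only [Matrix.add_apply, u]
      ring
    rw [h4]
    simp only [Finset.sum_sub_distrib, Finset.sum_add_distrib, ← Finset.sum_mul, h.phase_sum i,
      zero_mul]
    have h5 := hd i
    simp only [Matrix.mulVec, dotProduct] at h5 ⊢
    linarith
  linarith

/-- Take `lam = 1 - t` and `s = 1 - t c`, the first-order form of `exp (-t (k + c i))`. The terms of
order zero cancel by the row sums, and those of order one add up to `-t d`, which dominates for
small `t > 0`. -/
lemma exists_superharmonic (h : LevelWalk U V W) {c : P → ℝ} {d : ℝ}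
    (hd : IsDrift U V W c d) (hpos : 0 < d) :
    ∃ (lam : ℝ) (s : P → ℝ), 0 ≤ lam ∧ lam < 1 ∧ (∀ i, 0 < s i) ∧
      U.mulVec s + lam • V.mulVec s + lam ^ 2 • W.mulVec s ≤ 0 := by
  have e1 : ∀ᶠ t in 𝓝[>] (0 : ℝ), ∀ i, 0 < 1 - t * c i := by
    refine eventually_all.2 fun i => ?_
    have : Tendsto (fun t : ℝ => 1 - t * c i) (𝓝[>] 0) (𝓝 (1 - 0 * c i)) :=
      ((continuous_const.sub (continuous_id.mul continuous_const)).tendsto 0).mono_left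
        nhdsWithin_le_nhds
    exact this.eventually_const_lt (by simp)
  have e2 : ∀ᶠ t in 𝓝[>] (0 : ℝ), ∀ i, -d + t * (V.mulVec c i + ∑ j, W i j + 2 * W.mulVec c i -
      t * W.mulVec c i) < 0 := by
    refine eventually_all.2 fun i => ?_
    have hc : Continuous fun t : ℝ => -d + t * (V.mulVec c i + ∑ j, W i j + 2 * W.mulVec c i -
      t * W.mulVec c i) := by fun_prop
    have := (hc.tendsto 0).mono_left (nhdsWithin_le_nhds (s := Set.Ioi 0))
    exact this.eventually_lt_const (by simpa using hpos)
  have e3 : ∀ᶠ t in 𝓝[>] (0 : ℝ), t < 1 := by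
    filter_upwards [Ioo_mem_nhdsGT (zero_lt_one (α := ℝ))] with t ht using ht.2
  obtain ⟨t, h1, h2, h3, ht⟩ := (e1.and (e2.and (e3.and self_mem_nhdsWithin))).exists
  have ht : 0 < t := ht
  refine ⟨1 - t, fun i => 1 - t * c i, by linarith, by linarith, h1, fun i => ?_⟩
  have hs : ∀ A : Matrix P P ℝ, A.mulVec (fun i => 1 - t * c i) i =
      ∑ j, A i j - t * A.mulVec c i := by
    intro A
    simp only [Matrix.mulVec, dotProduct, mul_sub, mul_one, Finset.sum_sub_distrib, Finset.mul_sum]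
    congr 1
    exact Finset.sum_congr rfl fun j _ => by ring
  have h4 := h.sum_eq_zero i
  have h5 := hd i
  have h6 := mul_neg_of_pos_of_neg ht (h2 i)
  simp only [Matrix.add_mulVec, Pi.add_apply] at h5
  simp only [Pi.add_apply, Pi.smul_apply, smul_eq_mul, hs, Pi.zero_apply]
  have e : ∑ j, U i j - t * U.mulVec c i + (1 - t) * (∑ j, V i j - t * V.mulVec c i) +
      (1 - t) ^ 2 * (∑ j, W i j - t * W.mulVec c i) =
      t * (-d + t * (V.mulVec c i + ∑ j, W i j + 2 * W.mulVec c i - t * W.mulVec c i)) := by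
    have h7 : ∑ j, V i j = -∑ j, U i j - ∑ j, W i j := by linarith
    rw [h7, ← h5]
    ring
  linarith

/-- With positive drift, the walk may escape upwards: the powers of `G` tend to zero. -/
theorem tendsto_pow_mulVec_zero (h : LevelWalk U V W) {c : P → ℝ} {d : ℝ}
    (hd : IsDrift U V W c d) (hpos : 0 < d) (a : P → ℝ) (i : P) :
    Tendsto (fun k : ℕ => (minNonnegSolution U V W ^ k).mulVec a i) atTop (𝓝 0) := by
  obtain ⟨lam, s, h0, h1, hs, hsup⟩ := h.exists_superharmonic hd hpos
  have hG := fun k => matrix_pow_nonneg h.minNonnegSolution_nonneg k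
  have hij : ∀ j, Tendsto (fun k : ℕ => (minNonnegSolution U V W ^ k) i j) atTop (𝓝 0) := by
    intro j
    have t : Tendsto (fun k : ℕ => lam ^ k * s i / s j) atTop (𝓝 0) := by
      simpa using ((tendsto_pow_atTop_nhds_zero_of_lt_one h0 h1).mul_const (s i)).div_const (s j)
    refine squeeze_zero (fun k => hG k i j) (fun k => ?_) t
    rw [le_div_iff₀ (hs j)]
    refine le_trans ?_ (h.pow_mulVec_le h0 (fun i => (hs i).le) hsup k i)
    exact Finset.single_le_sum (f := fun j => (minNonnegSolution U V W ^ k) i j * s j)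
      (fun j _ => mul_nonneg (hG k i j) (hs j).le) (Finset.mem_univ j)
  have := tendsto_finsetSum Finset.univ fun j (_ : j ∈ Finset.univ) => (hij j).mul_const (a j)
  simpa [Matrix.mulVec, dotProduct] using this

lemma harmonic_pow_mulVec (h : LevelWalk U V W) (a : P → ℝ) (k : ℕ) :
    U.mulVec ((minNonnegSolution U V W ^ k).mulVec a) +
      V.mulVec ((minNonnegSolution U V W ^ (k + 1)).mulVec a) +
      W.mulVec ((minNonnegSolution U V W ^ (k + 2)).mulVec a) = 0 := by
  set G := minNonnegSolution U V W with hG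
  have h1 : U + V * G + W * G ^ 2 = 0 := h.isMinNonnegSolution.1.2
  have e : U.mulVec ((G ^ k).mulVec a) + V.mulVec ((G ^ (k + 1)).mulVec a) +
      W.mulVec ((G ^ (k + 2)).mulVec a) = (U + V * G + W * G ^ 2).mulVec ((G ^ k).mulVec a) := by
    simp only [← Matrix.add_mulVec, Matrix.mulVec_mulVec, Matrix.mul_assoc, pow_succ', pow_zero,
      mul_one, Matrix.add_mul]
  rw [e, h1, Matrix.zero_mulVec]

/-- The three blocks together form one weighted sum over `P ⊕ P ⊕ P`; the possibly negative diagonal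
weight of `V` sits where `y i = M` and contributes nothing. -/
lemma neighbors_of_max (h : LevelWalk U V W) {i : P} {x y z : P → ℝ} {M : ℝ}
    (hx : ∀ j, x j ≤ M) (hy : ∀ j, y j ≤ M) (hz : ∀ j, z j ≤ M) (hi : y i = M)
    (hh : (U.mulVec x + V.mulVec y + W.mulVec z) i = 0) (j : P) :
    (0 < U i j → x j = M) ∧ (0 < V i j → y j = M) ∧ (0 < W i j → z j = M) := by
  have hn : ∀ t : P ⊕ P ⊕ P, 0 ≤ Sum.elim (U i) (Sum.elim (V i) (W i)) t *
      (M - Sum.elim x (Sum.elim y z) t) := by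
    rintro (t | t | t)
    · exact mul_nonneg (h.down_nonneg i t) (sub_nonneg.2 (hx t))
    · by_cases hit : i = t
      · subst hit; simp [hi]
      · exact mul_nonneg (h.within_nonneg i t hit) (sub_nonneg.2 (hy t))
    · exact mul_nonneg (h.up_nonneg i t) (sub_nonneg.2 (hz t))
  have hs : 0 ≤ ∑ t, Sum.elim (U i) (Sum.elim (V i) (W i)) t *
      (Sum.elim x (Sum.elim y z) t - M) := by
    simp only [Fintype.sum_sum_type, Sum.elim_inl, Sum.elim_inr, mul_sub, Finset.sum_sub_distrib,
      ← Finset.sum_mul]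
    simp only [Pi.add_apply, Matrix.mulVec, dotProduct] at hh
    have := congrArg (· * M) (h.sum_eq_zero i)
    simp only [add_mul, zero_mul] at this
    linarith
  exact ⟨fun hp => eq_max_of_weighted_sum_nonneg hn hs (y := Sum.inl j) hp,
    fun hp => eq_max_of_weighted_sum_nonneg hn hs (y := Sum.inr (Sum.inl j)) hp,
    fun hp => eq_max_of_weighted_sum_nonneg hn hs (y := Sum.inr (Sum.inr j)) hp⟩

/-- Two geometric solutions, one decaying upwards from level `0` and one decaying downwards from
level `m`, that agree at both levels. -/
structure GluedSolutions (U V W : Matrix P P ℝ) (m : ℕ) (a b : P → ℝ) : Prop where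
  bottom : a = (minNonnegSolution W V U ^ m).mulVec b
  top : (minNonnegSolution U V W ^ m).mulVec a = b
  center : m = 0 → U.mulVec ((minNonnegSolution W V U).mulVec b) + V.mulVec a +
    W.mulVec ((minNonnegSolution U V W).mulVec a) = 0

lemma GluedSolutions.symm {m : ℕ} {a b : P → ℝ} (hg : GluedSolutions U V W m a b) :
    GluedSolutions W V U m b a where
  bottom := hg.top.symm
  top := hg.bottom.symm
  center hm := by
    have h1 := hg.center hm
    have h2 := hg.top
    subst hm
    simp only [pow_zero, Matrix.one_mulVec] at h2
    subst h2
    rw [← h1]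
    abel

lemma GluedSolutions.neg {m : ℕ} {a b : P → ℝ} (hg : GluedSolutions U V W m a b) :
    GluedSolutions U V W m (-a) (-b) where
  bottom := by rw [Matrix.mulVec_neg, ← hg.bottom]
  top := by rw [Matrix.mulVec_neg, hg.top]
  center hm := by
    simp only [Matrix.mulVec_neg]
    have := hg.center hm
    rw [← neg_eq_zero] at this
    rw [← this]
    abel

/-- If the common maximum `M` of `a` and `b` were positive, both solutions would stay below `M`, and
the states where one of them equals `M` would form a closed set. The endpoint of one solution is
harmonic through the other solution when `m > 0`; when `m = 0` this is the extra condition `center`.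
Decay of `G ^ k` bounds the set above, contradicting positive drift. -/
lemma nonpos_of_gluedSolutions (h : LevelWalk U V W) {c : P → ℝ} {d : ℝ}
    (hd : IsDrift U V W c d) (hpos : 0 < d) {m : ℕ} {a b : P → ℝ}
    (hg : GluedSolutions U V W m a b) (i : P) : a i ≤ 0 := by
  by_contra! hi
  let f : ℕ → P → ℝ := fun k => (minNonnegSolution U V W ^ k).mulVec a
  let g : ℕ → P → ℝ := fun k => (minNonnegSolution W V U ^ k).mulVec b
  have : Nonempty P := ⟨i⟩
  obtain ⟨t, ht⟩ := Finite.exists_max (Sum.elim a b)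
  set M := Sum.elim a b t with hM
  have haM : ∀ j, a j ≤ M := fun j => ht (Sum.inl j)
  have hbM : ∀ j, b j ≤ M := fun j => ht (Sum.inr j)
  have hM0 : 0 < M := hi.trans_le (haM i)
  have hf : ∀ k j, f k j ≤ M := fun k j => h.pow_mulVec_le_const hM0.le haM k j
  have hgM : ∀ k j, g k j ≤ M := fun k j => h.symm.pow_mulVec_le_const hM0.le hbM k j
  have hf0 : f 0 = a := by simp [f]
  have hg0 : g 0 = b := by simp [g]
  have hfm : f m = b := hg.top
  have hgm : g m = a := hg.bottom.symm
  have hfh : ∀ k, U.mulVec (f k) + V.mulVec (f (k + 1)) + W.mulVec (f (k + 2)) = 0 := fun k =>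
    h.harmonic_pow_mulVec a k
  have hgh : ∀ k, U.mulVec (g (k + 2)) + V.mulVec (g (k + 1)) + W.mulVec (g k) = 0 := fun k => by
    rw [← h.symm.harmonic_pow_mulVec b k]
    abel
  -- The upward solution lives on levels `0, 1, …` and the downward one on levels `m, m - 1, …`; on
  -- the overlap either of them may attain `M`.
  let E : Set (ℤ × P) := {x | (∃ n : ℕ, x.1 = n ∧ f n x.2 = M) ∨
    ∃ n : ℕ, x.1 = m - n ∧ g n x.2 = M}
  have hnb : ∀ k i j, (k, i) ∈ E → (0 < U i j → (k - 1, j) ∈ E) ∧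
      (0 < V i j → (k, j) ∈ E) ∧ (0 < W i j → (k + 1, j) ∈ E) := by
    have hfs : ∀ (n : ℕ) i j, f (n + 1) i = M → (0 < U i j → (((n + 1 : ℕ) : ℤ) - 1, j) ∈ E) ∧
        (0 < V i j → (((n + 1 : ℕ) : ℤ), j) ∈ E) ∧
        (0 < W i j → (((n + 1 : ℕ) : ℤ) + 1, j) ∈ E) := by
      intro n i j hn
      obtain ⟨h1, h2, h3⟩ := h.neighbors_of_max (hf n) (hf (n + 1)) (hf (n + 2)) hn
        (congrFun (hfh n) i) j
      exact ⟨fun hp => Or.inl ⟨n, by push_cast; ring, h1 hp⟩,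
        fun hp => Or.inl ⟨n + 1, rfl, h2 hp⟩,
        fun hp => Or.inl ⟨n + 2, by push_cast; ring, h3 hp⟩⟩
    have hgs : ∀ (n : ℕ) i j, g (n + 1) i = M →
        (0 < U i j → ((m : ℤ) - ((n + 1 : ℕ) : ℤ) - 1, j) ∈ E) ∧
        (0 < V i j → ((m : ℤ) - ((n + 1 : ℕ) : ℤ), j) ∈ E) ∧
        (0 < W i j → ((m : ℤ) - ((n + 1 : ℕ) : ℤ) + 1, j) ∈ E) := by
      intro n i j hn
      obtain ⟨h1, h2, h3⟩ := h.neighbors_of_max (hgM (n + 2)) (hgM (n + 1)) (hgM n) hn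
        (congrFun (hgh n) i) j
      exact ⟨fun hp => Or.inr ⟨n + 2, by push_cast; ring, h1 hp⟩,
        fun hp => Or.inr ⟨n + 1, rfl, h2 hp⟩,
        fun hp => Or.inr ⟨n, by push_cast; ring, h3 hp⟩⟩
    have hcen : m = 0 → ∀ i j, a i = M → (0 < U i j → ((0 : ℤ) - 1, j) ∈ E) ∧
        (0 < V i j → ((0 : ℤ), j) ∈ E) ∧ (0 < W i j → ((0 : ℤ) + 1, j) ∈ E) := by
      intro hm0 i j ha
      have hc := hg.center hm0
      subst hm0
      have hc' : U.mulVec (g 1) + V.mulVec a + W.mulVec (f 1) = 0 := by simpa [f, g] using hc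
      obtain ⟨h1, h2, h3⟩ := h.neighbors_of_max (hgM 1) haM (hf 1) ha (congrFun hc' i) j
      exact ⟨fun hp => Or.inr ⟨1, by simp, h1 hp⟩,
        fun hp => Or.inl ⟨0, by simp, by rw [hf0]; exact h2 hp⟩,
        fun hp => Or.inl ⟨1, by simp, h3 hp⟩⟩
    rintro k i j (⟨n, rfl, hn⟩ | ⟨n, rfl, hn⟩)
    · rcases n with _ | n
      · rcases Nat.eq_zero_or_pos m with hm | hm
        · rw [hf0] at hn
          exact_mod_cast hcen hm i j hn
        · obtain ⟨m', rfl⟩ := Nat.exists_eq_succ_of_ne_zero hm.ne'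
          have := hgs m' i j (by rw [hgm, ← hf0]; exact hn)
          simpa using this
      · exact hfs n i j hn
    · rcases n with _ | n
      · rcases Nat.eq_zero_or_pos m with hm | hm
        · have hab : a i = M := by
            have h1 := hfm
            rw [hm, hf0] at h1
            rw [h1, ← hg0]; exact hn
          have := hcen hm i j hab
          simpa [hm] using this
        · obtain ⟨m', rfl⟩ := Nat.exists_eq_succ_of_ne_zero hm.ne'
          have := hfs m' i j (by rw [hfm, ← hg0]; exact hn)
          simpa using this
      · exact hgs n i j hn
  have hE : IsClosedSet U V W E := by
    refine ⟨?_, fun k i j hk => (hnb k i j hk).1, fun k i j hk => (hnb k i j hk).2.1,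
      fun k i j hk => (hnb k i j hk).2.2⟩
    rcases t with t | t
    · exact ⟨((0 : ℕ), t), Or.inl ⟨0, rfl, by rw [hf0]; rfl⟩⟩
    · exact ⟨((m : ℤ) - (0 : ℕ), t), Or.inr ⟨0, rfl, by rw [hg0]; rfl⟩⟩
  have hev : ∀ᶠ n : ℕ in atTop, ∀ j, f n j < M := eventually_all.2 fun j =>
    (h.tendsto_pow_mulVec_zero hd hpos a j).eventually_lt_const hM0
  obtain ⟨N, hN⟩ := eventually_atTop.1 hev
  refine absurd (h.drift_nonpos_of_isClosedSet hd hE (N := max N m) ?_) (not_le.2 hpos)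
  rintro k j (⟨n, rfl, hn⟩ | ⟨n, rfl, hn⟩)
  · refine le_max_of_le_left ?_
    have : n ≤ N := by
      by_contra! hlt
      exact (hN n hlt.le j).ne hn
    exact_mod_cast this
  · refine le_max_of_le_right ?_
    simp

/-- With nonzero drift, there are no nonzero glued geometric solutions. -/
theorem eq_zero_of_gluedSolutions (h : LevelWalk U V W) {c : P → ℝ} {d : ℝ}
    (hd : IsDrift U V W c d) (hne : d ≠ 0) {m : ℕ} {a b : P → ℝ}
    (hg : GluedSolutions U V W m a b) : a = 0 ∧ b = 0 := by
  rcases hne.lt_or_gt with hlt | hgt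
  · have hb : b = 0 := by
      funext i
      refine le_antisymm
        (h.symm.nonpos_of_gluedSolutions hd.symm (by linarith) hg.symm i) ?_
      have := h.symm.nonpos_of_gluedSolutions hd.symm (by linarith) hg.symm.neg i
      simpa using this
    exact ⟨by rw [hg.bottom, hb, Matrix.mulVec_zero], hb⟩
  · have ha : a = 0 := by
      funext i
      refine le_antisymm (h.nonpos_of_gluedSolutions hd hgt hg i) ?_
      have := h.nonpos_of_gluedSolutions hd hgt hg.neg i
      simpa using this
    exact ⟨ha, by rw [← hg.top, ha, Matrix.mulVec_zero]⟩

/-- A null vector `u` gives a solution going up from level zero and one going down from it, both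
starting at `u`: the glued situation with `m = 0`. -/
theorem isUnit_center (h : LevelWalk U V W) {c : P → ℝ} {d : ℝ}
    (hd : IsDrift U V W c d) (hne : d ≠ 0) :
    IsUnit (V + W * minNonnegSolution U V W + U * minNonnegSolution W V U) := by
  refine Matrix.mulVec_injective_iff_isUnit.1 ?_
  refine (injective_iff_map_eq_zero (Matrix.mulVecLin _)).2 fun u hu => ?_
  rw [Matrix.mulVecLin_apply] at hu
  refine (h.eq_zero_of_gluedSolutions hd hne (m := 0) (a := u) (b := u) ⟨by simp, by simp,
    fun _ => ?_⟩).1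
  rw [← hu]
  simp only [Matrix.add_mulVec, Matrix.mulVec_mulVec]
  abel

theorem eq_zero_of_pow_system (h : LevelWalk U V W) {c : P → ℝ} {d : ℝ}
    (hd : IsDrift U V W c d) (hne : d ≠ 0) {m : ℕ} (hm : m ≠ 0) {x y : P → ℝ}
    (h1 : x + (minNonnegSolution W V U ^ m).mulVec y = 0)
    (h2 : (minNonnegSolution U V W ^ m).mulVec x + y = 0) : x = 0 ∧ y = 0 := by
  have := h.eq_zero_of_gluedSolutions hd hne (m := m) (a := x) (b := -y) ⟨?_, ?_, fun h0 =>
    absurd h0 hm⟩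
  · exact ⟨this.1, neg_eq_zero.1 this.2⟩
  · rw [Matrix.mulVec_neg]
    exact eq_neg_of_add_eq_zero_left h1
  · exact eq_neg_of_add_eq_zero_left h2

end LevelWalk

end QuadraticEquation

/-! ### Entrance times and escape probabilities in terms of rates -/

namespace MarkovGenerator

variable {S : Type*} (Q : MarkovGenerator S)

lemma exitRate_pos_of_irreducible [Nontrivial S] (hirr : IrreducibleRates Q.rate) (x : S) :
    0 < Q.exitRate x := by
  obtain ⟨y, hy⟩ := exists_ne x
  rcases (hirr x y).cases_head with h | ⟨z, hz, -⟩
  · exact absurd h.symm hy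
  · refine Q.exitRate_pos_of_rate_pos (fun h => ?_) hz
    subst h
    have := Q.exitRate_nonneg x
    unfold exitRate at this
    linarith

variable [MeasurableSpace S] [MeasurableSingletonClass S] [Countable S]

lemma hasSum_rate_mul_meanEntranceTime {x s : S} (hx : 0 < Q.exitRate x) (hxs : x ≠ s)
    (hfin : Q.meanEntranceTime x s ≠ ∞) :
    HasSum (fun z => Q.rate x z * (Q.meanEntranceTime z s).toReal) (-1) := by
  have h := Q.meanEntranceTime_of_ne hxs
  have h1 : ∫⁻ z, Q.meanEntranceTime z s ∂(Q.jumpKernel x) ≠ ∞ := fun h' => by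
    rw [h', add_top] at h
    exact hfin h
  have h2 : Q.meanHolding x ≠ ∞ := fun h' => by
    rw [h', top_add] at h
    exact hfin h
  have h3 := Q.hasSum_rate_mul_toReal hx _ h1
  have h4 := congrArg ENNReal.toReal h
  rw [ENNReal.toReal_add h2 h1, meanHolding, ENNReal.toReal_inv, ENNReal.toReal_ofReal hx.le] at h4
  refine Eq.subst (motive := fun t => HasSum
    (fun z => Q.rate x z * (Q.meanEntranceTime z s).toReal) t) ?_ h3
  rw [h4]
  field_simp
  ring

lemma ne_top_of_lintegral_jumpKernel_ne_top {x y : S} (hxy : x ≠ y) (hr : 0 < Q.rate x y)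
    {f : S → ℝ≥0∞} (hf : ∫⁻ z, f z ∂(Q.jumpKernel x) ≠ ∞) : f y ≠ ∞ := by
  classical
  have hx := Q.exitRate_pos_of_rate_pos hxy hr
  rw [Q.lintegral_jumpKernel hx.ne'] at hf
  have h1 := ENNReal.ne_top_of_tsum_ne_top hf y
  rw [if_neg hxy.symm] at h1
  intro h
  rw [h, ENNReal.top_mul] at h1
  · exact h1 rfl
  · simpa using div_pos hr hx

/-- Finiteness spreads along a path of positive rates: a finite one-step average has finite terms at
all states that can be entered. At `x` itself the average is that of the return time, elsewhere that
of the entrance time. -/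
lemma meanEntranceTime_ne_top_of_return (hirr : IrreducibleRates Q.rate) (x : S)
    (hfin : ∫⁻ ω, Q.returnTime x ω ∂(Q.law x) ≠ ∞) (y : S) : Q.meanEntranceTime y x ≠ ∞ := by
  have hp := hirr x y
  induction hp with
  | refl => simp [Q.meanEntranceTime_self]
  | @tail a b _ hab ih =>
    have hne : a ≠ b := by
      rintro rfl
      have := Q.exitRate_nonneg a
      unfold exitRate at this
      linarith
    refine Q.ne_top_of_lintegral_jumpKernel_ne_top hne hab
      (f := fun z => Q.meanEntranceTime z x) fun h => ?_
    by_cases hax : a = x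
    · subst hax
      rw [Q.lintegral_returnTime, h, add_top] at hfin
      exact hfin rfl
    · rw [Q.meanEntranceTime_of_ne hax, h, add_top] at ih
      exact ih rfl

lemma hasSum_rate_mul_neverReturn [DecidableEq S] {x s : S} (hx : 0 < Q.exitRate x)
    (hxs : x ≠ s) :
    HasSum (fun z => Q.rate x z * (if z = s then 0 else (Q.neverReturn s z).toReal)) 0 := by
  have h1 := Q.neverReturn_eq s x
  have hfin : ∫⁻ z, (if z = s then 0 else Q.neverReturn s z) ∂(Q.jumpKernel x) ≠ ∞ := by
    have := ne_top_of_le_ne_top ENNReal.one_ne_top (Q.neverReturn_le_one s x)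
    rw [h1] at this
    convert this
  have h3 := Q.hasSum_rate_mul_toReal hx _ hfin
  have h4 : ∫⁻ z, (if z = s then 0 else Q.neverReturn s z) ∂(Q.jumpKernel x) =
      Q.neverReturn s x := by
    rw [h1]
    congr!
  rw [h4, if_neg hxs, sub_self] at h3
  convert h3 using 3
  split_ifs <;> simp

end MarkovGenerator

/-! ### The unrestricted process: zero drift means null recurrence -/

namespace QBD

variable {n : ℕ} (q : QBD n)

lemma levelWalk (hphase : IrreducibleRates (q.Am + q.A0 + q.Ap)) :
    LevelWalk q.Am q.A0 q.Ap :=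
  ⟨q.Am_nonneg, q.A0_nonneg, q.Ap_nonneg, q.sum_interior, hphase⟩

/-- The generator at the interior levels, applied to a function of the state. -/
def interior (u : ℕ × Fin n → ℝ) (k : ℕ) (i : Fin n) : ℝ :=
  (q.Am.mulVec (fun j => u (k, j)) + q.A0.mulVec (fun j => u (k + 1, j)) +
    q.Ap.mulVec (fun j => u (k + 2, j))) i

lemma hasSum_unrestrictedRate_mul (u : ℕ × Fin n → ℝ) (k : ℕ) (i : Fin n) :
    HasSum (fun y => q.unrestrictedRate (k + 1, i) y * u y) (q.interior u k i) := by
  have h : HasSum (fun y => q.unrestrictedRate (k + 1, i) y * u y)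
      (∑ y ∈ ({k, k + 1, k + 2} : Finset ℕ) ×ˢ (Finset.univ : Finset (Fin n)),
        q.unrestrictedRate (k + 1, i) y * u y) := hasSum_sum_of_ne_finset_zero (by
      rintro ⟨l, j⟩ hb
      have hl : ¬ (l = k ∨ l = k + 1 ∨ l = k + 2) := by simpa using hb
      have h1 : l ≠ k + 1 + 1 := by omega
      have h2 : l + 1 ≠ k + 1 := by omega
      have h3 : l ≠ k + 1 := by omega
      simp only [unrestrictedRate, if_neg h1, if_neg h2, if_neg h3, zero_mul])
  have e : ∑ y ∈ ({k, k + 1, k + 2} : Finset ℕ) ×ˢ (Finset.univ : Finset (Fin n)),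
      q.unrestrictedRate (k + 1, i) y * u y = q.interior u k i := by
    rw [Finset.sum_product, Finset.sum_insert (by simp), Finset.sum_pair (by simp)]
    simp [interior, unrestrictedRate, Matrix.mulVec, dotProduct, add_assoc]
  rwa [e] at h

lemma interior_sub (u v : ℕ × Fin n → ℝ) (k : ℕ) (i : Fin n) :
    q.interior (fun x => u x - v x) k i = q.interior u k i - q.interior v k i := by
  have h := (q.hasSum_unrestrictedRate_mul u k i).sub (q.hasSum_unrestrictedRate_mul v k i)
  refine (q.hasSum_unrestrictedRate_mul (fun x => u x - v x) k i).unique ?_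
  simpa only [mul_sub] using h

lemma interior_const_mul (a : ℝ) (u : ℕ × Fin n → ℝ) (k : ℕ) (i : Fin n) :
    q.interior (fun x => a * u x) k i = a * q.interior u k i := by
  have h := (q.hasSum_unrestrictedRate_mul u k i).mul_left a
  refine (q.hasSum_unrestrictedRate_mul (fun x => a * u x) k i).unique ?_
  simpa only [mul_left_comm] using h

lemma interior_const (a : ℝ) (k : ℕ) (i : Fin n) : q.interior (fun _ => a) k i = 0 := by
  have h := (q.unrestrictedRate_hasSum (k + 1, i)).mul_right a
  rw [zero_mul] at h
  exact (q.hasSum_unrestrictedRate_mul (fun _ => a) k i).unique h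

/-- Maximum principle between level zero and level `N`. -/
lemma nonpos_of_interior_nonneg (hphase : IrreducibleRates (q.Am + q.A0 + q.Ap))
    (hunr : IrreducibleRates q.unrestrictedRate) {u : ℕ × Fin n → ℝ} {N : ℕ}
    (hu : ∀ k i, k + 1 < N → 0 ≤ q.interior u k i) (h0 : ∀ i, u (0, i) ≤ 0)
    (hN : ∀ i, u (N, i) ≤ 0) {k : ℕ} (hk : k ≤ N) (i : Fin n) : u (k, i) ≤ 0 := by
  by_contra! hpos
  obtain ⟨⟨k0, i0⟩, hm0, hm⟩ := Finset.exists_max_image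
    (Finset.range (N + 1) ×ˢ (Finset.univ : Finset (Fin n))) u ⟨(k, i), by simp; omega⟩
  have hmax : ∀ l j, l ≤ N → u (l, j) ≤ u (k0, i0) := fun l j hl => hm (l, j) (by simp; omega)
  have hM : 0 < u (k0, i0) := hpos.trans_le (hmax k i hk)
  have hw := q.levelWalk hphase
  -- A positive maximum over the levels up to `N` lies strictly between the two boundary levels and
  -- spreads along positive rates, never leaving this range; irreducibility would carry it to level
  -- zero.
  have key : ∀ y, Relation.ReflTransGen (fun a b => 0 < q.unrestrictedRate a b) (k0, i0) y →
      y.1 ≤ N ∧ u y = u (k0, i0) := by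
    intro y hy
    induction hy with
    | refl =>
      have : k0 < N + 1 := by simpa using hm0
      exact ⟨by simpa using Nat.lt_succ_iff.1 this, rfl⟩
    | @tail a b _ hab ih =>
      obtain ⟨l, j⟩ := a
      obtain ⟨l', j'⟩ := b
      obtain ⟨hl, hlu⟩ := ih
      have hl : l ≤ N := hl
      have hl0 : l ≠ 0 := by
        rintro rfl
        have := h0 j
        linarith
      have hlN : l ≠ N := by
        rintro rfl
        have := hN j
        linarith
      obtain ⟨l, rfl⟩ := Nat.exists_eq_succ_of_ne_zero hl0
      have hle : ∀ l' j', l' ≤ N → u (l', j') ≤ u (l + 1, j) := fun l' j' h => by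
        rw [hlu]; exact hmax l' j' h
      have hint : q.interior u l j = 0 := by
        refine le_antisymm ?_ (hu l j (by omega))
        have h1 : HasSum (fun y => q.unrestrictedRate (l + 1, j) y * (u y - u (l + 1, j)))
            (q.interior (fun y => u y - u (l + 1, j)) l j) :=
          q.hasSum_unrestrictedRate_mul _ l j
        rw [q.interior_sub u (fun _ => u (l + 1, j)), q.interior_const, sub_zero] at h1
        refine h1.nonpos fun y => ?_
        obtain ⟨l'', j''⟩ := y
        by_cases hyl : (l'' = l ∨ l'' = l + 1 ∨ l'' = l + 2)
        · by_cases hne : ((l + 1, j) : ℕ × Fin n) = (l'', j'')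
          · rw [← hne, sub_self, mul_zero]
          · exact mul_nonpos_of_nonneg_of_nonpos (q.unrestricted.rate_nonneg _ _ hne)
              (sub_nonpos.2 (hle _ _ (by omega)))
        · have h1 : l'' ≠ l + 1 + 1 := by omega
          have h2 : l'' + 1 ≠ l + 1 := by omega
          have h3 : l'' ≠ l + 1 := by omega
          simp [unrestrictedRate, h1, h3, show l'' ≠ l by omega]
      obtain ⟨h1, h2, h3⟩ := hw.neighbors_of_max (M := u (l + 1, j)) (fun j' => hle l j' (by omega))
        (fun j' => hle (l + 1) j' (by omega)) (fun j' => hle (l + 2) j' (by omega)) rfl hint j'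
      rw [← hlu]
      simp only [unrestrictedRate] at hab
      split_ifs at hab with c1 c2 c3 c4
      · subst c1
        exact ⟨by simp; omega, h3 hab⟩
      · have c2 : l' = l := by simpa using c2
        subst c2
        exact ⟨by simp; omega, h1 hab⟩
      · exact c4.elim
      · subst c3
        exact ⟨by simp; omega, h2 hab⟩
      · exact absurd hab (lt_irrefl _)
  have h1 := (key (0, i0) (hunr _ _)).2
  have := h0 i0
  linarith

/-- The function `(k, i) ↦ k + c i + b`. -/
def lyapunov (c : Fin n → ℝ) (b : ℝ) (x : ℕ × Fin n) : ℝ := x.1 + c x.2 + b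

lemma interior_lyapunov {c : Fin n → ℝ} {d : ℝ} (hd : LevelWalk.IsDrift q.Am q.A0 q.Ap c d)
    (b : ℝ) (k : ℕ) (i : Fin n) : q.interior (lyapunov c b) k i = d := by
  have h1 := q.interior_const ((k : ℝ) + 1 + b) k i
  rw [← hd i]
  have h2 : q.interior (lyapunov c b) k i =
      q.interior (fun _ => (k : ℝ) + 1 + b) k i + ((q.Am + q.A0 + q.Ap).mulVec c i +
        ∑ j, q.Ap i j - ∑ j, q.Am i j) := by
    simp only [interior, lyapunov, Matrix.mulVec, dotProduct, Pi.add_apply, Matrix.add_apply,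
      ← Finset.sum_add_distrib, ← Finset.sum_sub_distrib]
    refine Finset.sum_congr rfl fun j _ => ?_
    push_cast
    ring
  rw [h2, h1, zero_add]

/-- From `y² = 2 x y - x² + (y - x)²`: the cross term gives the drift, and the squared increments
are the variance rate, which does not depend on the level. -/
lemma interior_lyapunov_sq {c : Fin n → ℝ} {d : ℝ}
    (hd : LevelWalk.IsDrift q.Am q.A0 q.Ap c d) (b : ℝ) (k : ℕ) (i : Fin n) :
    q.interior (fun x => lyapunov c b x ^ 2) k i = 2 * lyapunov c b (k + 1, i) * d +
      ∑ j, (q.Am i j * (c j - c i - 1) ^ 2 + q.A0 i j * (c j - c i) ^ 2 +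
        q.Ap i j * (c j - c i + 1) ^ 2) := by
  have h1 := q.interior_const (lyapunov c b (k + 1, i) ^ 2) k i
  have h2 := q.interior_lyapunov hd b k i
  have h3 : q.interior (fun x => lyapunov c b x ^ 2) k i =
      2 * lyapunov c b (k + 1, i) * q.interior (lyapunov c b) k i -
      q.interior (fun _ => lyapunov c b (k + 1, i) ^ 2) k i +
      ∑ j, (q.Am i j * (c j - c i - 1) ^ 2 + q.A0 i j * (c j - c i) ^ 2 +
        q.Ap i j * (c j - c i + 1) ^ 2) := by
    simp only [interior, lyapunov, Matrix.mulVec, dotProduct, Pi.add_apply, Finset.mul_sum,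
      ← Finset.sum_add_distrib, ← Finset.sum_sub_distrib, mul_add]
    refine Finset.sum_congr rfl fun j _ => ?_
    push_cast
    ring
  rw [h3, h1, h2, sub_zero]

lemma unrestricted_exitRate_pos (hunr : IrreducibleRates q.unrestrictedRate) (x : ℕ × Fin n) : 0 < q.unrestricted.exitRate x := by
  have : Nontrivial (ℕ × Fin n) := ⟨⟨x, (x.1 + 1, x.2), fun h => by
    have := congrArg Prod.fst h
    simp at this⟩⟩
  exact q.unrestricted.exitRate_pos_of_irreducible hunr x

/-- Without drift, the unrestricted process is recurrent. -/
lemma isRecurrentState_of_zero_drift (hphase : IrreducibleRates (q.Am + q.A0 + q.Ap))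
    (hunr : IrreducibleRates q.unrestrictedRate) {c : Fin n → ℝ}
    (hd : LevelWalk.IsDrift q.Am q.A0 q.Ap c 0) (i : Fin n) :
    q.unrestricted.IsRecurrentState (0, i) := by
  classical
  refine q.unrestricted.isRecurrentState_of_neverReturn_eq_zero _ ?_
  let s : ℕ × Fin n := (0, i)
  let r : ℕ × Fin n → ℝ := fun z => if z = s then 0 else (q.unrestricted.neverReturn s z).toReal
  have hr0 : ∀ z, 0 ≤ r z := fun z => by dsimp only [r]; split_ifs <;> simp
  have hr1 : ∀ z, r z ≤ 1 := fun z => by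
    dsimp only [r]
    split_ifs
    · exact zero_le_one
    · exact ENNReal.toReal_le_of_le_ofReal zero_le_one (by
        simpa using q.unrestricted.neverReturn_le_one s z)
  have hharm : ∀ x, x ≠ s → HasSum (fun z => q.unrestrictedRate x z * r z) 0 := fun x hx =>
    q.unrestricted.hasSum_rate_mul_neverReturn (q.unrestricted_exitRate_pos hunr x) hx
  have : Nonempty (Fin n) := ⟨i⟩
  obtain ⟨m, hm⟩ := Finite.exists_max fun j => r (0, j)
  obtain ⟨t, ht⟩ := Finite.exists_max fun j => |c j|
  -- The escape probability `r` is harmonic off `s`, and without drift so is the function `k + c i +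
  -- |c t|`, which is at least `k`. Comparison with `ε` times it up to a level `N ≥ 1 / ε`, where it
  -- exceeds `1 ≥ r`, gives the bound as `ε → 0`.
  have hle : ∀ x, r x ≤ r (0, m) := by
    rintro ⟨k, j⟩
    have hf0 : ∀ (l : ℕ) j, (l : ℝ) ≤ lyapunov c |c t| (l, j) := fun l j => by
      have h1 := ht j
      have h2 := neg_abs_le (c j)
      simp only [lyapunov]
      linarith
    have key : ∀ ε : ℝ, 0 < ε → r (k, j) ≤ r (0, m) + ε * lyapunov c |c t| (k, j) := by
      intro ε hε
      obtain ⟨N, hN⟩ := exists_nat_ge (1 / ε)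
      have h1 := q.nonpos_of_interior_nonneg hphase hunr (N := max N k)
        (u := fun x => r x - r (0, m) - ε * lyapunov c |c t| x) (fun l j' _ => ?_)
        (fun j' => ?_) (fun j' => ?_) (le_max_right N k) j
      · linarith
      · rw [q.interior_sub (fun x => r x - r (0, m)), q.interior_sub r, q.interior_const,
          q.interior_const_mul, q.interior_lyapunov hd]
        have := (q.hasSum_unrestrictedRate_mul r l j').unique
          (hharm (l + 1, j') fun h => by simpa [s] using congrArg Prod.fst h)
        rw [this]
        simp
      · have h2 : r (0, j') ≤ r (0, m) := hm j'
        have h3 := mul_nonneg hε.le ((Nat.cast_nonneg 0).trans (hf0 0 j'))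
        linarith
      · have h2 := hr1 (max N k, j')
        have h3 := mul_le_mul_of_nonneg_left (hf0 (max N k) j') hε.le
        have h4 : (N : ℝ) ≤ (max N k : ℕ) := by exact_mod_cast le_max_left N k
        have h5 : 1 ≤ ε * (max N k : ℕ) := by
          rw [div_le_iff₀ hε] at hN
          nlinarith
        have h6 := hr0 (0, m)
        linarith
    have hlim : Tendsto (fun ε : ℝ => r (0, m) + ε * lyapunov c |c t| (k, j)) (𝓝[>] 0)
        (𝓝 (r (0, m) + 0 * lyapunov c |c t| (k, j))) :=
      ((continuous_const.add (continuous_id.mul continuous_const)).tendsto 0).mono_left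
        nhdsWithin_le_nhds
    rw [zero_mul, add_zero] at hlim
    exact ge_of_tendsto hlim (by filter_upwards [self_mem_nhdsWithin] with ε hε using key ε hε)
  -- The maximum of `r` is attained, so a positive value would spread to `s`, where `r` is zero by
  -- definition.
  have hzero : r (0, m) = 0 := by
    by_contra hne
    have hpos : 0 < r (0, m) := (hr0 _).lt_of_ne' hne
    have hpath : ∀ y, Relation.ReflTransGen (fun a b => 0 < q.unrestrictedRate a b) (0, m) y →
        r y = r (0, m) := by
      intro y hy
      induction hy with
      | refl => rfl
      | @tail a b _ hab ih =>
        have has : a ≠ s := by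
          intro h
          have h1 : r a = 0 := if_pos h
          linarith
        have h1 : HasSum (fun z => q.unrestrictedRate a z * (r a - r z)) 0 := by
          have h2 := ((q.unrestrictedRate_hasSum a).mul_right (r a)).sub (hharm a has)
          simpa only [mul_sub, zero_mul, sub_zero] using h2
        have h2 := (hasSum_zero_iff_of_nonneg fun z => by
          by_cases hz : a = z
          · subst hz; simp
          · exact mul_nonneg (q.unrestricted.rate_nonneg a z hz)
              (sub_nonneg.2 (ih ▸ hle z))).1 h1
        have h3 := congrFun h2 b
        rcases mul_eq_zero.1 h3 with h4 | h4
        · exact absurd h4 hab.ne'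
        · linarith
    have := hpath s (hunr _ _)
    simp only [r, if_true] at this
    linarith
  rw [q.unrestricted.neverReturn_eq]
  refine lintegral_eq_zero_of_ae_eq_zero (ae_of_all _ fun z => ?_)
  have hz : r z = 0 := le_antisymm ((hle z).trans hzero.le) (hr0 z)
  have hfin : q.unrestricted.neverReturn s z ≠ ∞ :=
    ne_top_of_le_ne_top ENNReal.one_ne_top (q.unrestricted.neverReturn_le_one s z)
  by_cases h : z = s
  · exact if_pos h
  · have hz' : (q.unrestricted.neverReturn s z).toReal = 0 := by simpa [r, h] using hz
    exact (if_neg h).trans (((ENNReal.toReal_eq_zero_iff _).1 hz').resolve_right hfin)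

/-- Without drift, the mean return times of the unrestricted process are infinite. -/
lemma lintegral_returnTime_eq_top_of_zero_drift (hphase : IrreducibleRates (q.Am + q.A0 + q.Ap))
    (hunr : IrreducibleRates q.unrestrictedRate) {c : Fin n → ℝ}
    (hd : LevelWalk.IsDrift q.Am q.A0 q.Ap c 0) (i : Fin n) :
    ∫⁻ ω, q.unrestricted.returnTime (0, i) ω ∂(q.unrestricted.law (0, i)) = ∞ := by
  by_contra hfin
  let s : ℕ × Fin n := (0, i)
  let m : ℕ × Fin n → ℝ := fun z => (q.unrestricted.meanEntranceTime z s).toReal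
  have hm0 : ∀ z, 0 ≤ m z := fun z => ENNReal.toReal_nonneg
  have hm : ∀ k j, q.interior m k j = -1 := fun k j =>
    (q.hasSum_unrestrictedRate_mul m k j).unique
      (q.unrestricted.hasSum_rate_mul_meanEntranceTime
        (q.unrestricted_exitRate_pos hunr _)
        (fun h => by simpa [s] using congrArg Prod.fst h)
        (q.unrestricted.meanEntranceTime_ne_top_of_return hunr s hfin _))
  have : Nonempty (Fin n) := ⟨i⟩
  obtain ⟨t, ht⟩ := Finite.exists_max fun j => |c j|
  let b : ℝ := |c t|
  let v : Fin n → ℝ := fun i => ∑ j, (q.Am i j * (c j - c i - 1) ^ 2 +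
    q.A0 i j * (c j - c i) ^ 2 + q.Ap i j * (c j - c i + 1) ^ 2)
  have hv0 : ∀ i, 0 ≤ v i := fun i => Finset.sum_nonneg fun j _ => by
    refine add_nonneg (add_nonneg (mul_nonneg (q.Am_nonneg i j) (sq_nonneg _)) ?_)
      (mul_nonneg (q.Ap_nonneg i j) (sq_nonneg _))
    by_cases hij : i = j
    · simp [hij]
    · exact mul_nonneg (q.A0_nonneg i j hij) (sq_nonneg _)
  -- A bound for the variance rates; the summand one only makes it positive when there is no
  -- variance.
  let B : ℝ := ∑ i, v i + 1
  have hvB : ∀ i, v i ≤ B := fun i => by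
    have := Finset.single_le_sum (f := v) (fun i _ => hv0 i) (Finset.mem_univ i)
    dsimp only [B]
    linarith
  have hB : 0 < B := by
    have := Finset.sum_nonneg fun i (_ : i ∈ Finset.univ) => hv0 i
    dsimp only [B]
    linarith
  have hf0 : ∀ (l : ℕ) j, (l : ℝ) ≤ lyapunov c b (l, j) := fun l j => by
    have h1 := ht j
    have h2 := neg_abs_le (c j)
    simp only [lyapunov, b]
    linarith
  have hf1 : ∀ (l : ℕ) j, lyapunov c b (l, j) ≤ l + 2 * b := fun l j => by
    have h1 := ht j
    have h2 := le_abs_self (c j)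
    simp only [lyapunov, b]
    linarith
  obtain ⟨k, hk⟩ := exists_nat_gt (2 * b)
  let f0 : ℝ := lyapunov c b (k, i)
  have hf0k : 0 < f0 - 2 * b := by
    have := hf0 k i
    dsimp only [f0]
    linarith
  -- Chosen so that `(f0 - 2 b) (N - f0) > B m (k, i)`, which the comparison below contradicts.
  obtain ⟨N, hN⟩ := exists_nat_gt (max (k : ℝ) (f0 + B * m (k, i) / (f0 - 2 * b)))
  have hNk : k ≤ N := by
    have := (le_max_left (k : ℝ) _).trans hN.le
    exact_mod_cast this
  have hNb : 2 * b ≤ N := by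
    have : (k : ℝ) ≤ N := by exact_mod_cast hNk
    linarith
  -- The test function is `(f - 2 b) (N - f) - B m`. Without drift the generator maps it to `B - v ≥
  -- 0`. The product is nonpositive at level zero, where `0 ≤ f ≤ 2 b ≤ N`, and at level `N`, where
  -- `f ≥ N ≥ 2 b`.
  have key := q.nonpos_of_interior_nonneg hphase hunr (N := N)
    (u := fun x => ((N : ℝ) + 2 * b) * lyapunov c b x - lyapunov c b x ^ 2 - 2 * b * N - B * m x)
    (fun l j _ => ?_) (fun j => ?_) (fun j => ?_) hNk i
  · have h1 : (f0 - 2 * b) * (N - f0) ≤ B * m (k, i) := by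
      dsimp only [f0] at *
      linarith
    have h2 := (le_max_right (k : ℝ) _).trans_lt hN
    have h3 : B * m (k, i) / (f0 - 2 * b) < N - f0 := by linarith
    rw [div_lt_iff₀ hf0k] at h3
    linarith
  · rw [q.interior_sub (fun x => ((N : ℝ) + 2 * b) * lyapunov c b x - lyapunov c b x ^ 2 -
        2 * b * N), q.interior_sub (fun x => ((N : ℝ) + 2 * b) * lyapunov c b x -
        lyapunov c b x ^ 2), q.interior_sub (fun x => ((N : ℝ) + 2 * b) * lyapunov c b x),
      q.interior_const, q.interior_const_mul, q.interior_const_mul, q.interior_lyapunov hd,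
      q.interior_lyapunov_sq hd, hm]
    have := hvB j
    dsimp only [v] at this
    linarith
  · have h1 := hf0 0 j
    have h2 := hf1 0 j
    have h3 := mul_nonneg hB.le (hm0 (0, j))
    push_cast at h1 h2
    have h4 : (lyapunov c b (0, j) - 2 * b) * (N - lyapunov c b (0, j)) ≤ 0 :=
      mul_nonpos_of_nonpos_of_nonneg (by linarith) (by linarith)
    linarith
  · have h1 := hf0 N j
    have h3 := mul_nonneg hB.le (hm0 (N, j))
    have h4 : (lyapunov c b (N, j) - 2 * b) * (N - lyapunov c b (N, j)) ≤ 0 :=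
      mul_nonpos_of_nonneg_of_nonpos (by linarith) (by linarith)
    linarith

lemma isNullRecurrentState_of_zero_drift (hphase : IrreducibleRates (q.Am + q.A0 + q.Ap))
    (hunr : IrreducibleRates q.unrestrictedRate) {c : Fin n → ℝ}
    (hd : LevelWalk.IsDrift q.Am q.A0 q.Ap c 0) (i : Fin n) :
    q.unrestricted.IsNullRecurrentState (0, i) :=
  ⟨q.isRecurrentState_of_zero_drift hphase hunr hd i,
    (q.unrestricted_exitRate_pos hunr _).ne',
    q.lintegral_returnTime_eq_top_of_zero_drift hphase hunr hd i⟩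

/-- This is where non-null-recurrence enters; everything else needs only a nonzero drift. -/
theorem exists_isDrift_ne_zero (hphase : IrreducibleRates (q.Am + q.A0 + q.Ap))
    (hunr : IrreducibleRates q.unrestrictedRate) (hnnr : q.NonNullRecurrent) :
    ∃ c d, LevelWalk.IsDrift q.Am q.A0 q.Ap c d ∧ d ≠ 0 := by
  rcases isEmpty_or_nonempty (Fin n) with h | h
  -- Without phases the drift condition is empty and any nonzero number serves.
  · exact ⟨0, 1, fun i => h.elim i, one_ne_zero⟩
  · obtain ⟨c, d, hd⟩ := (q.levelWalk hphase).exists_isDrift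
    refine ⟨c, d, hd, ?_⟩
    rintro rfl
    exact hnnr _ (q.isNullRecurrentState_of_zero_drift hphase hunr hd h.some)

end QBD

/-! ### The deviation matrix of a finite irreducible chain -/

section Deviation

variable {S : Type*} [Fintype S] [DecidableEq S] {Q : Matrix S S ℝ} {p : S → ℝ}

lemma matrix_exp_mulVec_of_mulVec_eq_zero {T : Matrix S S ℝ} {v : S → ℝ} (hv : T.mulVec v = 0)
    (t : ℝ) : (NormedSpace.exp (t • T)).mulVec v = v := by
  funext x
  have hd : ∀ t : ℝ, HasDerivAt (fun u : ℝ => (NormedSpace.exp (u • T)).mulVec v x) 0 t := by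
    intro t
    have := hasDerivAt_matrix_exp_mulVec T v t x
    rwa [hv, Matrix.mulVec_zero] at this
  have := is_const_of_deriv_eq_zero (fun t => (hd t).differentiableAt) (fun t => (hd t).deriv) t 0
  rw [this]
  simp

lemma matrix_exp_sum_eq_one (hsum : ∀ x, ∑ y, Q x y = 0) (t : ℝ) (x : S) :
    ∑ y, NormedSpace.exp (t • Q) x y = 1 := by
  have h : Q.mulVec 1 = 0 := funext fun x => by simp [Matrix.mulVec, dotProduct, hsum]
  have := congrFun (matrix_exp_mulVec_of_mulVec_eq_zero h t) x
  simpa [Matrix.mulVec, dotProduct] using this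

lemma vecMul_matrix_exp (hp : Matrix.vecMul p Q = 0) (t : ℝ) :
    Matrix.vecMul p (NormedSpace.exp (t • Q)) = p := by
  have h : Q.transpose.mulVec p = 0 := by rwa [Matrix.mulVec_transpose]
  have h2 := matrix_exp_mulVec_of_mulVec_eq_zero h t
  rwa [← Matrix.transpose_smul, Matrix.exp_transpose, Matrix.mulVec_transpose] at h2

lemma matrix_exp_nat_smul (Q : Matrix S S ℝ) (k : ℕ) :
    NormedSpace.exp ((k : ℝ) • Q) = NormedSpace.exp Q ^ k := by
  induction k with
  | zero => simp
  | succ k ih =>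
    rw [Nat.cast_succ, matrix_exp_add_smul, ih, one_smul, pow_succ]

/-- After adding a multiple of the identity the matrix is nonnegative, and a path of length `k`
makes the corresponding entry of its `k`th power positive; one such term of the exponential series
suffices. -/
lemma matrix_exp_pos (hQ : ∀ x y, x ≠ y → 0 ≤ Q x y) (hirr : IrreducibleRates Q) (x y : S) :
    0 < NormedSpace.exp Q x y := by
  obtain ⟨c, hc0, hc⟩ := exists_nonneg_add_smul_one Q hQ
  set B := Q + c • (1 : Matrix S S ℝ) with hB
  have hpow : ∃ k, 0 < (B ^ k) x y := by
    have h := hirr x y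
    induction h with
    | refl => exact ⟨0, by simp⟩
    | @tail a b _ hab ih =>
      obtain ⟨k, hk⟩ := ih
      refine ⟨k + 1, ?_⟩
      rw [pow_succ, Matrix.mul_apply]
      have hBab : 0 < B a b := by
        have h1 : 0 ≤ (1 : Matrix S S ℝ) a b := by
          rw [Matrix.one_apply]; split_ifs <;> norm_num
        have h2 := mul_nonneg hc0 h1
        simp only [hB, Matrix.add_apply, Matrix.smul_apply, smul_eq_mul]
        linarith
      exact (mul_pos hk hBab).trans_le (Finset.single_le_sum (f := fun z => (B ^ k) x z * B z b)
        (fun z _ => mul_nonneg (matrix_pow_nonneg hc k x z) (hc z b)) (Finset.mem_univ a))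
  obtain ⟨k, hk⟩ := hpow
  rw [matrix_exp_eq_smul_exp Q c]
  refine mul_pos (Real.exp_pos _) ?_
  have hs := hasSum_matrix_exp B x y
  refine lt_of_lt_of_le ?_ (le_hasSum hs k fun m _ =>
    mul_nonneg (by positivity) (matrix_pow_nonneg hc m x y))
  positivity

/-- Doeblin's argument: all entries of `E = exp Q` are at least `ε`, so `R = E - ε 1 p` is
nonnegative. Stationarity gives `R ^ k = E ^ k - (1 - (1 - ε) ^ k) 1 p`, with row sums `(1 - ε) ^
k`; the error is thus a difference of two numbers in `[0, (1 - ε) ^ k]`. -/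
lemma matrix_exp_pow_sub_le (hQ : ∀ x y, x ≠ y → 0 ≤ Q x y) (hsum : ∀ x, ∑ y, Q x y = 0)
    (hirr : IrreducibleRates Q) (hp : IsStationaryVector Q p) :
    ∃ ρ : ℝ, 0 < ρ ∧ ρ < 1 ∧ ∀ (k : ℕ) x y, |(NormedSpace.exp Q ^ k) x y - p y| ≤ ρ ^ k := by
  obtain ⟨hp0, hp1, hpQ⟩ := hp
  have hple : ∀ y, p y ≤ 1 := fun y =>
    hp1 ▸ Finset.single_le_sum (fun y _ => hp0 y) (Finset.mem_univ y)
  set E := NormedSpace.exp Q with hE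
  have hE1 : ∀ x, ∑ y, E x y = 1 := fun x => by
    simpa using matrix_exp_sum_eq_one hsum 1 x
  have hpE : Matrix.vecMul p E = p := by simpa using vecMul_matrix_exp hpQ 1
  obtain ⟨ε, hε0, hε1, hε⟩ : ∃ ε : ℝ, 0 < ε ∧ ε < 1 ∧ ∀ x y, ε ≤ E x y := by
    rcases isEmpty_or_nonempty S with h | h
    · exact ⟨1 / 2, by norm_num, by norm_num, fun x => h.elim x⟩
    · obtain ⟨m, hm⟩ := Finite.exists_min fun z : S × S => E z.1 z.2
      have := matrix_exp_pos hQ hirr m.1 m.2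
      exact ⟨min (E m.1 m.2) (1 / 2), lt_min this (by norm_num),
        (min_le_right _ _).trans_lt (by norm_num), fun x y => (min_le_left _ _).trans (hm (x, y))⟩
  let R : Matrix S S ℝ := Matrix.of fun x y => E x y - ε * p y
  have hR0 : ∀ x y, 0 ≤ R x y := fun x y => by
    have h1 := hε x y
    have h2 := mul_le_mul_of_nonneg_left (hple y) hε0.le
    simp only [R, Matrix.of_apply]
    linarith
  have key : ∀ (k : ℕ) x y, (R ^ k) x y = (E ^ k) x y - (1 - (1 - ε) ^ k) * p y := by
    intro k
    induction k with
    | zero => simp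
    | succ k ih =>
      intro x y
      have h1 : ∑ z, p z * E z y = p y := congrFun hpE y
      have hk1 : ∑ z, (E ^ k) x z = 1 := by
        rw [hE, ← matrix_exp_nat_smul]
        exact matrix_exp_sum_eq_one hsum k x
      have e : ∀ z, (R ^ k) x z * R z y = (E ^ k) x z * E z y - ε * p y * (E ^ k) x z -
          (1 - (1 - ε) ^ k) * (p z * E z y) + (1 - (1 - ε) ^ k) * ε * p y * p z := fun z => by
        rw [ih]
        simp only [R, Matrix.of_apply]
        ring
      rw [pow_succ, Matrix.mul_apply, Finset.sum_congr rfl fun z _ => e z, Finset.sum_add_distrib,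
        Finset.sum_sub_distrib, Finset.sum_sub_distrib, ← Finset.mul_sum, ← Finset.mul_sum,
        ← Finset.mul_sum, h1, hk1, hp1, pow_succ, Matrix.mul_apply]
      ring
  refine ⟨1 - ε, by linarith, by linarith, fun k x y => ?_⟩
  have hk1 : ∑ z, (E ^ k) x z = 1 := by
    rw [hE, ← matrix_exp_nat_smul]
    exact matrix_exp_sum_eq_one hsum k x
  have hRsum : ∑ z, (R ^ k) x z = (1 - ε) ^ k := by
    simp only [key]
    rw [Finset.sum_sub_distrib, ← Finset.mul_sum, hk1, hp1]
    ring
  have h1 := matrix_pow_nonneg hR0 k x y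
  have h2 : (R ^ k) x y ≤ (1 - ε) ^ k := hRsum ▸ Finset.single_le_sum
    (f := fun z => (R ^ k) x z) (fun z _ => matrix_pow_nonneg hR0 k x z) (Finset.mem_univ y)
  have h3 : (0 : ℝ) ≤ (1 - ε) ^ k := pow_nonneg (by linarith) k
  have h4 := mul_le_mul_of_nonneg_left (hple y) h3
  have h5 := mul_nonneg h3 (hp0 y)
  have h6 := key k x y
  rw [abs_le]
  constructor <;> linarith

/-- The geometric bound at integer times extends to real times because averaging over the fractional
part does not increase it; the factor `ρ⁻¹` pays for replacing `⌊t⌋` by `t - 1`. -/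
lemma deviationIntegrand_abs_le (hQ : ∀ x y, x ≠ y → 0 ≤ Q x y) (hsum : ∀ x, ∑ y, Q x y = 0)
    (hirr : IrreducibleRates Q) (hp : IsStationaryVector Q p) :
    ∃ (b B : ℝ), 0 < b ∧ ∀ x y (t : ℝ), 0 ≤ t →
      |deviationIntegrand Q p x y t| ≤ B * Real.exp (-b * t) := by
  obtain ⟨ρ, h0, h1, hρ⟩ := matrix_exp_pow_sub_le hQ hsum hirr hp
  refine ⟨-Real.log ρ, ρ⁻¹, neg_pos.2 (Real.log_neg h0 h1), fun x y t ht => ?_⟩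
  set k := ⌊t⌋₊ with hk
  have hkt : (k : ℝ) ≤ t := Nat.floor_le ht
  have hkt' : t - 1 ≤ k := by linarith [Nat.lt_floor_add_one t]
  have e1 : NormedSpace.exp (t • Q) = NormedSpace.exp ((t - k) • Q) * NormedSpace.exp Q ^ k := by
    rw [← matrix_exp_nat_smul, ← matrix_exp_add_smul, sub_add_cancel]
  have hs := matrix_exp_sum_eq_one hsum (t - k) x
  have e2 : deviationIntegrand Q p x y t =
      ∑ z, NormedSpace.exp ((t - k) • Q) x z * ((NormedSpace.exp Q ^ k) z y - p y) := by
    rw [deviationIntegrand, e1, Matrix.mul_apply]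
    simp only [mul_sub, Finset.sum_sub_distrib, ← Finset.sum_mul, hs, one_mul]
  have hnn := matrix_exp_smul_nonneg hQ (sub_nonneg.2 hkt) x
  have h2 : |deviationIntegrand Q p x y t| ≤ ρ ^ k := by
    rw [e2]
    refine (Finset.abs_sum_le_sum_abs _ _).trans ?_
    calc ∑ z, |NormedSpace.exp ((t - k) • Q) x z * ((NormedSpace.exp Q ^ k) z y - p y)|
        ≤ ∑ z, NormedSpace.exp ((t - k) • Q) x z * ρ ^ k := by
          refine Finset.sum_le_sum fun z _ => ?_
          rw [abs_mul, abs_of_nonneg (hnn z)]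
          exact mul_le_mul_of_nonneg_left (hρ k z y) (hnn z)
      _ = ρ ^ k := by rw [← Finset.sum_mul, hs, one_mul]
  refine h2.trans ?_
  rw [← Real.rpow_natCast]
  calc ρ ^ (k : ℝ) ≤ ρ ^ (t - 1) := Real.rpow_le_rpow_of_exponent_ge h0 h1.le hkt'
    _ = ρ⁻¹ * Real.exp (-(-Real.log ρ) * t) := by
      rw [Real.rpow_sub h0, Real.rpow_one, Real.rpow_def_of_pos h0, neg_neg]
      field_simp

lemma continuous_deviationIntegrand (x y : S) : Continuous (deviationIntegrand Q p x y) := by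
  have h : Continuous fun u : ℝ => NormedSpace.exp (u • Q) x y :=
    continuous_iff_continuousAt.2 fun t => (hasDerivAt_matrix_exp Q t x y).continuousAt
  exact h.sub continuous_const

lemma integrableOn_deviationIntegrand (hQ : ∀ x y, x ≠ y → 0 ≤ Q x y)
    (hsum : ∀ x, ∑ y, Q x y = 0) (hirr : IrreducibleRates Q) (hp : IsStationaryVector Q p)
    (x y : S) : IntegrableOn (deviationIntegrand Q p x y) (Set.Ioi 0) := by
  obtain ⟨b, B, hb, hB⟩ := deviationIntegrand_abs_le hQ hsum hirr hp
  refine integrable_of_isBigO_exp_neg hb (continuous_deviationIntegrand x y).continuousOn ?_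
  refine Asymptotics.IsBigO.of_bound B ?_
  filter_upwards [eventually_ge_atTop 0] with t ht
  rw [Real.norm_eq_abs, Real.norm_of_nonneg (Real.exp_pos _).le]
  exact hB x y t ht

lemma tendsto_matrix_exp_stationary (hQ : ∀ x y, x ≠ y → 0 ≤ Q x y)
    (hsum : ∀ x, ∑ y, Q x y = 0) (hirr : IrreducibleRates Q) (hp : IsStationaryVector Q p)
    (x y : S) : Tendsto (fun t : ℝ => NormedSpace.exp (t • Q) x y) atTop (𝓝 (p y)) := by
  obtain ⟨b, B, hb, hB⟩ := deviationIntegrand_abs_le hQ hsum hirr hp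
  have h1 : Tendsto (fun t : ℝ => B * Real.exp (-b * t)) atTop (𝓝 0) := by
    have : Tendsto (fun t : ℝ => -b * t) atTop atBot :=
      tendsto_id.const_mul_atTop_of_neg (by linarith)
    simpa using (Real.tendsto_exp_atBot.comp this).const_mul B
  have h2 : Tendsto (deviationIntegrand Q p x y) atTop (𝓝 0) := by
    refine squeeze_zero_norm' ?_ h1
    filter_upwards [eventually_ge_atTop 0] with t ht
    exact hB x y t ht
  have h3 := h2.add_const (p y)
  simpa [deviationIntegrand] using h3

/-- The deviation matrix in terms of the mean first entrance times. -/
theorem deviationMatrix_eq (hQ : ∀ x y, x ≠ y → 0 ≤ Q x y)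
    (hsum : ∀ x, ∑ y, Q x y = 0) (hirr : IrreducibleRates Q) (hp : IsStationaryVector Q p)
    {m : S → S → ℝ} (hm : ∀ s x, x ≠ s → Q.mulVec (fun z => m z s) x = -1) (x y : S) :
    deviationMatrix Q p x y = (∑ z, p z * m z y - m x y) * p y := by
  let v : S → ℝ := fun x => (∑ z, p z * m z y - m x y) * p y
  have hQv : ∀ x, Q.mulVec v x = p y - if x = y then 1 else 0 := by
    have h1 : ∀ x, Q.mulVec v x = -Q.mulVec (fun z => m z y) x * p y := by
      intro x
      have : ∀ z, Q x z * v z = Q x z * ((∑ z, p z * m z y) * p y) - Q x z * m z y * p y :=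
        fun z => by simp only [v]; ring
      simp only [Matrix.mulVec, dotProduct, this, Finset.sum_sub_distrib, ← Finset.sum_mul, hsum]
      ring
    -- Stationarity determines the row at the target: the other rows are all `-1`, so `p y` times
    -- this row equals `1 - p y`.
    have h2 : ∑ x, p x * Q.mulVec (fun z => m z y) x = 0 := by
      have : p ⬝ᵥ Q.mulVec (fun z => m z y) = 0 := by
        rw [Matrix.dotProduct_mulVec, hp.2.2, zero_dotProduct]
      exact this
    intro x
    rw [h1]
    by_cases hxy : x = y
    · subst hxy
      rw [← Finset.add_sum_erase _ _ (Finset.mem_univ x)] at h2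
      have h3 := hp.2.1
      rw [← Finset.add_sum_erase _ _ (Finset.mem_univ x)] at h3
      have h4 : ∑ z ∈ Finset.univ.erase x, p z * Q.mulVec (fun z => m z x) z =
          ∑ z ∈ Finset.univ.erase x, p z * (-1) :=
        Finset.sum_congr rfl fun z hz => by rw [hm x z (Finset.ne_of_mem_erase hz)]
      rw [h4, ← Finset.sum_mul] at h2
      simp only [if_true]
      linarith
    · rw [hm y x hxy, if_neg hxy]
      ring
  have hpv : ∑ z, p z * v z = 0 := by
    have : ∀ z, p z * v z = p z * ((∑ z, p z * m z y) * p y) - p z * m z y * p y :=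
      fun z => by simp only [v]; ring
    simp only [this, Finset.sum_sub_distrib, ← Finset.sum_mul, hp.2.1]
    ring
  -- Since `exp (t Q)` has row sums one, applying it to `Q v` gives `p y - exp (t Q) x y`, the
  -- negative of the integrand.
  have hderiv : ∀ t ∈ Set.Ici (0 : ℝ),
      HasDerivAt (fun t : ℝ => -(NormedSpace.exp (t • Q)).mulVec v x)
        (deviationIntegrand Q p x y t) t := by
    intro t _
    have h := (hasDerivAt_matrix_exp_mulVec Q v t x).neg
    refine h.congr_deriv ?_
    have e : (NormedSpace.exp (t • Q)).mulVec (Q.mulVec v) x =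
        ∑ z, NormedSpace.exp (t • Q) x z * (p y - if z = y then 1 else 0) :=
      Finset.sum_congr rfl fun z _ => by rw [hQv]
    rw [e]
    simp only [mul_sub, Finset.sum_sub_distrib, ← Finset.sum_mul, matrix_exp_sum_eq_one hsum,
      one_mul, mul_ite, mul_one, mul_zero, Finset.sum_ite_eq', Finset.mem_univ, if_true,
      deviationIntegrand]
    ring
  have hlim : Tendsto (fun t : ℝ => -(NormedSpace.exp (t • Q)).mulVec v x) atTop (𝓝 0) := by
    have h := tendsto_finsetSum Finset.univ fun z (_ : z ∈ Finset.univ) =>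
      (tendsto_matrix_exp_stationary hQ hsum hirr hp x z).mul_const (v z)
    rw [hpv] at h
    simpa [Matrix.mulVec, dotProduct] using h.neg
  have h := integral_Ioi_of_hasDerivAt_of_tendsto' hderiv
    (integrableOn_deviationIntegrand hQ hsum hirr hp x y) hlim
  rw [deviationMatrix, Matrix.of_apply, h]
  simp [v]

end Deviation

lemma unitRow_mulVec {n : ℕ} (j : Fin n) (A : Matrix (Fin n) (Fin n) ℝ) (x : Fin n → ℝ)
    (i : Fin n) : (unitRow j A).mulVec x i = if i = j then -x j else A.mulVec x i := by
  unfold unitRow Matrix.mulVec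
  by_cases h : i = j
  · subst h
    simp [dotProduct, Pi.single_apply]
  · simp [h]

lemma zeroRow_mulVec {n : ℕ} (j : Fin n) (A : Matrix (Fin n) (Fin n) ℝ) (x : Fin n → ℝ)
    (i : Fin n) : (zeroRow j A).mulVec x i = if i = j then 0 else A.mulVec x i := by
  unfold zeroRow Matrix.mulVec
  by_cases h : i = j
  · subst h
    simp [dotProduct]
  · simp [h]

namespace QBD

variable {n : ℕ} (q : QBD n) {C : ℕ}

/-! ### Mean first entrance times of the finite process -/

lemma generator_nonneg (hC : 1 ≤ C) (x y : Fin (C + 1) × Fin n) (h : x ≠ y) :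
    0 ≤ q.generator C x y := (q.finite C hC).rate_nonneg x y h

lemma finite_exitRate_pos (hC : 1 ≤ C) (hfin : IrreducibleRates (q.generator C))
    (x : Fin (C + 1) × Fin n) : 0 < (q.finite C hC).exitRate x := by
  have : Nontrivial (Fin (C + 1) × Fin n) := by
    refine ⟨⟨(0, x.2), (Fin.last C, x.2), fun h => ?_⟩⟩
    have := congrArg Fin.val (congrArg Prod.fst h)
    simp at this
    omega
  exact (q.finite C hC).exitRate_pos_of_irreducible hfin x

/-- The nonnegative finite vector `w = -T⁻¹ 1` satisfies the first-step equations, and mean entrance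
times are the smallest solution. -/
lemma meanEntranceTime_ne_top (hC : 1 ≤ C) (hfin : IrreducibleRates (q.generator C))
    (x s : Fin (C + 1) × Fin n) : (q.finite C hC).meanEntranceTime x s ≠ ∞ := by
  have hQ := q.generator_nonneg hC
  have hsum := q.generator_sum C hC
  let T := absorbAt (q.generator C) s
  have hu : IsUnit T := isUnit_absorbAt hQ hsum hfin s
  have hT : IsTransientGenerator T :=
    isTransientGenerator_of_isUnit (absorbAt_nonneg hQ s) (absorbAt_sum_nonpos hsum s) hu
  let w : Fin (C + 1) × Fin n → ℝ := T⁻¹.mulVec fun _ => -1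
  have hw : T.mulVec w = fun _ => -1 := by
    rw [Matrix.mulVec_mulVec, Matrix.mul_nonsing_inv _ ((Matrix.isUnit_iff_isUnit_det _).1 hu),
      Matrix.one_mulVec]
  have hw0 : ∀ x, 0 ≤ w x := nonneg_of_mulVec_nonpos hT fun x => by rw [hw]; norm_num
  refine ne_top_of_le_ne_top ENNReal.ofReal_ne_top
    ((q.finite C hC).meanEntranceTime_le s (fun x => ENNReal.ofReal (w x)) (fun x hx => ?_) x)
  have he := q.finite_exitRate_pos hC hfin x
  have hI : ∫⁻ z, ENNReal.ofReal (w z) ∂((q.finite C hC).jumpKernel x) ≠ ∞ := by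
    rw [lintegral_fintype]
    exact ENNReal.sum_ne_top.2 fun z _ => ENNReal.mul_ne_top ENNReal.ofReal_ne_top
      (measure_ne_top _ _)
  have h1 := (q.finite C hC).hasSum_rate_mul_toReal he _ hI
  have h2 := h1.unique (hasSum_fintype _)
  have h3 : ∑ z, (q.finite C hC).rate x z * (ENNReal.ofReal (w z)).toReal = -1 := by
    have h4 := congrFun hw x
    rw [absorbAt_mulVec, if_neg hx] at h4
    rw [← h4]
    exact Finset.sum_congr rfl fun z _ => by rw [ENNReal.toReal_ofReal (hw0 z)]; rfl
  rw [h3, ENNReal.toReal_ofReal (hw0 x)] at h2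
  set I := ∫⁻ z, ENNReal.ofReal (w z) ∂((q.finite C hC).jumpKernel x)
  have h5 : w x = ((q.finite C hC).exitRate x)⁻¹ + I.toReal := by
    field_simp
    linarith
  rw [h5, ENNReal.ofReal_add (by positivity) ENNReal.toReal_nonneg, ENNReal.ofReal_toReal hI,
    MarkovGenerator.meanHolding, ENNReal.ofReal_inv_of_pos he]

/-- The mean first entrance times to `s` solve the linear system of the chain absorbed in `s`. -/
lemma generator_mulVec_meanEntranceTime (hC : 1 ≤ C) (hfin : IrreducibleRates (q.generator C))
    (s x : Fin (C + 1) × Fin n) (hx : x ≠ s) :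
    (q.generator C).mulVec (fun z => ((q.finite C hC).meanEntranceTime z s).toReal) x = -1 :=
  (hasSum_fintype _).unique ((q.finite C hC).hasSum_rate_mul_meanEntranceTime
    (q.finite_exitRate_pos hC hfin x) hx (q.meanEntranceTime_ne_top hC hfin x s))

lemma absorbAt_mulVec_meanEntranceTime (hC : 1 ≤ C) (hfin : IrreducibleRates (q.generator C))
    (s : Fin (C + 1) × Fin n) :
    (absorbAt (q.generator C) s).mulVec
      (fun z => ((q.finite C hC).meanEntranceTime z s).toReal) = -(1 - Pi.single s 1) := by
  funext x
  rw [absorbAt_mulVec]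
  by_cases hx : x = s
  · subst hx
    simp [MarkovGenerator.meanEntranceTime_self]
  · rw [if_neg hx, q.generator_mulVec_meanEntranceTime hC hfin s x hx]
    simp [hx]

/-! ### Block rows of the absorbed generator -/

/-- The generator absorbed in phase `j` of level `s`, applied to a function of the level, at the
level `k`. -/
def levelRow (C s : ℕ) (j : Fin n) (F : ℕ → Fin n → ℝ) (k : ℕ) : Fin n → ℝ :=
  if k = 0 then
    (if s = k then unitRow j q.B0 else q.B0).mulVec (F 0) +
      (if s = k then zeroRow j q.Ap else q.Ap).mulVec (F 1)
  else if k = C then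
    (if s = k then zeroRow j q.Am else q.Am).mulVec (F (C - 1)) +
      (if s = k then unitRow j q.C0 else q.C0).mulVec (F C)
  else
    (if s = k then zeroRow j q.Am else q.Am).mulVec (F (k - 1)) +
      (if s = k then unitRow j q.A0 else q.A0).mulVec (F k) +
      (if s = k then zeroRow j q.Ap else q.Ap).mulVec (F (k + 1))

/-- The same for functions of the level with matrix values. -/
def blockRow (C s : ℕ) (j : Fin n) (X : ℕ → Matrix (Fin n) (Fin n) ℝ) (k : ℕ) :
    Matrix (Fin n) (Fin n) ℝ :=
  if k = 0 then
    (if s = k then unitRow j q.B0 else q.B0) * X 0 +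
      (if s = k then zeroRow j q.Ap else q.Ap) * X 1
  else if k = C then
    (if s = k then zeroRow j q.Am else q.Am) * X (C - 1) +
      (if s = k then unitRow j q.C0 else q.C0) * X C
  else
    (if s = k then zeroRow j q.Am else q.Am) * X (k - 1) +
      (if s = k then unitRow j q.A0 else q.A0) * X k +
      (if s = k then zeroRow j q.Ap else q.Ap) * X (k + 1)

lemma blockRow_apply (C s : ℕ) (j : Fin n) (X : ℕ → Matrix (Fin n) (Fin n) ℝ) (k : ℕ)
    (i c : Fin n) : q.blockRow C s j X k i c = q.levelRow C s j (fun k i => X k i c) k i := by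
  unfold blockRow levelRow
  split_ifs <;> rfl

lemma generator_mulVec (hC : 1 ≤ C) (F : ℕ → Fin n → ℝ) (k : Fin (C + 1)) (i : Fin n) :
    (q.generator C).mulVec (fun x => F x.1 x.2) (k, i) =
      if (k : ℕ) = 0 then (q.B0.mulVec (F 0) + q.Ap.mulVec (F 1)) i
      else if (k : ℕ) = C then (q.Am.mulVec (F (C - 1)) + q.C0.mulVec (F C)) i
      else (q.Am.mulVec (F (k - 1)) + q.A0.mulVec (F k) + q.Ap.mulVec (F (k + 1))) i := by
  have hk : (k : ℕ) < C + 1 := k.2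
  let f : ℕ → ℝ := fun l => ∑ j, (if l = (k : ℕ) + 1 then q.Ap i j
    else if l + 1 = k then q.Am i j
    else if l = k then
      (if (k : ℕ) = 0 then q.B0 i j else if (k : ℕ) = C then q.C0 i j else q.A0 i j)
    else 0) * F l j
  have e : (q.generator C).mulVec (fun x => F x.1 x.2) (k, i) =
      ∑ l ∈ Finset.range (C + 1), f l := by
    rw [Matrix.mulVec, dotProduct, Fintype.sum_prod_type, ← Fin.sum_univ_eq_sum_range]
    simp only [f, generator, Matrix.of_apply, Fin.ext_iff]
  have up : f (k + 1) = q.Ap.mulVec (F (k + 1)) i := by simp [f, Matrix.mulVec, dotProduct]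
  have mid : f k = (if (k : ℕ) = 0 then q.B0 else if (k : ℕ) = C then q.C0
      else q.A0).mulVec (F k) i := by
    simp only [f, Matrix.mulVec, dotProduct]
    refine Finset.sum_congr rfl fun j _ => ?_
    have h1 : (k : ℕ) ≠ k + 1 := by omega
    have h2 : (k : ℕ) + 1 ≠ k := by omega
    simp only [h1, h2, if_false, if_true]
    congr 1
    split_ifs <;> rfl
  have other : ∀ l, l ≠ (k : ℕ) + 1 → l + 1 ≠ k → l ≠ k → f l = 0 := by
    intro l h1 h2 h3
    simp [f, h1, h2, h3]
  rw [e]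
  by_cases h0 : (k : ℕ) = 0
  · rw [← Finset.sum_subset (s₁ := {0, 1})]
    · rw [Finset.sum_pair (by norm_num)]
      rw [h0] at up mid
      rw [mid, show f 1 = _ from up]
      simp [h0]
    · intro l hl; simp at hl ⊢; omega
    · intro l _ hl
      simp at hl
      exact other l (by omega) (by omega) (by omega)
  · have down : f (k - 1) = q.Am.mulVec (F (k - 1)) i := by
      have h1 : (k : ℕ) - 1 ≠ k + 1 := by omega
      have h2 : (k : ℕ) - 1 + 1 = k := by omega
      simp only [f, if_neg h1, if_pos h2, Matrix.mulVec, dotProduct]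
    by_cases hkC : (k : ℕ) = C
    · rw [← Finset.sum_subset (s₁ := {(k : ℕ) - 1, (k : ℕ)})]
      · rw [Finset.sum_pair (by omega), down, mid]
        have hC0 : C ≠ 0 := by omega
        simp [hkC, hC0]
      · intro l hl; simp at hl ⊢; omega
      · intro l hl hl'
        simp at hl hl'
        exact other l (by omega) (by omega) (by omega)
    · rw [← Finset.sum_subset (s₁ := {(k : ℕ) - 1, (k : ℕ), (k : ℕ) + 1})]
      · rw [Finset.sum_insert (by simp; omega), Finset.sum_pair (by omega), down, mid, up]
        simp only [if_neg h0, if_neg hkC, Pi.add_apply, add_assoc]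
      · intro l hl; simp at hl ⊢; omega
      · intro l hl hl'
        simp at hl hl'
        exact other l (by omega) (by omega) (by omega)

lemma absorbAt_generator_mulVec (hC : 1 ≤ C) (s : Fin (C + 1)) (j : Fin n)
    (F : ℕ → Fin n → ℝ) (k : Fin (C + 1)) (i : Fin n) :
    (absorbAt (q.generator C) (s, j)).mulVec (fun x => F x.1 x.2) (k, i) =
      q.levelRow C s j F k i := by
  rw [absorbAt_mulVec, q.generator_mulVec hC]
  by_cases hs : (s : ℕ) = k
  · have hks : k = s := Fin.ext hs.symm
    subst hks
    simp only [levelRow, if_true, Prod.mk.injEq, true_and]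
    split_ifs with h1 h2 h3 h4 h5 <;>
      simp_all [unitRow_mulVec, zeroRow_mulVec]
  · have hks : ¬ ((k, i) = (s, j)) := fun h => hs (congrArg Fin.val (congrArg Prod.fst h)).symm
    simp only [levelRow, if_neg hs, if_neg hks]
    split_ifs <;> rfl

lemma flat_mulVec {P : Type*} [Fintype P] {r : ℕ} (K : Matrix (Fin r) (Fin r) (Matrix P P ℝ))
    (x : Fin r × P → ℝ) (a : Fin r) (i : P) :
    (flat K).mulVec x (a, i) = (∑ b, (K a b).mulVec fun j => x (b, j)) i := by
  simp only [flat, Matrix.mulVec, dotProduct, Fintype.sum_prod_type, Finset.sum_apply]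
  rfl

/-- The representation of the mean first entrance times, for a general choice of the levels at
which the chain is observed. -/
theorem factorsThroughRestriction_and_m_eq (hC : 1 ≤ C)
    (hfin : IrreducibleRates (q.generator C)) {r : ℕ} {e : Fin r → Fin (C + 1)}
    (he : Function.Injective e) (h0 : ∃ a, (e a : ℕ) = 0) (hl : ∃ a, (e a : ℕ) = C) (a0 : Fin r)
    (j : Fin n) {X : ℕ → Fin r → Matrix (Fin n) (Fin n) ℝ}
    {Z K : Matrix (Fin r) (Fin r) (Matrix (Fin n) (Fin n) ℝ)} {b : Fin r → Fin n → ℝ}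
    (hKu : IsUnit (flat K)) (hK : ∀ a b, X (e a) b = K a b)
    (hin : ∀ a b, q.blockRow C (e a0) j (fun k => X k b) (e a) = Z a b)
    (hout : ∀ k : ℕ, (∀ a, (e a : ℕ) ≠ k + 1) → k + 1 < C → ∀ b,
      q.Am * X k b + q.A0 * X (k + 1) b + q.Ap * X (k + 2) b = 0)
    (hμ : ∀ a, q.levelRow C (e a0) j (q.mu C) (e a) =
      b a - if a = a0 then 1 - Pi.single j 1 else 1)
    (hμout : ∀ k : ℕ, k + 1 < C → q.Am.mulVec (q.mu C k) + q.A0.mulVec (q.mu C (k + 1)) +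
      q.Ap.mulVec (q.mu C (k + 2)) = -1) :
    FactorsThroughRestriction (absorbAt (q.generator C) (e a0, j)) e Z K ∧
      ∀ k : Fin (C + 1), q.m C hC j k (e a0) =
        ∑ a, (X k a).mulVec (blockSolve Z b a) + q.mu C k := by
  have hQ := q.generator_nonneg hC
  have hsum := q.generator_sum C hC
  have hT := isUnit_absorbAt hQ hsum hfin (e a0, j)
  have hO := isUnit_outerBlock_absorbAt hQ hsum hfin he a0 j
  let V : Fin (C + 1) → Fin r → Matrix (Fin n) (Fin n) ℝ := fun k b => X k b
  have hTV : ∀ k i (c : Fin r × Fin n), (absorbAt (q.generator C) (e a0, j) * flatColumns V) (k, i) c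
      = q.blockRow C (e a0) j (fun k => X k c.1) k i c.2 := by
    intro k i c
    rw [q.blockRow_apply, ← q.absorbAt_generator_mulVec hC]
    rfl
  -- The boundary levels are always observed, so an eliminated level is interior; it also differs
  -- from the target level, so its row is an unmodified interior row.
  have hmidk : ∀ k : Fin (C + 1), (∀ a, e a ≠ k) →
      ∃ l : ℕ, (k : ℕ) = l + 1 ∧ l + 1 < C ∧ ∀ a, (e a : ℕ) ≠ l + 1 := by
    intro k hk
    have hk' : ∀ a, (e a : ℕ) ≠ k := fun a h => hk a (Fin.ext h)
    obtain ⟨a1, h1⟩ := h0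
    obtain ⟨a2, h2⟩ := hl
    have h3 := hk' a1
    have h4 := hk' a2
    have h5 := k.2
    refine ⟨k - 1, by omega, by omega, fun a => ?_⟩
    have := hk' a
    omega
  have hVin : ∀ a i c, (absorbAt (q.generator C) (e a0, j) * flatColumns V) (e a, i) c =
      flat Z (a, i) c := by
    intro a i c
    rw [hTV, hin]
    rfl
  have hVout : ∀ k, (∀ a, e a ≠ k) → ∀ i c,
      (absorbAt (q.generator C) (e a0, j) * flatColumns V) (k, i) c = 0 := by
    intro k hk i c
    obtain ⟨l, h1, h2, h3⟩ := hmidk k hk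
    rw [hTV, h1, blockRow, if_neg (Nat.succ_ne_zero l), if_neg h2.ne, if_neg (h3 a0),
      if_neg (h3 a0), if_neg (h3 a0)]
    exact congrFun (congrFun (hout l h3 h2 c.1) i) c.2
  have hKV : Matrix.of (fun a b => V (e a) b) = K :=
    Matrix.ext fun a b => hK a b
  have hZ : flat Z = restrictToLevels (absorbAt (q.generator C) (e a0, j)) e * flat K := by
    have := flat_eq_restrictToLevels_mul he hO hVin hVout
    rwa [hKV] at this
  have hZu : IsUnit (flat Z) := by
    rw [hZ]
    exact (isUnit_restrictToLevels he hT hO).mul hKu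
  refine ⟨⟨hO, restrictToLevels_isTransientGenerator (absorbAt_nonneg hQ _)
    (absorbAt_sum_nonpos hsum _) he hT hO, hKu, hZu, hZ⟩, fun k => ?_⟩
  funext i
  have hμ1 : ∀ k i, (absorbAt (q.generator C) (e a0, j)).mulVec (fun x => q.mu C x.1 x.2) (k, i) =
      q.levelRow C (e a0) j (q.mu C) k i := q.absorbAt_generator_mulVec hC _ _ _
  have h := eq_flatColumns_mulVec_blockSolve_add hT hVin hVout hZu (b := b)
    (μ := fun x => q.mu C x.1 x.2) (g := 1 - Pi.single (e a0, j) 1)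
    (m := fun z => ((q.finite C hC).meanEntranceTime z (e a0, j)).toReal)
    (fun a i => ?_) (fun k hk i => ?_)
    (q.absorbAt_mulVec_meanEntranceTime hC hfin (e a0, j)) k i
  · simp only [Pi.add_apply, Finset.sum_apply]
    exact h
  · rw [hμ1, hμ]
    by_cases ha : a = a0
    · subst ha
      by_cases hi : i = j
      · subst hi; simp
      · simp [hi]
    · have : (e a, i) ≠ (e a0, j) := fun h => ha (he (congrArg Prod.fst h))
      simp [ha, this]
  · obtain ⟨l, h1, h2, h3⟩ := hmidk k hk
    have hne : (k, i) ≠ (e a0, j) := fun h => hk a0 (congrArg Prod.fst h).symm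
    rw [hμ1, h1, levelRow, if_neg (Nat.succ_ne_zero l), if_neg h2.ne, if_neg (h3 a0),
      if_neg (h3 a0), if_neg (h3 a0)]
    have := congrFun (hμout l h2) i
    simp only [Nat.add_sub_cancel]
    rw [this]
    simp [hne]

/-! ### The particular solution -/

/-- Put `g_l = G ^ l H₀ 1` for `l ≥ 0` and `g_l = Ĝ ^ (-l) H₀ 1` for `l < 0`. This two-sided
sequence is harmonic except at `l = 0`, where the choice of `H₀` gives `-1`. Since `μ_k` is the sum
of `g_(k - l)` over `l = 1, …, C`, each interior level meets the exceptional index exactly once. -/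
lemma mu_interior (hw : LevelWalk q.Am q.A0 q.Ap)
    (hU : IsUnit (q.A0 + q.Ap * q.G + q.Am * q.Ghat)) (k : ℕ) (hk : k + 1 < C) :
    q.Am.mulVec (q.mu C k) + q.A0.mulVec (q.mu C (k + 1)) + q.Ap.mulVec (q.mu C (k + 2)) = -1 := by
  obtain ⟨t, rfl⟩ : ∃ t, C = k + t + 2 := ⟨C - k - 2, by omega⟩
  let a : ℕ → Fin n → ℝ := fun l => (q.G ^ l * q.H0).mulVec 1
  let b : ℕ → Fin n → ℝ := fun l => (q.Ghat ^ l * q.H0).mulVec 1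
  have ha : ∀ l, q.Am.mulVec (a l) + q.A0.mulVec (a (l + 1)) + q.Ap.mulVec (a (l + 2)) = 0 := by
    intro l
    have : q.Am.mulVec ((q.G ^ l).mulVec (q.H0.mulVec 1)) +
        q.A0.mulVec ((q.G ^ (l + 1)).mulVec (q.H0.mulVec 1)) +
        q.Ap.mulVec ((q.G ^ (l + 2)).mulVec (q.H0.mulVec 1)) = 0 :=
      hw.harmonic_pow_mulVec (q.H0.mulVec 1) l
    simpa only [a, ← Matrix.mulVec_mulVec] using this
  have hb : ∀ l, q.Ap.mulVec (b l) + q.A0.mulVec (b (l + 1)) + q.Am.mulVec (b (l + 2)) = 0 := by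
    intro l
    have : q.Ap.mulVec ((q.Ghat ^ l).mulVec (q.H0.mulVec 1)) +
        q.A0.mulVec ((q.Ghat ^ (l + 1)).mulVec (q.H0.mulVec 1)) +
        q.Am.mulVec ((q.Ghat ^ (l + 2)).mulVec (q.H0.mulVec 1)) = 0 :=
      hw.symm.harmonic_pow_mulVec (q.H0.mulVec 1) l
    simpa only [b, ← Matrix.mulVec_mulVec] using this
  -- Increasing `k` by one adds the harmonic combination of the next three terms, so the value is
  -- that at `k = 0`; the sum with powers of `Ĝ` is treated in the same way.
  have e1 : ∀ k, q.Am.mulVec (∑ l ∈ Finset.range k, a l) +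
      q.A0.mulVec (∑ l ∈ Finset.range (k + 1), a l) +
      q.Ap.mulVec (∑ l ∈ Finset.range (k + 2), a l) =
      q.A0.mulVec (a 0) + q.Ap.mulVec (a 0) + q.Ap.mulVec (a 1) := by
    intro k
    induction k with
    | zero => simp [Finset.sum_range_succ, Matrix.mulVec_add, add_assoc]
    | succ k ih =>
      rw [Finset.sum_range_succ a k, Finset.sum_range_succ a (k + 1),
        Finset.sum_range_succ a (k + 2), Matrix.mulVec_add, Matrix.mulVec_add, Matrix.mulVec_add,
        ← ih, ← add_zero (_ + _ + q.Ap.mulVec _), ← ha k]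
      abel
  have e2 : ∀ t, q.Am.mulVec (∑ l ∈ Finset.Icc 1 (t + 2), b l) +
      q.A0.mulVec (∑ l ∈ Finset.Icc 1 (t + 1), b l) +
      q.Ap.mulVec (∑ l ∈ Finset.Icc 1 t, b l) =
      q.Am.mulVec (b 1) - q.Ap.mulVec (b 0) := by
    intro t
    induction t with
    | zero =>
      have h0 := hb 0
      simp only [zero_add] at h0
      rw [Finset.sum_Icc_succ_top (by omega)]
      simp only [zero_add, Finset.Icc_self, Finset.sum_singleton, Matrix.mulVec_add]
      rw [← add_zero (_ - _), ← h0]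
      simp
      abel
    | succ t ih =>
      have hs : ∀ (A : Matrix (Fin n) (Fin n) ℝ) N, A.mulVec (∑ l ∈ Finset.Icc 1 (N + 1), b l) =
          A.mulVec (∑ l ∈ Finset.Icc 1 N, b l) + A.mulVec (b (N + 1)) := fun A N => by
        rw [Finset.sum_Icc_succ_top (by omega), Matrix.mulVec_add]
      calc _ = q.Am.mulVec (∑ l ∈ Finset.Icc 1 (t + 2), b l) + q.Am.mulVec (b (t + 1 + 2)) +
            (q.A0.mulVec (∑ l ∈ Finset.Icc 1 (t + 1), b l) + q.A0.mulVec (b (t + 1 + 1))) +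
            (q.Ap.mulVec (∑ l ∈ Finset.Icc 1 t, b l) + q.Ap.mulVec (b (t + 1))) := by
              rw [hs q.Am (t + 2), hs q.A0 (t + 1), hs q.Ap t]
        _ = q.Am.mulVec (∑ l ∈ Finset.Icc 1 (t + 2), b l) +
              q.A0.mulVec (∑ l ∈ Finset.Icc 1 (t + 1), b l) +
              q.Ap.mulVec (∑ l ∈ Finset.Icc 1 t, b l) + (q.Ap.mulVec (b (t + 1)) +
              q.A0.mulVec (b (t + 1 + 1)) + q.Am.mulVec (b (t + 1 + 2))) := by abel
        _ = _ := by rw [ih, hb, add_zero]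
  have e3 : q.A0.mulVec (a 0) + q.Ap.mulVec (a 0) + q.Ap.mulVec (a 1) +
      (q.Am.mulVec (b 1) - q.Ap.mulVec (b 0)) = -1 := by
    have h1 : (q.A0 + q.Ap * q.G + q.Am * q.Ghat) * q.H0 = -1 := by
      rw [H0, Matrix.mul_neg, Matrix.mul_nonsing_inv _ ((Matrix.isUnit_iff_isUnit_det _).1 hU)]
    have h2 := congrArg (fun A : Matrix (Fin n) (Fin n) ℝ => A.mulVec 1) h1
    simp only [Matrix.neg_mulVec, Matrix.one_mulVec, ← Matrix.mulVec_mulVec, Matrix.add_mulVec] at h2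
    rw [← h2]
    simp only [a, b, pow_zero, pow_one, Matrix.one_mulVec, ← Matrix.mulVec_mulVec]
    abel
  have h1 : k + t + 2 - k = t + 2 := by omega
  have h2 : k + t + 2 - (k + 1) = t + 1 := by omega
  have h3 : k + t + 2 - (k + 2) = t := by omega
  rw [← e3, ← e1 k, ← e2 t]
  simp only [mu, h1, h2, h3, Matrix.mulVec_add]
  abel

end QBD

/-! ### The four positions of the target level -/

namespace QBD

variable {n : ℕ} (q : QBD n) {C : ℕ}

lemma blockRow_zero (C s : ℕ) (j : Fin n) (X : ℕ → Matrix (Fin n) (Fin n) ℝ) :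
    q.blockRow C s j X 0 = (if s = 0 then unitRow j q.B0 else q.B0) * X 0 +
      (if s = 0 then zeroRow j q.Ap else q.Ap) * X 1 := if_pos rfl

lemma blockRow_top (hC : 1 ≤ C) (s : ℕ) (j : Fin n) (X : ℕ → Matrix (Fin n) (Fin n) ℝ) :
    q.blockRow C s j X C = (if s = C then zeroRow j q.Am else q.Am) * X (C - 1) +
      (if s = C then unitRow j q.C0 else q.C0) * X C := by
  rw [blockRow, if_neg (by omega), if_pos rfl]

lemma blockRow_mid {k : ℕ} (hk : k + 1 < C) (s : ℕ) (j : Fin n)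
    (X : ℕ → Matrix (Fin n) (Fin n) ℝ) :
    q.blockRow C s j X (k + 1) = (if s = k + 1 then zeroRow j q.Am else q.Am) * X k +
      (if s = k + 1 then unitRow j q.A0 else q.A0) * X (k + 1) +
      (if s = k + 1 then zeroRow j q.Ap else q.Ap) * X (k + 2) := by
  rw [blockRow, if_neg (by omega), if_neg (by omega)]
  rfl

lemma levelRow_zero (C s : ℕ) (j : Fin n) (F : ℕ → Fin n → ℝ) :
    q.levelRow C s j F 0 = (if s = 0 then unitRow j q.B0 else q.B0).mulVec (F 0) +
      (if s = 0 then zeroRow j q.Ap else q.Ap).mulVec (F 1) := if_pos rfl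

lemma levelRow_top (hC : 1 ≤ C) (s : ℕ) (j : Fin n) (F : ℕ → Fin n → ℝ) :
    q.levelRow C s j F C = (if s = C then zeroRow j q.Am else q.Am).mulVec (F (C - 1)) +
      (if s = C then unitRow j q.C0 else q.C0).mulVec (F C) := by
  rw [levelRow, if_neg (by omega), if_pos rfl]

lemma levelRow_mid {k : ℕ} (hk : k + 1 < C) (s : ℕ) (j : Fin n) (F : ℕ → Fin n → ℝ) :
    q.levelRow C s j F (k + 1) = (if s = k + 1 then zeroRow j q.Am else q.Am).mulVec (F k) +
      (if s = k + 1 then unitRow j q.A0 else q.A0).mulVec (F (k + 1)) +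
      (if s = k + 1 then zeroRow j q.Ap else q.Ap).mulVec (F (k + 2)) := by
  rw [levelRow, if_neg (by omega), if_neg (by omega)]
  rfl

variable {q}

lemma harmonic_pow_G (hw : LevelWalk q.Am q.A0 q.Ap) (k : ℕ) :
    q.Am * q.G ^ k + q.A0 * q.G ^ (k + 1) + q.Ap * q.G ^ (k + 2) = 0 := by
  have h : q.Am + q.A0 * q.G + q.Ap * q.G ^ 2 = 0 := hw.isMinNonnegSolution.1.2
  rw [add_comm k, add_comm k, pow_add, pow_add, pow_one, ← mul_assoc, ← mul_assoc, ← add_mul,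
    ← add_mul, h, zero_mul]

lemma harmonic_pow_Ghat (hw : LevelWalk q.Am q.A0 q.Ap) (k : ℕ) :
    q.Am * q.Ghat ^ (k + 2) + q.A0 * q.Ghat ^ (k + 1) + q.Ap * q.Ghat ^ k = 0 := by
  have h : q.Ap + q.A0 * q.Ghat + q.Am * q.Ghat ^ 2 = 0 := hw.symm.isMinNonnegSolution.1.2
  rw [add_comm k, add_comm k, pow_add, pow_add, pow_one, ← mul_assoc, ← mul_assoc, ← add_mul,
    ← add_mul, add_comm, add_comm (q.Am * _), ← add_assoc, h, zero_mul]

lemma isUnit_flat_of_eq_zero {r : ℕ} {K : Matrix (Fin r) (Fin r) (Matrix (Fin n) (Fin n) ℝ)}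
    (h : ∀ x : Fin r → Fin n → ℝ, (∀ a, ∑ b, (K a b).mulVec (x b) = 0) → ∀ a, x a = 0) :
    IsUnit (flat K) := by
  refine Matrix.mulVec_injective_iff_isUnit.1 ?_
  refine (injective_iff_map_eq_zero (Matrix.mulVecLin _)).2 fun x hx => ?_
  rw [Matrix.mulVecLin_apply] at hx
  have := h (fun a i => x (a, i)) fun a => funext fun i => by rw [← flat_mulVec, hx]; rfl
  exact funext fun z => congrFun (this z.1) z.2

section
variable {c : Fin n → ℝ} {d : ℝ}

lemma isUnit_flat_two (hw : LevelWalk q.Am q.A0 q.Ap)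
    (hd : LevelWalk.IsDrift q.Am q.A0 q.Ap c d) (hne : d ≠ 0) {m : ℕ} (hm : m ≠ 0) :
    IsUnit (flat !![1, q.Ghat ^ m; q.G ^ m, 1]) := by
  refine isUnit_flat_of_eq_zero fun x hx => ?_
  have h0 := hx 0
  have h1 := hx 1
  simp [Fin.sum_univ_two] at h0 h1
  have := hw.eq_zero_of_pow_system hd hne hm h0 h1
  simpa [Fin.forall_fin_two] using this

lemma isUnit_flat_three (hw : LevelWalk q.Am q.A0 q.Ap)
    (hd : LevelWalk.IsDrift q.Am q.A0 q.Ap c d) (hne : d ≠ 0) {m : ℕ} (hm : m ≠ 0) :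
    IsUnit (flat !![1, q.Ghat ^ m, 0; q.G ^ m, 1, 0; 0, 0, 1]) := by
  refine isUnit_flat_of_eq_zero fun x hx => ?_
  have h0 := hx 0
  have h1 := hx 1
  have h2 := hx 2
  simp [Fin.sum_univ_three] at h0 h1 h2
  have := hw.eq_zero_of_pow_system hd hne hm h0 h1
  intro a
  fin_cases a
  exacts [this.1, this.2, h2]

lemma isUnit_flat_four (hw : LevelWalk q.Am q.A0 q.Ap)
    (hd : LevelWalk.IsDrift q.Am q.A0 q.Ap c d) (hne : d ≠ 0) {m m' : ℕ} (hm : m ≠ 0)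
    (hm' : m' ≠ 0) :
    IsUnit (flat !![1, q.Ghat ^ m, 0, 0; q.G ^ m, 1, 0, 0; 0, 0, 1, q.Ghat ^ m';
      0, 0, q.G ^ m', 1]) := by
  refine isUnit_flat_of_eq_zero fun x hx => ?_
  have h0 := hx 0
  have h1 := hx 1
  have h2 := hx 2
  have h3 := hx 3
  simp [Fin.sum_univ_four] at h0 h1 h2 h3
  have := hw.eq_zero_of_pow_system hd hne hm h0 h1
  have h' := hw.eq_zero_of_pow_system hd hne hm' h2 h3
  intro a
  fin_cases a
  exacts [this.1, this.2, h'.1, h'.2]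

/-- With the target at a boundary level, all other levels are interior and untouched, so one pair of
geometric columns works on the whole range. -/
theorem level_zero (hC : 1 ≤ C) (hfin : IrreducibleRates (q.generator C))
    (hw : LevelWalk q.Am q.A0 q.Ap) (hd : LevelWalk.IsDrift q.Am q.A0 q.Ap c d) (hne : d ≠ 0)
    (j : Fin n) :
    FactorsThroughRestriction (absorbAt (q.generator C) (0, j)) ![0, Fin.last C]
        (q.Zzero C j) !![1, q.Ghat ^ C; q.G ^ C, 1] ∧
      ∀ k : Fin (C + 1),
        q.m C hC j k 0 =
          (q.G ^ (k : ℕ)).mulVec (blockSolve (q.Zzero C j) (q.rhsZero C j) 0) +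
          (q.Ghat ^ (C - k)).mulVec (blockSolve (q.Zzero C j) (q.rhsZero C j) 1) +
          q.mu C k := by
  obtain ⟨t, rfl⟩ : ∃ t, C = t + 1 := ⟨C - 1, by omega⟩
  have key := q.factorsThroughRestriction_and_m_eq hC hfin (e := ![0, Fin.last (t + 1)])
    (X := fun k => ![q.G ^ k, q.Ghat ^ (t + 1 - k)]) (b := q.rhsZero (t + 1) j)
    (Z := q.Zzero (t + 1) j) (K := !![1, q.Ghat ^ (t + 1); q.G ^ (t + 1), 1])
    ?_ ⟨0, rfl⟩ ⟨1, rfl⟩ 0 j (isUnit_flat_two hw hd hne (Nat.succ_ne_zero t)) ?_ ?_ ?_ ?_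
    (fun k hk => q.mu_interior hw (hw.isUnit_center hd hne) k hk)
  · refine ⟨key.1, fun k => ?_⟩
    have := key.2 k
    rw [Fin.sum_univ_two] at this
    exact this
  · intro a b
    fin_cases a <;> fin_cases b <;> simp [Fin.ext_iff]
  · intro a b
    fin_cases a <;> fin_cases b <;> simp
  · intro a b
    fin_cases a <;> fin_cases b <;>
      simp [blockRow_zero, q.blockRow_top hC, Zzero, pow_succ', add_mul, mul_assoc]
  · intro k hk hkC b
    obtain ⟨u, rfl⟩ : ∃ u, t = k + u + 1 := ⟨t - k - 1, by omega⟩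
    have h1 : k + u + 1 + 1 - k = u + 2 := by omega
    have h2 : k + u + 1 + 1 - (k + 1) = u + 1 := by omega
    have h3 : k + u + 1 + 1 - (k + 2) = u := by omega
    fin_cases b
    · exact harmonic_pow_G hw k
    · simpa [h1, h2, h3] using harmonic_pow_Ghat hw u
  · intro a
    fin_cases a <;>
      simp [levelRow_zero, q.levelRow_top hC, rhsZero] <;> abel

theorem level_top (hC : 1 ≤ C) (hfin : IrreducibleRates (q.generator C))
    (hw : LevelWalk q.Am q.A0 q.Ap) (hd : LevelWalk.IsDrift q.Am q.A0 q.Ap c d) (hne : d ≠ 0)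
    (j : Fin n) :
    FactorsThroughRestriction (absorbAt (q.generator C) (Fin.last C, j)) ![0, Fin.last C]
        (q.Ztop C j) !![1, q.Ghat ^ C; q.G ^ C, 1] ∧
      ∀ k : Fin (C + 1),
        q.m C hC j k (Fin.last C) =
          (q.G ^ (k : ℕ)).mulVec (blockSolve (q.Ztop C j) (q.rhsTop C j) 0) +
          (q.Ghat ^ (C - k)).mulVec (blockSolve (q.Ztop C j) (q.rhsTop C j) 1) +
          q.mu C k := by
  obtain ⟨t, rfl⟩ : ∃ t, C = t + 1 := ⟨C - 1, by omega⟩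
  have key := q.factorsThroughRestriction_and_m_eq hC hfin (e := ![0, Fin.last (t + 1)])
    (X := fun k => ![q.G ^ k, q.Ghat ^ (t + 1 - k)]) (b := q.rhsTop (t + 1) j)
    (Z := q.Ztop (t + 1) j) (K := !![1, q.Ghat ^ (t + 1); q.G ^ (t + 1), 1])
    ?_ ⟨0, rfl⟩ ⟨1, rfl⟩ 1 j (isUnit_flat_two hw hd hne (Nat.succ_ne_zero t)) ?_ ?_ ?_ ?_
    (fun k hk => q.mu_interior hw (hw.isUnit_center hd hne) k hk)
  · refine ⟨key.1, fun k => ?_⟩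
    have := key.2 k
    rw [Fin.sum_univ_two] at this
    exact this
  · intro a b
    fin_cases a <;> fin_cases b <;> simp [Fin.ext_iff]
  · intro a b
    fin_cases a <;> fin_cases b <;> simp
  · intro a b
    fin_cases a <;> fin_cases b <;>
      simp [blockRow_zero, q.blockRow_top hC, Ztop, pow_succ', add_mul, mul_assoc]
  · intro k hk hkC b
    obtain ⟨u, rfl⟩ : ∃ u, t = k + u + 1 := ⟨t - k - 1, by omega⟩
    have h1 : k + u + 1 + 1 - k = u + 2 := by omega
    have h2 : k + u + 1 + 1 - (k + 1) = u + 1 := by omega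
    have h3 : k + u + 1 + 1 - (k + 2) = u := by omega
    fin_cases b
    · exact harmonic_pow_G hw k
    · simpa [h1, h2, h3] using harmonic_pow_Ghat hw u
  · intro a
    fin_cases a <;>
      simp [levelRow_zero, q.levelRow_top hC, rhsTop] <;> abel

/-- Above the target only level `C` remains. A pair of geometric columns on a single level would
coincide and make `K` singular, so the third column is the identity supported on that level. -/
theorem level_pred (hC : 1 ≤ C) (hfin : IrreducibleRates (q.generator C))
    (hw : LevelWalk q.Am q.A0 q.Ap) (hd : LevelWalk.IsDrift q.Am q.A0 q.Ap c d) (hne : d ≠ 0)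
    (h2 : 2 ≤ C) (h : C - 1 < C + 1) (j : Fin n) :
    FactorsThroughRestriction (absorbAt (q.generator C) (⟨C - 1, h⟩, j))
        ![0, ⟨C - 1, h⟩, Fin.last C]
        (q.Zpred C j)
        !![1, q.Ghat ^ (C - 1), 0;
          q.G ^ (C - 1), 1, 0;
          0, 0, 1] ∧
      ∀ k : Fin (C + 1),
        q.m C hC j k ⟨C - 1, h⟩ =
          (if (k : ℕ) ≤ C - 1 then
            (q.G ^ (k : ℕ)).mulVec (blockSolve (q.Zpred C j) (q.rhsPred C j) 0) +
            (q.Ghat ^ (C - 1 - k)).mulVec (blockSolve (q.Zpred C j) (q.rhsPred C j) 1)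
          else blockSolve (q.Zpred C j) (q.rhsPred C j) 2) +
          q.mu C k := by
  obtain ⟨t, rfl⟩ : ∃ t, C = t + 1 + 1 := ⟨C - 2, by omega⟩
  have key := q.factorsThroughRestriction_and_m_eq hC hfin
    (e := ![0, ⟨t + 1, h⟩, Fin.last (t + 1 + 1)])
    (X := fun k => ![if k ≤ t + 1 then q.G ^ k else 0,
      if k ≤ t + 1 then q.Ghat ^ (t + 1 - k) else 0, if k ≤ t + 1 then 0 else 1])
    (b := q.rhsPred (t + 1 + 1) j) (Z := q.Zpred (t + 1 + 1) j)
    (K := !![1, q.Ghat ^ (t + 1), 0; q.G ^ (t + 1), 1, 0; 0, 0, 1])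
    ?_ ⟨0, rfl⟩ ⟨2, rfl⟩ 1 j (isUnit_flat_three hw hd hne (Nat.succ_ne_zero t)) ?_ ?_ ?_ ?_
    (fun k hk => q.mu_interior hw (hw.isUnit_center hd hne) k hk)
  · refine ⟨key.1, fun k => ?_⟩
    have := key.2 k
    rw [Fin.sum_univ_three] at this
    refine this.trans ?_
    by_cases hk : (k : ℕ) ≤ t + 1 <;> simp [hk]
  · intro a b
    fin_cases a <;> fin_cases b <;> simp [Fin.ext_iff]
  · intro a b
    fin_cases a <;> fin_cases b <;> simp
  · have hm := q.blockRow_mid (C := t + 1 + 1) (k := t) (by omega)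
    have ht := q.blockRow_top hC
    intro a b
    fin_cases a <;> fin_cases b <;>
      simp [blockRow_zero, hm, ht, Zpred, pow_succ', add_mul, mul_assoc]
  · intro k hk hkC b
    have hk1 := hk 1
    simp at hk1
    obtain ⟨u, rfl⟩ : ∃ u, t = k + u + 1 := ⟨t - k - 1, by omega⟩
    have h1 : k + u + 1 + 1 - k = u + 2 := by omega
    have h2 : k + u + 1 + 1 - (k + 1) = u + 1 := by omega
    have h3 : k + u + 1 + 1 - (k + 2) = u := by omega
    have h4 : k ≤ k + u + 1 + 1 := by omega
    have h5 : k + 1 ≤ k + u + 1 + 1 := by omega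
    have h6 : k + 2 ≤ k + u + 1 + 1 := by omega
    fin_cases b
    · simpa [h4, h5, h6] using harmonic_pow_G hw k
    · simpa [h1, h2, h3, h4, h5, h6] using harmonic_pow_Ghat hw u
    · simp [h4, h5, h6]
  · have hm := q.levelRow_mid (C := t + 1 + 1) (k := t) (by omega)
    have ht := q.levelRow_top hC
    intro a
    fin_cases a <;>
      simp [levelRow_zero, hm, ht, rhsPred] <;> abel

/-- The altered row at level `l` forces a break in the ansatz, placed between `l` and `l + 1`. Both
are observed, so every eliminated level sees only one of the two geometric pairs. The bound `l + 2 ≤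
C` makes the upper exponent `C - l - 1` positive, as invertibility of `K` requires. -/
theorem level_mid (hC : 1 ≤ C) (hfin : IrreducibleRates (q.generator C))
    (hw : LevelWalk q.Am q.A0 q.Ap) (hd : LevelWalk.IsDrift q.Am q.A0 q.Ap c d) (hne : d ≠ 0)
    (l : ℕ) (hl : 1 ≤ l) (hlC : l + 2 ≤ C) (h : l < C + 1)
    (h' : l + 1 < C + 1) (j : Fin n) :
    FactorsThroughRestriction (absorbAt (q.generator C) (⟨l, h⟩, j))
        ![0, ⟨l, h⟩, ⟨l + 1, h'⟩, Fin.last C]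
        (q.Zmid C l j)
        !![1, q.Ghat ^ l, 0, 0;
          q.G ^ l, 1, 0, 0;
          0, 0, 1, q.Ghat ^ (C - l - 1);
          0, 0, q.G ^ (C - l - 1), 1] ∧
      ∀ k : Fin (C + 1),
        q.m C hC j k ⟨l, h⟩ =
          (if (k : ℕ) ≤ l then
            (q.G ^ (k : ℕ)).mulVec (blockSolve (q.Zmid C l j) (q.rhsMid C l j) 0) +
            (q.Ghat ^ (l - k)).mulVec (blockSolve (q.Zmid C l j) (q.rhsMid C l j) 1)
          else
            (q.G ^ (k - l - 1)).mulVec (blockSolve (q.Zmid C l j) (q.rhsMid C l j) 2) +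
            (q.Ghat ^ (C - k)).mulVec (blockSolve (q.Zmid C l j) (q.rhsMid C l j) 3)) +
          q.mu C k := by
  obtain ⟨p, rfl⟩ : ∃ p, l = p + 1 := ⟨l - 1, by omega⟩
  obtain ⟨t, rfl⟩ : ∃ t, C = t + (p + 1 + 1 + 1) := ⟨C - (p + 1 + 1 + 1), by omega⟩
  have e1 : t + (p + 1 + 1 + 1) - (p + 1) - 1 = t + 1 := by omega
  have e2 : t + (p + 1 + 1 + 1) - (p + 1) - 2 = t := by omega
  have e3 : t + (p + 1 + 1 + 1) - (p + 1 + 1) = t + 1 := by omega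
  have e4 : t + (p + 1 + 1 + 1) - (p + 1 + 2) = t := by omega
  have e5 : t + (p + 2) - (p + 1) - 1 = t := by omega
  have e6 : t + (p + 1 + 1 + 1) - (t + (p + 2)) = 1 := by omega
  have f1 : p + 1 ≠ t + (p + 1 + 1 + 1) := by omega
  have f2 : p + 1 + 1 ≠ t + (p + 1 + 1 + 1) := by omega
  have f3 : ¬ t + (p + 1 + 1 + 1) ≤ p + 1 := by omega
  have f4 : ¬ t + (p + 2) ≤ p + 1 := by omega
  have key := q.factorsThroughRestriction_and_m_eq hC hfin
    (e := ![0, ⟨p + 1, h⟩, ⟨p + 1 + 1, h'⟩, Fin.last (t + (p + 1 + 1 + 1))])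
    (X := fun k => ![if k ≤ p + 1 then q.G ^ k else 0,
      if k ≤ p + 1 then q.Ghat ^ (p + 1 - k) else 0,
      if k ≤ p + 1 then 0 else q.G ^ (k - (p + 1) - 1),
      if k ≤ p + 1 then 0 else q.Ghat ^ (t + (p + 1 + 1 + 1) - k)])
    (b := q.rhsMid (t + (p + 1 + 1 + 1)) (p + 1) j) (Z := q.Zmid (t + (p + 1 + 1 + 1)) (p + 1) j)
    (K := !![1, q.Ghat ^ (p + 1), 0, 0; q.G ^ (p + 1), 1, 0, 0; 0, 0, 1, q.Ghat ^ (t + 1);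
      0, 0, q.G ^ (t + 1), 1])
    ?_ ⟨0, rfl⟩ ⟨3, rfl⟩ 1 j
    (isUnit_flat_four hw hd hne (Nat.succ_ne_zero p) (Nat.succ_ne_zero t)) ?_ ?_ ?_ ?_
    (fun k hk => q.mu_interior hw (hw.isUnit_center hd hne) k hk)
  · rw [e1]
    refine ⟨key.1, fun k => ?_⟩
    have := key.2 k
    rw [Fin.sum_univ_four] at this
    refine this.trans ?_
    by_cases hk : (k : ℕ) ≤ p + 1 <;> simp [hk]
  · intro a b
    fin_cases a <;> fin_cases b <;> simp [Fin.ext_iff, f1, f2, f1.symm, f2.symm]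
  · intro a b
    fin_cases a <;> fin_cases b <;> simp [e1, e3, f3]
  · have hm := q.blockRow_mid (C := t + (p + 1 + 1 + 1)) (k := p) (by omega)
    have hm' := q.blockRow_mid (C := t + (p + 1 + 1 + 1)) (k := p + 1) (by omega)
    have ht := q.blockRow_top hC
    intro a b
    fin_cases a <;> fin_cases b <;>
      simp [blockRow_zero, hm, hm', ht, Zmid, pow_succ', add_mul, mul_assoc, e1, e2, e3, e4,
        e5, e6, f1, f3, f4] <;> exact add_comm _ _
  · intro k hk hkC b
    have hk1 := hk 1
    have hk2 := hk 2
    simp at hk1 hk2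
    -- The eliminated level is `k + 1`. For `k < p` it and its neighbours lie in the lower piece;
    -- otherwise `k ≥ p + 2`, since levels `p + 1` and `p + 2` are observed, and all three lie in
    -- the upper piece.
    rcases Nat.lt_or_ge k p with hkp | hkp
    · obtain ⟨u, rfl⟩ : ∃ u, p = k + u + 1 := ⟨p - k - 1, by omega⟩
      have h1 : k + u + 1 + 1 - k = u + 2 := by omega
      have h2 : k + u + 1 + 1 - (k + 1) = u + 1 := by omega
      have h3 : k + u + 1 + 1 - (k + 2) = u := by omega
      have h4 : k ≤ k + u + 1 + 1 := by omega
      have h5 : k + 1 ≤ k + u + 1 + 1 := by omega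
      have h6 : k + 2 ≤ k + u + 1 + 1 := by omega
      fin_cases b
      · simpa [h4, h5, h6] using harmonic_pow_G hw k
      · simpa [h1, h2, h3, h4, h5, h6] using harmonic_pow_Ghat hw u
      · simp [h4, h5, h6]
      · simp [h4, h5, h6]
    · obtain ⟨u, rfl⟩ : ∃ u, k = p + 2 + u := ⟨k - p - 2, by omega⟩
      obtain ⟨v, rfl⟩ : ∃ v, t = u + 1 + v := ⟨t - u - 1, by omega⟩
      have h1 : p + 2 + u - (p + 1) - 1 = u := by omega
      have h2 : p + 2 + u + 1 - (p + 1) - 1 = u + 1 := by omega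
      have h3 : p + 2 + u + 2 - (p + 1) - 1 = u + 2 := by omega
      have h4 : ¬ p + 2 + u ≤ p + 1 := by omega
      have h5 : ¬ p + 2 + u + 1 ≤ p + 1 := by omega
      have h6 : ¬ p + 2 + u + 2 ≤ p + 1 := by omega
      have h7 : u + 1 + v + (p + 1 + 1 + 1) - (p + 2 + u) = v + 2 := by omega
      have h8 : u + 1 + v + (p + 1 + 1 + 1) - (p + 2 + u + 1) = v + 1 := by omega
      have h9 : u + 1 + v + (p + 1 + 1 + 1) - (p + 2 + u + 2) = v := by omega
      fin_cases b
      · simp only [h4, h5, h6]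
        simp
      · simp only [h4, h5, h6]
        simp
      · simp only [h1, h2, h3, h4, h5, h6, if_false]
        exact harmonic_pow_G hw u
      · simp only [h7, h8, h9, h4, h5, h6, if_false]
        exact harmonic_pow_Ghat hw v
  · have hm := q.levelRow_mid (C := t + (p + 1 + 1 + 1)) (k := p) (by omega)
    have hm' := q.levelRow_mid (C := t + (p + 1 + 1 + 1)) (k := p + 1) (by omega)
    have ht := q.levelRow_top hC
    intro a
    fin_cases a <;>
      simp [levelRow_zero, hm, hm', ht, rhsMid, f1] <;> abel

end

end QBD

end

/-! ### The proposition -/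

theorem mainTheorem3 {n : ℕ} (q : QBD n) (C : ℕ) (hC : 1 ≤ C)
    (hfin : IrreducibleRates (q.generator C))
    (hunr : IrreducibleRates q.unrestrictedRate)
    (hphase : IrreducibleRates (q.Am + q.A0 + q.Ap))
    (hnnr : q.NonNullRecurrent) :
    -- the objects in the formulas are well defined
    IsMinNonnegSolution q.Am q.A0 q.Ap q.G ∧
    IsMinNonnegSolution q.Ap q.A0 q.Am q.Ghat ∧
    IsUnit (q.A0 + q.Ap * q.G + q.Am * q.Ghat) ∧
    (∀ x y, (q.finite C hC).meanEntranceTime x y ≠ ∞) ∧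
    -- level zero
    (∀ j : Fin n,
      FactorsThroughRestriction (absorbAt (q.generator C) (0, j)) ![0, Fin.last C]
        (q.Zzero C j) !![1, q.Ghat ^ C; q.G ^ C, 1] ∧
      ∀ k : Fin (C + 1),
        q.m C hC j k 0 =
          (q.G ^ (k : ℕ)).mulVec (blockSolve (q.Zzero C j) (q.rhsZero C j) 0) +
          (q.Ghat ^ (C - k)).mulVec (blockSolve (q.Zzero C j) (q.rhsZero C j) 1) +
          q.mu C k) ∧
    -- levels `1 ≤ l ≤ C - 2`
    (∀ (l : ℕ) (_ : 1 ≤ l) (_ : l + 2 ≤ C) (j : Fin n),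
      FactorsThroughRestriction (absorbAt (q.generator C) (⟨l, by omega⟩, j))
        ![0, ⟨l, by omega⟩, ⟨l + 1, by omega⟩, Fin.last C]
        (q.Zmid C l j)
        !![1, q.Ghat ^ l, 0, 0;
          q.G ^ l, 1, 0, 0;
          0, 0, 1, q.Ghat ^ (C - l - 1);
          0, 0, q.G ^ (C - l - 1), 1] ∧
      ∀ k : Fin (C + 1),
        q.m C hC j k ⟨l, by omega⟩ =
          (if (k : ℕ) ≤ l then
            (q.G ^ (k : ℕ)).mulVec (blockSolve (q.Zmid C l j) (q.rhsMid C l j) 0) +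
            (q.Ghat ^ (l - k)).mulVec (blockSolve (q.Zmid C l j) (q.rhsMid C l j) 1)
          else
            (q.G ^ (k - l - 1)).mulVec (blockSolve (q.Zmid C l j) (q.rhsMid C l j) 2) +
            (q.Ghat ^ (C - k)).mulVec (blockSolve (q.Zmid C l j) (q.rhsMid C l j) 3)) +
          q.mu C k) ∧
    -- level `C - 1`, when it is not level zero
    (∀ (_ : 2 ≤ C) (j : Fin n),
      FactorsThroughRestriction (absorbAt (q.generator C) (⟨C - 1, by omega⟩, j))
        ![0, ⟨C - 1, by omega⟩, Fin.last C]
        (q.Zpred C j)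
        !![1, q.Ghat ^ (C - 1), 0;
          q.G ^ (C - 1), 1, 0;
          0, 0, 1] ∧
      ∀ k : Fin (C + 1),
        q.m C hC j k ⟨C - 1, by omega⟩ =
          (if (k : ℕ) ≤ C - 1 then
            (q.G ^ (k : ℕ)).mulVec (blockSolve (q.Zpred C j) (q.rhsPred C j) 0) +
            (q.Ghat ^ (C - 1 - k)).mulVec (blockSolve (q.Zpred C j) (q.rhsPred C j) 1)
          else blockSolve (q.Zpred C j) (q.rhsPred C j) 2) +
          q.mu C k) ∧
    -- level `C`
    (∀ j : Fin n,
      FactorsThroughRestriction (absorbAt (q.generator C) (Fin.last C, j)) ![0, Fin.last C]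
        (q.Ztop C j) !![1, q.Ghat ^ C; q.G ^ C, 1] ∧
      ∀ k : Fin (C + 1),
        q.m C hC j k (Fin.last C) =
          (q.G ^ (k : ℕ)).mulVec (blockSolve (q.Ztop C j) (q.rhsTop C j) 0) +
          (q.Ghat ^ (C - k)).mulVec (blockSolve (q.Ztop C j) (q.rhsTop C j) 1) +
          q.mu C k) ∧
    -- the blocks of the deviation matrix
    (∀ p : Fin (C + 1) × Fin n → ℝ, IsStationaryVector (q.generator C) p →
      (∀ x y, IntegrableOn (deviationIntegrand (q.generator C) p x y) (Set.Ioi 0)) ∧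
      ∀ k l : Fin (C + 1),
        (deviationMatrix (q.generator C) p).submatrix (Prod.mk k) (Prod.mk l) =
          (Matrix.vecMulVec 1 (∑ x, Matrix.vecMul (fun i => p (x, i)) (q.M C hC x l)) -
            q.M C hC k l) * Matrix.diagonal fun j => p (l, j)) := by

  have hw := q.levelWalk hphase
  obtain ⟨c, d, hd, hne⟩ := q.exists_isDrift_ne_zero hphase hunr hnnr
  refine ⟨hw.isMinNonnegSolution, hw.symm.isMinNonnegSolution, hw.isUnit_center hd hne,
    q.meanEntranceTime_ne_top hC hfin, QBD.level_zero hC hfin hw hd hne,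
    fun l hl hlC => QBD.level_mid hC hfin hw hd hne l hl hlC _ _, fun h2 => QBD.level_pred hC hfin hw hd hne h2 _,
    QBD.level_top hC hfin hw hd hne, fun p hp => ⟨integrableOn_deviationIntegrand
      (q.generator_nonneg hC) (q.generator_sum C hC) hfin hp, fun k l => ?_⟩⟩
  ext i j
  have h := deviationMatrix_eq (q.generator_nonneg hC) (q.generator_sum C hC) hfin hp
    (m := fun x s => ((q.finite C hC).meanEntranceTime x s).toReal)
    (q.generator_mulVec_meanEntranceTime hC hfin) (k, i) (l, j)
  rw [Matrix.submatrix_apply, h, Matrix.mul_diagonal, Fintype.sum_prod_type]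
  simp [Matrix.vecMul, dotProduct, QBD.M, Finset.sum_apply]
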